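/- Conventions. A positive Lebesgue measurable function $b$ on $(0,\infty)$ is slowly varying ($b\in SV$) if for every $\varepsilon>0$ the function $t^{\varepsilon}b(t)$ is equivalent to an increasing function and $t^{-\varepsilon}b(t)$ is equivalent to a decreasing function (two positive functions are equivalent if each is bounded by a constant multiple of the other). $\|\cdot\|_{q,(c,d)}$ is the usual (quasi-)norm of $L_q(c,d)$, $0<q\le\infty$, and $1/\infty=0$. Let $\bar A=(A_0,A_1)$ be a compatible couple of (quasi-)Banach spaces (both continuously embedded in one Hausdorff topological vector space) with $A_0\cap A_1\ne\{0\}$, and let $K(t,f)=K(t,f;A_0,A_1)=\inf\{\|f_0\|_{A_0}+t\|f_1\|_{A_1}: f=f_0+f_1,\ f_i\in A_i\}$ for $f\in A_0+A_1$, $t>0$. The following spaces consist of all $f\in A_0+A_1$ with finite indicated (quasi-)norm: - $\bar A_{\theta,q;b}$: $\ \|u^{-\theta-1/q}b(u)K(u,f)\|_{q,(0,\infty)}$; - $\bar A^{\mathcal L}_{\theta,r,b,q,a}$: $\ \big\|t^{-1/r}b(t)\|u^{-\theta-1/q}a(u)K(u,f)\|_{q,(0,t)}\big\|_{r,(0,\infty)}$;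 - $\bar A^{\mathcal R}_{\theta,r,b,q,a}$: $\ \big\|t^{-1/r}b(t)\|u^{-\theta-1/q}a(u)K(u,f)\|_{q,(t,\infty)}\big\|_{r,(0,\infty)}$; - $\bar A^{\mathcal L,\mathcal R}_{\theta,s,c,r,b,q,a}$: $\ \Big\|t^{-1/s}c(t)\big\|u^{-1/r}b(u)\|v^{-\theta-1/q}a(v)K(v,f)\|_{q,(t,u)}\big\|_{r,(t,\infty)}\Big\|_{s,(0,\infty)}$; - $\bar A^{\mathcal R,\mathcal L}_{\theta,s,c,r,b,q,a}$: $\ \Big\|t^{-1/s}c(t)\big\|u^{-1/r}b(u)\|v^{-\theta-1/q}a(v)K(v,f)\|_{q,(u,t)}\big\|_{r,(0,t)}\Big\|_{s,(0,\infty)}$. For a couple $(X_0,X_1)$ of such spaces, $(X_0,X_1)_{\theta,r,a}$ denotes the first of these constructions applied with the $K$-functional of $(X_0,X_1)$. Equality of spaces means equality as sets with equivalent (quasi-)norms. Theorem. Let $0<\theta_0<1$, $0<r,r_0,q_0,r_1,q_1\le\infty$ and $a,a_0,b_0,a_1,b_1\in SV$, and suppose that $$\|s^{-1/r_0}b_0(s)\|_{r_0,(0,1)}<\infty,\qquad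 \|s^{-1/r_1}b_1(s)\|_{r_1,(1,\infty)}<\infty,\qquad \big\|s^{-1/r_1}b_1(s)\|u^{-1/q_1}a_1(u)\|_{q_1,(0,s)}\big\|_{r_1,(0,1)}<\infty .$$ Put, for $t>0$, $$\chi_0(t)=a_0(t)\,\|s^{-1/r_0}b_0(s)\|_{r_0,(0,t)},$$ $$\chi_1(t)=\big\|s^{-1/r_1}b_1(s)\|u^{-1/q_1}a_1(u)\|_{q_1,(0,s)}\big\|_{r_1,(0,t)}+\|s^{-1/r_1}b_1(s)\|_{r_1,(t,\infty)}\,\|u^{-1/q_1}a_1(u)\|_{q_1,(0,t)},$$ and $\rho(t)=t^{1-\theta_0}\chi_0(t)/\chi_1(t)$. For $0\le\theta\le1$ let $a^{\#}=\chi_0^{1-\theta}\,\chi_1^{\theta}\,(a\circ\rho)$ and $\eta=(1-\theta)\theta_0+\theta$. (i) If $0<\theta<1$, then $$\big(\bar A^{\mathcal R}_{\theta_0,r_0,b_0,q_0,a_0},\ \bar A^{\mathcal L}_{1,r_1,b_1,q_1,a_1}\big)_{\theta,r,a}=\bar A_{\eta,r;a^{\#}}.$$ (ii) If $\|s^{-1/r}a(s)\|_{r,(1,\infty)}<\infty$,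 then $$\big(\bar A^{\mathcal R}_{\theta_0,r_0,b_0,q_0,a_0},\ \bar A^{\mathcal L}_{1,r_1,b_1,q_1,a_1}\big)_{0,r,a}=\bar A^{\mathcal R,\mathcal L}_{\theta_0,r,a\circ\rho,r_0,b_0,q_0,a_0}.$$ (iii) If $\|s^{-1/r}a(s)\|_{r,(0,1)}<\infty$, then, with $a^{\#}=\chi_1\,(a\circ\rho)$ (the case $\theta=1$), $$\big(\bar A^{\mathcal R}_{\theta_0,r_0,b_0,q_0,a_0},\ \bar A^{\mathcal L}_{1,r_1,b_1,q_1,a_1}\big)_{1,r,a}=\bar A_{1,r;a^{\#}}\cap\bar A^{\mathcal L,\mathcal R}_{1,r,a\circ\rho,r_1,b_1,q_1,a_1}.$$ -/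

import Mathlib

open MeasureTheory Set Filter Topology
open scoped ENNReal NNReal

namespace LimitingInterpolation

/-- Two functions that are positive on `(0, ∞)` are equivalent there: each is bounded by a constant
multiple of the other. -/
def EquivPos (f g : ℝ → ℝ) : Prop :=
  ∃ C : ℝ, 0 < C ∧ ∀ t : ℝ, 0 < t → f t ≤ C * g t ∧ g t ≤ C * f t

/-- `b ∈ SV`: `b` is positive and Lebesgue measurable on `(0, ∞)` and, for each `ε > 0`, the function
`t ^ ε * b t` is equivalent to an increasing function and `t ^ (-ε) * b t` to a decreasing one. -/
def SlowlyVarying (b : ℝ → ℝ) : Prop :=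
  (∀ t : ℝ, 0 < t → 0 < b t) ∧ AEMeasurable b (volume.restrict (Ioi 0)) ∧
    ∀ ε : ℝ, 0 < ε →
      (∃ g : ℝ → ℝ, MonotoneOn g (Ioi 0) ∧ EquivPos (fun t => t ^ ε * b t) g) ∧
      (∃ h : ℝ → ℝ, AntitoneOn h (Ioi 0) ∧ EquivPos (fun t => t ^ (-ε) * b t) h)

/-- A quasi-Banach space continuously embedded in the topological vector space `E`. It is given by its
quasi-norm, extended by `∞` outside the space; the space itself is `{x | qnorm x < ∞}`. Two such spaces
in the same Hausdorff `E` form a compatible couple. -/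
structure QuasiBanachIn (𝕜 E : Type*) [RCLike 𝕜] [AddCommGroup E] [Module 𝕜 E]
    [TopologicalSpace E] where
  /-- The quasi-norm, with value `∞` outside the space. -/
  qnorm : E → ℝ≥0∞
  eq_zero_of_qnorm : ∀ x : E, qnorm x = 0 → x = 0
  qnorm_smul : ∀ (c : 𝕜) (x : E), qnorm (c • x) = ‖c‖ₑ * qnorm x
  quasi_triangle : ∃ C : ℝ≥0, ∀ x y : E, qnorm (x + y) ≤ C * (qnorm x + qnorm y)
  continuous_incl : ∀ U ∈ 𝓝 (0 : E), ∃ δ : ℝ≥0∞, 0 < δ ∧ ∀ x : E, qnorm x < δ → x ∈ U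
  complete : ∀ x : ℕ → E, (∀ n, qnorm (x n) < ∞) →
    (∀ ε : ℝ≥0∞, 0 < ε → ∃ N : ℕ, ∀ m ≥ N, ∀ n ≥ N, qnorm (x m - x n) < ε) →
    ∃ y : E, qnorm y < ∞ ∧ Tendsto (fun n => qnorm (x n - y)) atTop (𝓝 0)

/-- The (quasi-)norm `‖u ^ (α - 1/q) w(u) F(u)‖` in `L_q(S)`, `0 < q ≤ ∞`, with `1/∞ = 0`. -/
noncomputable def wnorm (q : ℝ≥0∞) (α : ℝ) (S : Set ℝ) (w : ℝ → ℝ) (F : ℝ → ℝ≥0∞) : ℝ≥0∞ :=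
  eLpNorm (fun u : ℝ => ENNReal.ofReal (u ^ (α - (q⁻¹).toReal) * w u) * F u) q (volume.restrict S)

section Spaces

variable {E : Type*} [AddCommGroup E]

/-! Quasi-normed spaces of elements of `E` are given by their quasi-norms, with value `∞` outside the
space. In the definitions below `N₀` and `N₁` are the quasi-norms of the two spaces of a couple. -/

/-- Peetre's `K`-functional `K(t, f) = inf (‖f₀‖₀ + t ‖f₁‖₁)` over `f = f₀ + f₁`. It is `∞` when `f`
does not belong to the sum of the two spaces. -/
noncomputable def peetreK (N₀ N₁ : E → ℝ≥0∞) (t : ℝ) (f : E) : ℝ≥0∞ :=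
  ⨅ (f₀ : E) (f₁ : E) (_ : f = f₀ + f₁), N₀ f₀ + ENNReal.ofReal t * N₁ f₁

/-- The quasi-norm of the standard space `(A₀, A₁)_{θ,q;b}`:
`‖u ^ (-θ-1/q) b(u) K(u,f)‖_{q,(0,∞)}`. -/
noncomputable def stdNorm (N₀ N₁ : E → ℝ≥0∞) (θ : ℝ) (q : ℝ≥0∞) (b : ℝ → ℝ) (f : E) : ℝ≥0∞ :=
  wnorm q (-θ) (Ioi 0) b (fun u => peetreK N₀ N₁ u f)

/-- The quasi-norm of the limiting space `(A₀, A₁)^𝓛_{θ,r,b,q,a}`: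
`‖t ^ (-1/r) b(t) ‖u ^ (-θ-1/q) a(u) K(u,f)‖_{q,(0,t)}‖_{r,(0,∞)}`. -/
noncomputable def normL (N₀ N₁ : E → ℝ≥0∞) (θ : ℝ) (r : ℝ≥0∞) (b : ℝ → ℝ) (q : ℝ≥0∞)
    (a : ℝ → ℝ) (f : E) : ℝ≥0∞ :=
  wnorm r 0 (Ioi 0) b fun t => wnorm q (-θ) (Ioo 0 t) a fun u => peetreK N₀ N₁ u f

/-- The quasi-norm of the limiting space `(A₀, A₁)^𝓡_{θ,r,b,q,a}`:
`‖t ^ (-1/r) b(t) ‖u ^ (-θ-1/q) a(u) K(u,f)‖_{q,(t,∞)}‖_{r,(0,∞)}`. -/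
noncomputable def normR (N₀ N₁ : E → ℝ≥0∞) (θ : ℝ) (r : ℝ≥0∞) (b : ℝ → ℝ) (q : ℝ≥0∞)
    (a : ℝ → ℝ) (f : E) : ℝ≥0∞ :=
  wnorm r 0 (Ioi 0) b fun t => wnorm q (-θ) (Ioi t) a fun u => peetreK N₀ N₁ u f

/-- The quasi-norm of the extremal space `(A₀, A₁)^{𝓛,𝓡}_{θ,s,c,r,b,q,a}`: `‖t ^ (-1/s) c(t)
‖u ^ (-1/r) b(u) ‖v ^ (-θ-1/q) a(v) K(v,f)‖_{q,(t,u)}‖_{r,(t,∞)}‖_{s,(0,∞)}`. -/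
noncomputable def normLR (N₀ N₁ : E → ℝ≥0∞) (θ : ℝ) (s : ℝ≥0∞) (c : ℝ → ℝ) (r : ℝ≥0∞)
    (b : ℝ → ℝ) (q : ℝ≥0∞) (a : ℝ → ℝ) (f : E) : ℝ≥0∞ :=
  wnorm s 0 (Ioi 0) c fun t => wnorm r 0 (Ioi t) b fun u =>
    wnorm q (-θ) (Ioo t u) a fun v => peetreK N₀ N₁ v f

/-- The quasi-norm of the extremal space `(A₀, A₁)^{𝓡,𝓛}_{θ,s,c,r,b,q,a}`: `‖t ^ (-1/s) c(t)
‖u ^ (-1/r) b(u) ‖v ^ (-θ-1/q) a(v) K(v,f)‖_{q,(u,t)}‖_{r,(0,t)}‖_{s,(0,∞)}`. -/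
noncomputable def normRL (N₀ N₁ : E → ℝ≥0∞) (θ : ℝ) (s : ℝ≥0∞) (c : ℝ → ℝ) (r : ℝ≥0∞)
    (b : ℝ → ℝ) (q : ℝ≥0∞) (a : ℝ → ℝ) (f : E) : ℝ≥0∞ :=
  wnorm s 0 (Ioi 0) c fun t => wnorm r 0 (Ioo 0 t) b fun u =>
    wnorm q (-θ) (Ioo u t) a fun v => peetreK N₀ N₁ v f

/-- The quasi-norm of the intersection of two spaces. -/
noncomputable def interNorm (N M : E → ℝ≥0∞) (f : E) : ℝ≥0∞ := max (N f) (M f)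

/-- `X ⊂ Y`: the space with quasi-norm `N` is contained in the space with quasi-norm `M`, and the
inclusion is bounded. -/
def Embeds (N M : E → ℝ≥0∞) : Prop :=
  (∀ f : E, N f < ∞ → M f < ∞) ∧ ∃ C : ℝ≥0, ∀ f : E, N f < ∞ → M f ≤ C * N f

/-- `X = Y`: the two spaces coincide, with equivalent quasi-norms. -/
def SpaceEq (N M : E → ℝ≥0∞) : Prop := Embeds N M ∧ Embeds M N

end Spaces

/-- `χ₀(t) = a₀(t) ‖s ^ (-1/r₀) b₀(s)‖_{r₀,(0,t)}`. -/
noncomputable def chi0 (r₀ : ℝ≥0∞) (b₀ a₀ : ℝ → ℝ) (t : ℝ) : ℝ :=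
  a₀ t * (wnorm r₀ 0 (Ioo 0 t) b₀ fun _ => 1).toReal

/-- `χ₁(t) = ‖s ^ (-1/r₁) b₁(s) ‖u ^ (-1/q₁) a₁(u)‖_{q₁,(0,s)}‖_{r₁,(0,t)}
+ ‖s ^ (-1/r₁) b₁(s)‖_{r₁,(t,∞)} ‖u ^ (-1/q₁) a₁(u)‖_{q₁,(0,t)}`. -/
noncomputable def chi1 (r₁ : ℝ≥0∞) (b₁ : ℝ → ℝ) (q₁ : ℝ≥0∞) (a₁ : ℝ → ℝ) (t : ℝ) : ℝ :=
  ((wnorm r₁ 0 (Ioo 0 t) b₁ fun s => wnorm q₁ 0 (Ioo 0 s) a₁ fun _ => 1) +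
    (wnorm r₁ 0 (Ioi t) b₁ fun _ => 1) * (wnorm q₁ 0 (Ioo 0 t) a₁ fun _ => 1)).toReal

/-- `ρ(t) = t ^ (1-θ₀) χ₀(t) / χ₁(t)`. -/
noncomputable def rho (θ₀ : ℝ) (χ₀ χ₁ : ℝ → ℝ) (t : ℝ) : ℝ := t ^ (1 - θ₀) * (χ₀ t / χ₁ t)

/-- `a^# = χ₀ ^ (1-θ) · χ₁ ^ θ · (a ∘ ρ)`. -/
noncomputable def aSharp (θ : ℝ) (χ₀ χ₁ ρ a : ℝ → ℝ) (t : ℝ) : ℝ :=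
  χ₀ t ^ (1 - θ) * χ₁ t ^ θ * a (ρ t)

end LimitingInterpolation

open LimitingInterpolation

namespace LimitingInterpolation

/-! All the spaces see `f` only through k(u) = K(u, f), which is nondecreasing while k(u)/u is
nonincreasing. The heart of the matter is a Holmstedt formula: the K-functional of (𝓡, 𝓛) at ρ(t) is
equivalent to I₀(t) + t^(-θ₀) χ₀(t) k(t) + ρ(t) I₁(t), where I₀ is the 𝓡-norm truncated to (0, t)
and I₁ the 𝓛-norm truncated to (t, ∞). For the upper bound, `f` is split near-optimally at t; the
K-functionals of the two parts are controlled by k(min(u, t)) and by the function equal to (u/t)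
k(t) up to t and to k beyond (`exists_decomposition`). For the lower bound, the expression is
quasi-subadditive in `f` and is dominated by the 𝓡-norm as well as by ρ(t) times the 𝓛-norm
(`holmstedt_le_X₀`, `holmstedt_le_X₁`). The function ρ is the ratio for which the middle terms seen
from both spaces agree.

The substitution u = ρ(t) turns the interpolation norm into a norm of this sum with weight ρ^(-θ)
a(ρ), of index -(1-θ₀)θ. Although ρ need be neither monotone nor smooth, its positive index 1-θ₀
suffices (`mnorm_comp_le`, `mnorm_le_comp`). A Hardy inequality absorbs I₀ into the middle term when
θ > 0 (`hardy_I₀`), another absorbs I₁ when θ < 1 (`hardy_I₁`), and the middle term carries the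
weight t^(-η) a^#. For 0 < θ < 1 only the middle term survives. For θ = 0 the I₁ term disappears and
I₀ dominates the middle term pointwise, which leaves the 𝓡,𝓛 space. For θ = 1 the I₀ term
disappears; the middle term and I₁ stay, hence the intersection.

Weights enter through Potter bounds only (`RegVary`). Hardy inequalities and substitution both come
from one dyadic Schur test, `PowerLike.mnorm_le`, valid for every 0 < r ≤ ∞. -/

/-! ### Regularly varying weights. -/

/-- Two-sided Potter bounds of index `α`. -/
structure RegVary (α : ℝ) (w : ℝ → ℝ) : Prop where
  pos : ∀ t : ℝ, 0 < t → 0 < w t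
  bound : ∀ ε : ℝ, 0 < ε → ∃ C : ℝ, 0 < C ∧ ∀ s t : ℝ, 0 < s → s ≤ t →
    w t ≤ C * (t / s) ^ (α + ε) * w s ∧ w s ≤ C * (t / s) ^ (ε - α) * w t

/-- Passing to the monotone function and back costs the equivalence constant twice, hence the
squares. The decreasing comparison bounds the growth of `b`, the increasing one its decay. -/
theorem SlowlyVarying.regVary {b : ℝ → ℝ} (hb : SlowlyVarying b) : RegVary 0 b := by
  refine ⟨hb.1, fun ε hε => ?_⟩
  obtain ⟨⟨g, hg, C, hC, hgC⟩, ⟨h, hh, D, hD, hhD⟩⟩ := hb.2.2 ε hε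
  refine ⟨max (C * C) (D * D), lt_max_of_lt_left (by positivity), fun s t hs hst => ?_⟩
  have ht : 0 < t := hs.trans_le hst
  have hbs := hb.1 s hs
  have hbt := hb.1 t ht
  constructor
  · have h1 : t ^ (-ε) * b t ≤ D * D * (s ^ (-ε) * b s) := by
      calc t ^ (-ε) * b t ≤ D * h t := (hhD t ht).1
        _ ≤ D * h s := by gcongr; exact hh hs ht hst
        _ ≤ D * (D * (s ^ (-ε) * b s)) := by gcongr; exact (hhD s hs).2
        _ = _ := by ring
    have h2 : b t ≤ D * D * (t / s) ^ (0 + ε) * b s := by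
      rw [zero_add, Real.div_rpow ht.le hs.le]
      rw [Real.rpow_neg ht.le, Real.rpow_neg hs.le] at h1
      have := Real.rpow_pos_of_pos ht ε
      have := Real.rpow_pos_of_pos hs ε
      field_simp at h1 ⊢
      linarith
    refine h2.trans ?_
    gcongr
    exact le_max_right _ _
  · have h1 : s ^ ε * b s ≤ C * C * (t ^ ε * b t) := by
      calc s ^ ε * b s ≤ C * g s := (hgC s hs).1
        _ ≤ C * g t := by gcongr; exact hg hs ht hst
        _ ≤ C * (C * (t ^ ε * b t)) := by gcongr; exact (hgC t ht).2
        _ = _ := by ring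
    have h2 : b s ≤ C * C * (t / s) ^ (ε - 0) * b t := by
      rw [sub_zero, Real.div_rpow ht.le hs.le]
      have := Real.rpow_pos_of_pos ht ε
      have := Real.rpow_pos_of_pos hs ε
      field_simp at h1 ⊢
      linarith
    refine h2.trans ?_
    gcongr
    exact le_max_left _ _

namespace RegVary

theorem mul {α β : ℝ} {v w : ℝ → ℝ} (hv : RegVary α v) (hw : RegVary β w) :
    RegVary (α + β) fun t => v t * w t := by
  refine ⟨fun t ht => mul_pos (hv.pos t ht) (hw.pos t ht), fun ε hε => ?_⟩
  obtain ⟨C, hC, h⟩ := hv.bound (ε / 2) (by positivity)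
  obtain ⟨D, hD, h'⟩ := hw.bound (ε / 2) (by positivity)
  refine ⟨C * D, by positivity, fun s t hs hst => ?_⟩
  have ht := hs.trans_le hst
  have hq : 0 < t / s := by positivity
  have := hv.pos s hs
  have := hv.pos t ht
  have := hw.pos s hs
  have := hw.pos t ht
  constructor
  · calc v t * w t ≤ (C * (t / s) ^ (α + ε / 2) * v s) * (D * (t / s) ^ (β + ε / 2) * w s) := by
          gcongr
          · exact (h s t hs hst).1
          · exact (h' s t hs hst).1
      _ = C * D * ((t / s) ^ (α + ε / 2) * (t / s) ^ (β + ε / 2)) * (v s * w s) := by ring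
      _ = _ := by rw [← Real.rpow_add hq]; ring_nf
  · calc v s * w s ≤ (C * (t / s) ^ (ε / 2 - α) * v t) * (D * (t / s) ^ (ε / 2 - β) * w t) := by
          gcongr
          · exact (h s t hs hst).2
          · exact (h' s t hs hst).2
      _ = C * D * ((t / s) ^ (ε / 2 - α) * (t / s) ^ (ε / 2 - β)) * (v t * w t) := by ring
      _ = _ := by rw [← Real.rpow_add hq]; ring_nf

theorem inv {α : ℝ} {w : ℝ → ℝ} (hw : RegVary α w) : RegVary (-α) fun t => (w t)⁻¹ := by
  refine ⟨fun t ht => inv_pos.2 (hw.pos t ht), fun ε hε => ?_⟩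
  obtain ⟨C, hC, h⟩ := hw.bound ε hε
  refine ⟨C, hC, fun s t hs hst => ?_⟩
  have ht := hs.trans_le hst
  have hs' := hw.pos s hs
  have ht' := hw.pos t ht
  have h1 := h s t hs hst
  rw [← div_eq_mul_inv, le_div_iff₀ hs', inv_mul_le_iff₀ ht', ← div_eq_mul_inv, le_div_iff₀ ht',
    inv_mul_le_iff₀ hs', sub_neg_eq_add, add_comm ε, neg_add_eq_sub, mul_comm (w t),
    mul_comm (w s)]
  exact ⟨h1.2, h1.1⟩

theorem rpow {α : ℝ} {w : ℝ → ℝ} (hw : RegVary α w) {c : ℝ} (hc : 0 ≤ c) :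
    RegVary (α * c) fun t => w t ^ c := by
  refine ⟨fun t ht => Real.rpow_pos_of_pos (hw.pos t ht) c, fun ε hε => ?_⟩
  -- Dividing by c + 1 rather than c keeps the case c = 0.
  obtain ⟨C, hC, h⟩ := hw.bound (ε / (c + 1)) (by positivity)
  refine ⟨C ^ c, by positivity, fun s t hs hst => ?_⟩
  have ht := hs.trans_le hst
  have hq : 1 ≤ t / s := (one_le_div hs).2 hst
  have hws := hw.pos s hs
  have hwt := hw.pos t ht
  have hce : ε / (c + 1) * c ≤ ε := by
    rw [div_mul_eq_mul_div, div_le_iff₀ (by positivity)]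
    nlinarith
  have aux : ∀ x y β : ℝ, 0 < x → 0 < y → x ≤ C * (t / s) ^ β * y →
      x ^ c ≤ C ^ c * (t / s) ^ (β * c) * y ^ c := by
    intro x y β hx hy hxy
    calc x ^ c ≤ (C * (t / s) ^ β * y) ^ c := by gcongr
      _ = _ := by
        rw [Real.mul_rpow (by positivity) hy.le, Real.mul_rpow hC.le (by positivity),
          ← Real.rpow_mul (by positivity)]
  constructor
  · refine (aux _ _ _ hwt hws (h s t hs hst).1).trans ?_
    gcongr
    linarith
  · refine (aux _ _ _ hws hwt (h s t hs hst).2).trans ?_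
    gcongr
    linarith

theorem rpow_id (α : ℝ) : RegVary α fun t => t ^ α := by
  refine ⟨fun t ht => Real.rpow_pos_of_pos ht α, fun ε hε => ⟨1, one_pos, fun s t hs hst => ?_⟩⟩
  have ht := hs.trans_le hst
  have hq : 1 ≤ t / s := (one_le_div hs).2 hst
  have hq0 : 0 < t / s := by positivity
  have h1 : (t / s) ^ α * s ^ α = t ^ α := by
    rw [← Real.mul_rpow hq0.le hs.le, div_mul_cancel₀ _ hs.ne']
  constructor
  · rw [one_mul, ← h1]
    gcongr
    linarith
  · rw [one_mul, ← h1, ← mul_assoc, ← Real.rpow_add hq0, sub_add_cancel]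
    exact le_mul_of_one_le_left (by positivity) (Real.one_le_rpow hq hε.le)

theorem congr {α β : ℝ} {v w : ℝ → ℝ} (hv : RegVary α v) (hαβ : α = β)
    (h : ∀ t : ℝ, 0 < t → v t = w t) : RegVary β w := by
  subst hαβ
  refine ⟨fun t ht => h t ht ▸ hv.pos t ht, fun ε hε => ?_⟩
  obtain ⟨C, hC, h'⟩ := hv.bound ε hε
  refine ⟨C, hC, fun s t hs hst => ?_⟩
  rw [← h t (hs.trans_le hst), ← h s hs]
  exact h' s t hs hst

/-- A crude form of the Potter bounds that ignores the order of s and t. Only some finite exponent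
is wanted, so ε = 1 will do. -/
theorem near {α : ℝ} {w : ℝ → ℝ} (hw : RegVary α w) : ∃ C m : ℝ, 1 ≤ C ∧ 0 ≤ m ∧
    ∀ R s t : ℝ, 1 ≤ R → 0 < s → 0 < t → s ≤ R * t → t ≤ R * s → w s ≤ C * R ^ m * w t := by
  obtain ⟨C, hC, h⟩ := hw.bound 1 one_pos
  refine ⟨max C 1, |α| + 1, le_max_right _ _, by positivity, fun R s t hR hs ht hst hts => ?_⟩
  have key : ∀ x y β : ℝ, 0 < x → x ≤ y → y ≤ R * x → β ≤ |α| + 1 →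
      C * (y / x) ^ β * w t ≤ max C 1 * R ^ (|α| + 1) * w t := by
    intro x y β hx hxy hyx hβ
    have := hw.pos t ht
    have hq : 1 ≤ y / x := (one_le_div hx).2 hxy
    gcongr ?_ * ?_ * _
    · exact le_max_left _ _
    · exact (Real.rpow_le_rpow_of_exponent_le hq hβ).trans
        (Real.rpow_le_rpow (by positivity) ((div_le_iff₀ hx).2 hyx) (by positivity))
  rcases le_total s t with hle | hle
  · exact (h s t hs hle).2.trans (key s t _ hs hle hts (by linarith [neg_abs_le α]))
  · exact (h t s ht hle).1.trans (key t s _ ht hle hst (by linarith [le_abs_self α]))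

/-- By `near`, ρ(s) and ρ(t) differ by at most a power of t/s, and `a` changes by an arbitrarily
small power of their ratio. At index 0 the two Potter bounds have the same shape, so it does not
matter which of ρ(s), ρ(t) is larger. -/
theorem comp {κ : ℝ} {a ρ : ℝ → ℝ} (ha : RegVary 0 a) (hρ : RegVary κ ρ) :
    RegVary 0 fun t => a (ρ t) := by
  refine ⟨fun t ht => ha.pos _ (hρ.pos t ht), fun ε hε => ?_⟩
  obtain ⟨C, m, hC, hm, h⟩ := hρ.near
  obtain ⟨D, hD, h'⟩ := ha.bound (ε / (m + 1)) (by positivity)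
  refine ⟨D * C ^ (ε / (m + 1)), by positivity, fun s t hs hst => ?_⟩
  have ht := hs.trans_le hst
  have hq : 1 ≤ t / s := (one_le_div hs).2 hst
  have hq0 : 0 < t / s := by positivity
  have hme : m * (ε / (m + 1)) ≤ ε := by
    rw [mul_div_assoc', div_le_iff₀ (by positivity)]
    nlinarith
  have e1 : t ≤ t / s * s := by rw [div_mul_cancel₀ _ hs.ne']
  have e2 : s ≤ t / s * t := hst.trans (le_mul_of_one_le_left ht.le hq)
  have hst' := h (t / s) s t hq hs ht e2 e1
  have hts' := h (t / s) t s hq ht hs e1 e2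
  have hρs := hρ.pos s hs
  have hρt := hρ.pos t ht
  have key : ∀ x y z : ℝ, 0 < x → 0 < y → x ≤ C * (t / s) ^ m * y → 0 < z →
      D * (x / y) ^ (ε / (m + 1)) * z ≤ D * C ^ (ε / (m + 1)) * (t / s) ^ ε * z := by
    intro x y z hx hy hxy hz
    rw [mul_assoc D (C ^ _)]
    gcongr
    calc (x / y) ^ (ε / (m + 1)) ≤ (C * (t / s) ^ m) ^ (ε / (m + 1)) := by
          gcongr
          exact (div_le_iff₀ hy).2 hxy
      _ = C ^ (ε / (m + 1)) * (t / s) ^ (m * (ε / (m + 1))) := by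
          rw [Real.mul_rpow (by positivity) (by positivity), ← Real.rpow_mul (by positivity)]
      _ ≤ _ := by
          gcongr
  rw [zero_add, sub_zero]
  rcases le_total (ρ s) (ρ t) with hle | hle
  · have := h' _ _ hρs hle
    rw [zero_add, sub_zero] at this
    exact ⟨this.1.trans (key _ _ _ hρt hρs hts' (ha.pos _ hρs)),
      this.2.trans (key _ _ _ hρt hρs hts' (ha.pos _ hρt))⟩
  · have := h' _ _ hρt hle
    rw [zero_add, sub_zero] at this
    exact ⟨this.2.trans (key _ _ _ hρs hρt hst' (ha.pos _ hρs)),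
      this.1.trans (key _ _ _ hρs hρt hst' (ha.pos _ hρt))⟩

end RegVary

/-! ### Moderate and quasi-concave functions. -/

/-- `h s ≤ C R ^ m h t` whenever `s` and `t` differ by a factor of at most `R`. -/
def Moderate (C m : ℝ) (h : ℝ → ℝ≥0∞) : Prop :=
  ∀ R s t : ℝ, 1 ≤ R → 0 < s → 0 < t → s ≤ R * t → t ≤ R * s →
    h s ≤ ENNReal.ofReal (C * R ^ m) * h t

/-- `k` is nondecreasing and `k t / t` is nonincreasing on `(0, ∞)`. -/
def QuasiConc (k : ℝ → ℝ≥0∞) : Prop :=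
  ∀ s t : ℝ, 0 < s → s ≤ t → k s ≤ k t ∧ k t ≤ ENNReal.ofReal (t / s) * k s

theorem QuasiConc.one : QuasiConc fun _ => 1 := by
  refine fun s t hs hst => ⟨le_rfl, ?_⟩
  rw [mul_one, ← ENNReal.ofReal_one]
  exact ENNReal.ofReal_le_ofReal ((one_le_div hs).2 hst)

theorem QuasiConc.near {k : ℝ → ℝ≥0∞} (hk : QuasiConc k) {R s t : ℝ} (hR : 1 ≤ R) (hs : 0 < s)
    (ht : 0 < t) (hst : s ≤ R * t) : k s ≤ ENNReal.ofReal R * k t := by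
  rcases le_total s t with h | h
  · refine (hk s t hs h).1.trans (le_mul_of_one_le_left zero_le ?_)
    rw [← ENNReal.ofReal_one]
    exact ENNReal.ofReal_le_ofReal hR
  · refine (hk t s ht h).2.trans ?_
    gcongr
    exact (div_le_iff₀ ht).2 hst

/-- The constants depend on the weight and not on k; this is why the final constants do not depend
on `f`. The quasi-concave factor contributes at most one power of R. -/
theorem RegVary.moderate {α : ℝ} {w : ℝ → ℝ} (hw : RegVary α w) : ∃ C m : ℝ, 1 ≤ C ∧ 0 ≤ m ∧
    ∀ k : ℝ → ℝ≥0∞, QuasiConc k → Moderate C m fun t => ENNReal.ofReal (w t) * k t := by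
  obtain ⟨C, m, hC, hm, h⟩ := hw.near
  refine ⟨C, m + 1, hC, by positivity, fun k hk R s t hR hs ht hst hts => ?_⟩
  have hR0 : 0 < R := by positivity
  calc ENNReal.ofReal (w s) * k s
      ≤ ENNReal.ofReal (C * R ^ m * w t) * (ENNReal.ofReal R * k t) := by
        gcongr
        · exact h R s t hR hs ht hst hts
        · exact hk.near hR hs ht hst
    _ = _ := by
        rw [ENNReal.ofReal_mul (by positivity), Real.rpow_add_one hR0.ne', ← mul_assoc C,
          ENNReal.ofReal_mul (by positivity : 0 ≤ C * R ^ m)]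
        ring

theorem RegVary.moderate_self {α : ℝ} {w : ℝ → ℝ} (hw : RegVary α w) : ∃ C m : ℝ, 1 ≤ C ∧ 0 ≤ m ∧
    Moderate C m fun t => ENNReal.ofReal (w t) := by
  obtain ⟨C, m, hC, hm, h⟩ := hw.moderate
  exact ⟨C, m, hC, hm, by simpa using h _ QuasiConc.one⟩

/-! ### Quasi-norms with respect to du/u. -/

/-- The measure `du / u` on `(0, ∞)`. -/
noncomputable def dtt : Measure ℝ := volume.withDensity fun u => ENNReal.ofReal u⁻¹

/-- The (quasi-)norm of `L_q(S, du / u)`. -/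
noncomputable def mnorm (q : ℝ≥0∞) (S : Set ℝ) (h : ℝ → ℝ≥0∞) : ℝ≥0∞ :=
  eLpNorm h q (dtt.restrict S)

theorem mnorm_top (S : Set ℝ) (h : ℝ → ℝ≥0∞) : mnorm ∞ S h = essSup h (dtt.restrict S) := by
  simp [mnorm, eLpNormEssSup_eq_essSup_enorm]

theorem mnorm_of_ne_top {q : ℝ≥0∞} (hq : q ≠ 0) (hq' : q ≠ ∞) (S : Set ℝ) (h : ℝ → ℝ≥0∞) :
    mnorm q S h = (∫⁻ u in S, h u ^ q.toReal ∂dtt) ^ (1 / q.toReal) := by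
  simp [mnorm, eLpNorm_eq_lintegral_rpow_enorm_toReal hq hq']

/-- The factor u^(-1/q) is the q-th root of the density 1/u. For q = ∞ it is absent, and on S the
two measures have the same null sets. -/
theorem wnorm_eq_mnorm {q : ℝ≥0∞} (hq : q ≠ 0) (α : ℝ) {S : Set ℝ} (hS : MeasurableSet S)
    (hS0 : S ⊆ Ioi 0) (w : ℝ → ℝ) (F : ℝ → ℝ≥0∞) :
    wnorm q α S w F = mnorm q S fun u => ENNReal.ofReal (u ^ α * w u) * F u := by
  have hm : Measurable fun u : ℝ => ENNReal.ofReal u⁻¹ := by fun_prop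
  have hr : dtt.restrict S = (volume.restrict S).withDensity fun u => ENNReal.ofReal u⁻¹ :=
    restrict_withDensity hS _
  rcases eq_or_ne q ∞ with rfl | hq'
  · rw [wnorm, mnorm, eLpNorm_exponent_top, eLpNorm_exponent_top, eLpNormEssSup_eq_essSup_enorm,
      eLpNormEssSup_eq_essSup_enorm, hr]
    have hae : ae ((volume.restrict S).withDensity fun u => ENNReal.ofReal u⁻¹)
        = ae (volume.restrict S) := by
      apply le_antisymm (withDensity_absolutelyContinuous _ _).ae_le
      refine (withDensity_absolutelyContinuous' hm.aemeasurable ?_).ae_le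
      refine (ae_restrict_iff' hS).2 (ae_of_all _ fun u hu => ?_)
      simpa using (show (0 : ℝ) < u from hS0 hu)
    simp only [essSup, hae]
    simp
  · have hp : 0 < q.toReal := ENNReal.toReal_pos hq hq'
    rw [mnorm_of_ne_top hq hq', wnorm, eLpNorm_eq_lintegral_rpow_enorm_toReal hq hq', hr,
      lintegral_withDensity_eq_lintegral_mul_non_measurable _ hm (ae_of_all _ fun _ => by simp)]
    congr 1
    refine setLIntegral_congr_fun hS fun u hu => ?_
    have hu0 : (0 : ℝ) < u := hS0 hu
    simp only [enorm_eq_self, Pi.mul_apply]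
    rw [ENNReal.mul_rpow_of_nonneg _ _ hp.le, ENNReal.mul_rpow_of_nonneg _ _ hp.le, ← mul_assoc,
      Real.rpow_sub hu0, div_mul_eq_mul_div, div_eq_inv_mul, ENNReal.ofReal_mul (by positivity),
      ENNReal.mul_rpow_of_nonneg _ _ hp.le, ENNReal.ofReal_rpow_of_pos (by positivity),
      ← Real.rpow_neg hu0.le, ← Real.rpow_mul hu0.le, ENNReal.toReal_inv, neg_mul,
      inv_mul_cancel₀ hp.ne', Real.rpow_neg_one]

theorem mnorm_mono {q : ℝ≥0∞} {S : Set ℝ} (hS : MeasurableSet S) {f g : ℝ → ℝ≥0∞}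
    (h : ∀ u ∈ S, f u ≤ g u) : mnorm q S f ≤ mnorm q S g :=
  eLpNorm_mono_enorm_ae ((ae_restrict_iff' hS).2 (ae_of_all _ fun u hu => h u hu))

theorem mnorm_congr {q : ℝ≥0∞} {S : Set ℝ} (hS : MeasurableSet S) {f g : ℝ → ℝ≥0∞}
    (h : ∀ u ∈ S, f u = g u) : mnorm q S f = mnorm q S g :=
  le_antisymm (mnorm_mono hS fun u hu => (h u hu).le) (mnorm_mono hS fun u hu => (h u hu).ge)

theorem mnorm_mono_set {q : ℝ≥0∞} {S T : Set ℝ} (h : S ⊆ T) (f : ℝ → ℝ≥0∞) :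
    mnorm q S f ≤ mnorm q T f :=
  eLpNorm_mono_measure _ (Measure.restrict_mono h le_rfl)

theorem mnorm_congr_set {q : ℝ≥0∞} {S T : Set ℝ} (h : S =ᵐ[dtt] T) (f : ℝ → ℝ≥0∞) :
    mnorm q S f = mnorm q T f := by
  rw [mnorm, mnorm, Measure.restrict_congr_set h]

theorem mnorm_const_mul {q : ℝ≥0∞} (hq : q ≠ 0) (S : Set ℝ) {c : ℝ≥0∞} (hc : c ≠ ∞)
    (f : ℝ → ℝ≥0∞) : mnorm q S (fun u => c * f u) = c * mnorm q S f := by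
  rcases eq_or_ne q ∞ with rfl | hq'
  · rw [mnorm_top, mnorm_top, ENNReal.essSup_const_mul]
  · have hp : 0 < q.toReal := ENNReal.toReal_pos hq hq'
    rw [mnorm_of_ne_top hq hq', mnorm_of_ne_top hq hq']
    simp_rw [ENNReal.mul_rpow_of_nonneg _ _ hp.le]
    rw [lintegral_const_mul' _ _ (ENNReal.rpow_ne_top_of_nonneg hp.le hc),
      ENNReal.mul_rpow_of_nonneg _ _ (by positivity), ← ENNReal.rpow_mul,
      mul_one_div_cancel hp.ne', ENNReal.rpow_one]

/-- The half of homogeneity that survives for c = ∞: it is tested on finite constants below c. -/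
theorem const_mul_mnorm_le {q : ℝ≥0∞} (hq : q ≠ 0) (S : Set ℝ) (c : ℝ≥0∞)
    (f : ℝ → ℝ≥0∞) : c * mnorm q S f ≤ mnorm q S (fun u => c * f u) := by
  refine ENNReal.mul_le_of_forall_lt fun a ha b hb => ?_
  calc a * b ≤ a * mnorm q S f := by gcongr
    _ = mnorm q S (fun u => a * f u) := (mnorm_const_mul hq S ha.ne_top f).symm
    _ ≤ _ := eLpNorm_mono_enorm fun u => by
        simp only [enorm_eq_self]
        gcongr

theorem mnorm_union {q : ℝ≥0∞} (hq : q ≠ 0) : ∃ C : ℝ≥0, 1 ≤ C ∧ ∀ (S T : Set ℝ) (f : ℝ → ℝ≥0∞),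
    mnorm q (S ∪ T) f ≤ C * (mnorm q S f + mnorm q T f) := by
  rcases eq_or_ne q ∞ with rfl | hq'
  · refine ⟨1, le_rfl, fun S T f => ?_⟩
    rw [mnorm_top, mnorm_top, mnorm_top, ENNReal.coe_one, one_mul]
    refine essSup_le_of_ae_le _ ?_
    have h1 : ∀ᵐ x ∂dtt.restrict S, f x ≤ essSup f (dtt.restrict S) := ENNReal.ae_le_essSup f
    have h2 : ∀ᵐ x ∂dtt.restrict T, f x ≤ essSup f (dtt.restrict T) := ENNReal.ae_le_essSup f
    refine (ae_restrict_union_iff S T _).2 ⟨?_, ?_⟩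
    · filter_upwards [h1] with x hx using hx.trans le_self_add
    · filter_upwards [h2] with x hx using hx.trans le_add_self
  · have hp : 0 < q.toReal := ENNReal.toReal_pos hq hq'
    refine ⟨2 ^ (1 / q.toReal), NNReal.one_le_rpow one_le_two (by positivity), fun S T f => ?_⟩
    rw [mnorm_of_ne_top hq hq', mnorm_of_ne_top hq hq', mnorm_of_ne_top hq hq']
    set x := ∫⁻ u in S, f u ^ q.toReal ∂dtt
    set y := ∫⁻ u in T, f u ^ q.toReal ∂dtt
    -- Bounding a sum by twice the maximum commutes with powers, so q < 1 and q ≥ 1 need no separate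
    -- treatment.
    calc (∫⁻ u in S ∪ T, f u ^ q.toReal ∂dtt) ^ (1 / q.toReal)
        ≤ (2 * max x y) ^ (1 / q.toReal) := by
          gcongr
          refine (lintegral_union_le _ _ _).trans ?_
          rw [two_mul]
          exact add_le_add (le_max_left _ _) (le_max_right _ _)
      _ = 2 ^ (1 / q.toReal) * max (x ^ (1 / q.toReal)) (y ^ (1 / q.toReal)) := by
          rw [ENNReal.mul_rpow_of_nonneg _ _ (by positivity)]
          congr 1
          exact (ENNReal.monotone_rpow_of_nonneg (by positivity : 0 ≤ 1 / q.toReal)).map_max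
      _ ≤ _ := by
          rw [ENNReal.coe_rpow_of_nonneg _ (by positivity)]
          gcongr
          · exact le_rfl
          · exact max_le le_self_add le_add_self

theorem mnorm_add {q : ℝ≥0∞} (hq : q ≠ 0) : ∃ C : ℝ≥0, 1 ≤ C ∧ ∀ (S : Set ℝ) (f g : ℝ → ℝ≥0∞),
    AEMeasurable f (dtt.restrict S) →
    mnorm q S (fun u => f u + g u) ≤ C * (mnorm q S f + mnorm q S g) := by
  rcases eq_or_ne q ∞ with rfl | hq'
  · refine ⟨1, le_rfl, fun S f g _ => ?_⟩
    rw [mnorm_top, mnorm_top, mnorm_top, ENNReal.coe_one, one_mul]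
    exact ENNReal.essSup_add_le f g
  · have hp : 0 < q.toReal := ENNReal.toReal_pos hq hq'
    have hp' : 0 ≤ 1 / q.toReal := by positivity
    refine ⟨2 * 2 ^ (1 / q.toReal), ?_, fun S f g hf => ?_⟩
    · exact one_le_mul one_le_two (NNReal.one_le_rpow one_le_two hp')
    rw [mnorm_of_ne_top hq hq', mnorm_of_ne_top hq hq', mnorm_of_ne_top hq hq']
    set x := ∫⁻ u in S, f u ^ q.toReal ∂dtt with hx
    set y := ∫⁻ u in S, g u ^ q.toReal ∂dtt with hy
    have h1 : ∫⁻ u in S, (f u + g u) ^ q.toReal ∂dtt ≤ 2 ^ q.toReal * (x + y) := by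
      rw [hx, hy, ← lintegral_add_left' (hf.pow_const _), ← lintegral_const_mul' _ _ (by finiteness)]
      refine lintegral_mono fun u => ?_
      calc (f u + g u) ^ q.toReal ≤ (2 * max (f u) (g u)) ^ q.toReal := by
            gcongr
            rw [two_mul]
            exact add_le_add (le_max_left _ _) (le_max_right _ _)
        _ = 2 ^ q.toReal * max (f u ^ q.toReal) (g u ^ q.toReal) := by
            rw [ENNReal.mul_rpow_of_nonneg _ _ hp.le]
            congr 1
            exact (ENNReal.monotone_rpow_of_nonneg hp.le).map_max
        _ ≤ _ := by
            gcongr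
            exact max_le le_self_add le_add_self
    calc (∫⁻ u in S, (f u + g u) ^ q.toReal ∂dtt) ^ (1 / q.toReal)
        ≤ (2 ^ q.toReal * (2 * max x y)) ^ (1 / q.toReal) := by
          gcongr
          refine h1.trans ?_
          gcongr
          rw [two_mul]
          exact add_le_add (le_max_left _ _) (le_max_right _ _)
      _ = 2 * (2 ^ (1 / q.toReal) * max (x ^ (1 / q.toReal)) (y ^ (1 / q.toReal))) := by
          rw [ENNReal.mul_rpow_of_nonneg _ _ hp', ENNReal.mul_rpow_of_nonneg _ _ hp',
            ← ENNReal.rpow_mul, mul_one_div_cancel hp.ne', ENNReal.rpow_one]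
          congr 2
          exact (ENNReal.monotone_rpow_of_nonneg hp').map_max
      _ ≤ _ := by
          rw [ENNReal.coe_mul, ENNReal.coe_rpow_of_nonneg _ hp', mul_assoc]
          gcongr
          · exact le_rfl
          · exact le_rfl
          · exact max_le le_self_add le_add_self

/-- Splitting an integral needs a measurable summand, but `RegVary` does not make w measurable.
Hence w is exchanged for the step function u ↦ w(e^⌊log u⌋), which is measurable and equivalent to w
because the argument moves by a factor at most e. -/
theorem mnorm_weight_add {q : ℝ≥0∞} (hq : q ≠ 0) {α : ℝ} {w : ℝ → ℝ} (hw : RegVary α w) :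
    ∃ C : ℝ≥0, 1 ≤ C ∧ ∀ (S : Set ℝ), MeasurableSet S → S ⊆ Ioi 0 → ∀ f g : ℝ → ℝ≥0∞,
      Measurable f →
      mnorm q S (fun u => ENNReal.ofReal (w u) * (f u + g u)) ≤
        C * (mnorm q S (fun u => ENNReal.ofReal (w u) * f u) +
          mnorm q S fun u => ENNReal.ofReal (w u) * g u) := by
  obtain ⟨A, hA1, hA⟩ := mnorm_add hq
  obtain ⟨C, m, hC, hm, h⟩ := hw.moderate_self
  set D : ℝ≥0 := (C * Real.exp 1 ^ m).toNNReal with hD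
  have hDc : ENNReal.ofReal (C * Real.exp 1 ^ m) = D := rfl
  have hD1 : 1 ≤ D := by
    rw [hD, ← NNReal.coe_le_coe, Real.coe_toNNReal _ (by positivity), NNReal.coe_one]
    exact one_le_mul_of_one_le_of_one_le hC (Real.one_le_rpow (by simp) hm)
  let v : ℝ → ℝ≥0∞ := fun u => ENNReal.ofReal (w (Real.exp ⌊Real.log u⌋))
  have hv : Measurable v := by
    have h1 : Measurable fun u : ℝ => ⌊Real.log u⌋ := by fun_prop
    exact (measurable_from_top (f := fun n : ℤ => ENNReal.ofReal (w (Real.exp n)))).comp h1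
  have hs1 : ∀ u : ℝ, 0 < u → Real.exp ⌊Real.log u⌋ ≤ u := fun u hu => by
    rw [← Real.le_log_iff_exp_le hu]
    exact Int.floor_le _
  have hs2 : ∀ u : ℝ, 0 < u → u ≤ Real.exp 1 * Real.exp ⌊Real.log u⌋ := fun u hu => by
    rw [← Real.exp_add, ← Real.log_le_iff_le_exp hu, add_comm]
    exact (Int.lt_floor_add_one _).le
  have he : 1 ≤ Real.exp 1 := by simp
  have hwv : ∀ u : ℝ, 0 < u → ENNReal.ofReal (w u) ≤ D * v u := fun u hu => by
    rw [← hDc]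
    exact h _ _ _ he hu (Real.exp_pos _) (hs2 u hu)
      ((hs1 u hu).trans (le_mul_of_one_le_left hu.le he))
  have hvw : ∀ u : ℝ, 0 < u → v u ≤ D * ENNReal.ofReal (w u) := fun u hu => by
    rw [← hDc]
    exact h _ _ _ he (Real.exp_pos _) hu ((hs1 u hu).trans (le_mul_of_one_le_left hu.le he))
      (hs2 u hu)
  refine ⟨D * A * D, one_le_mul (one_le_mul hD1 hA1) hD1, fun S hS hS0 f g hf => ?_⟩
  have hv' : ∀ f : ℝ → ℝ≥0∞, mnorm q S (fun u => v u * f u) ≤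
      D * mnorm q S fun u => ENNReal.ofReal (w u) * f u := fun f => by
    rw [← mnorm_const_mul hq _ ENNReal.coe_ne_top]
    refine mnorm_mono hS fun u hu => ?_
    rw [← mul_assoc]
    gcongr
    exact hvw u (hS0 hu)
  calc mnorm q S (fun u => ENNReal.ofReal (w u) * (f u + g u))
      ≤ mnorm q S (fun u => D * (v u * f u + v u * g u)) := by
        refine mnorm_mono hS fun u hu => ?_
        rw [← mul_add, ← mul_assoc]
        gcongr
        exact hwv u (hS0 hu)
    _ = D * mnorm q S (fun u => v u * f u + v u * g u) :=
        mnorm_const_mul hq _ ENNReal.coe_ne_top _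
    _ ≤ D * (A * (mnorm q S (fun u => v u * f u) + mnorm q S fun u => v u * g u)) := by
        gcongr
        exact hA S _ _ (hv.mul hf).aemeasurable
    _ ≤ D * (A * (D * mnorm q S (fun u => ENNReal.ofReal (w u) * f u) +
          D * mnorm q S fun u => ENNReal.ofReal (w u) * g u)) := by
        gcongr
        · exact hv' f
        · exact hv' g
    _ = _ := by
        push_cast
        ring

theorem dtt_Ico_le {t : ℝ} (ht : 0 < t) : dtt (Ico t (2 * t)) ≤ 1 := by
  rw [dtt, withDensity_apply _ measurableSet_Ico]
  calc ∫⁻ u in Ico t (2 * t), ENNReal.ofReal u⁻¹ ≤ ∫⁻ _ in Ico t (2 * t), ENNReal.ofReal t⁻¹ := by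
        refine setLIntegral_mono' measurableSet_Ico fun u hu => ?_
        gcongr
        exact hu.1
    _ = 1 := by
        rw [setLIntegral_const, Real.volume_Ico, ← ENNReal.ofReal_mul (by positivity), two_mul,
          add_sub_cancel_left, inv_mul_cancel₀ ht.ne', ENNReal.ofReal_one]

theorem le_dtt_Ioo {t : ℝ} (ht : 0 < t) : 2⁻¹ ≤ dtt (Ioo t (2 * t)) := by
  rw [dtt, withDensity_apply _ measurableSet_Ioo]
  calc (2⁻¹ : ℝ≥0∞) = ∫⁻ _ in Ioo t (2 * t), ENNReal.ofReal (2 * t)⁻¹ := by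
        rw [setLIntegral_const, Real.volume_Ioo, ← ENNReal.ofReal_mul (by positivity), two_mul t,
          add_sub_cancel_left, ← two_mul, mul_inv, mul_assoc, inv_mul_cancel₀ ht.ne', mul_one,
          ENNReal.ofReal_inv_of_pos two_pos]
        simp
    _ ≤ _ := by
        refine setLIntegral_mono' measurableSet_Ioo fun u hu => ?_
        have : 0 < u := ht.trans hu.1
        gcongr
        exact hu.2.le

instance : NullSingletonClass dtt := ⟨fun x => withDensity_absolutelyContinuous _ _ (measure_singleton x)⟩

/-- The interval (t, 2t) has mass at least 1/2. For q = ∞ the exponent reads 1/0 = 0 and the factor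
is 1. -/
theorem le_mnorm_Ioo_const {q : ℝ≥0∞} (hq : q ≠ 0) {t : ℝ} (ht : 0 < t) (c : ℝ≥0∞) :
    c * 2⁻¹ ^ (1 / q.toReal) ≤ mnorm q (Ioo t (2 * t)) fun _ => c := by
  have h0 : dtt.restrict (Ioo t (2 * t)) ≠ 0 := by
    intro h
    have := le_dtt_Ioo ht
    rw [Measure.restrict_eq_zero.1 h] at this
    simp at this
  rw [mnorm, eLpNorm_const c hq h0, enorm_eq_self]
  gcongr
  rw [Measure.restrict_apply_univ]
  exact le_dtt_Ioo ht

/-- A moderate function is comparable on (t, 2t) to each of its values on [t, 2t], so point values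
are controlled by local norms. -/
theorem Moderate.le_mnorm {q : ℝ≥0∞} (hq : q ≠ 0) (C m : ℝ) : ∃ D : ℝ≥0, 1 ≤ D ∧
    ∀ h : ℝ → ℝ≥0∞, Moderate C m h → ∀ x t : ℝ, 0 < t → t ≤ x → x ≤ 2 * t →
      h x ≤ D * mnorm q (Ioo t (2 * t)) h := by
  set e : ℝ≥0 := 2⁻¹ ^ (1 / q.toReal) with he
  have he0 : e ≠ 0 := by positivity
  set A : ℝ≥0 := (C * 2 ^ m).toNNReal with hA
  have hAc : ENNReal.ofReal (C * 2 ^ m) = A := rfl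
  refine ⟨1 + A * e⁻¹, le_self_add, fun h hh x t ht htx hxt => ?_⟩
  have h1 : h x * e ≤ A * mnorm q (Ioo t (2 * t)) h := by
    calc h x * e = h x * 2⁻¹ ^ (1 / q.toReal) := by
          rw [he, ENNReal.coe_rpow_of_nonneg _ (by positivity), ENNReal.coe_inv two_ne_zero]
          simp
      _ ≤ mnorm q (Ioo t (2 * t)) fun _ => h x := le_mnorm_Ioo_const hq ht _
      _ ≤ mnorm q (Ioo t (2 * t)) fun u => A * h u := by
          refine mnorm_mono measurableSet_Ioo fun u hu => ?_
          rw [← hAc]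
          have h1 := hu.1
          have h2 := hu.2
          exact hh 2 x u one_le_two (by linarith) (by linarith) (by linarith) (by linarith)
      _ = _ := mnorm_const_mul hq _ ENNReal.coe_ne_top _
  calc h x = h x * e * (e⁻¹ : ℝ≥0) := by
        rw [mul_assoc, ← ENNReal.coe_mul, mul_inv_cancel₀ he0,
          ENNReal.coe_one, mul_one]
    _ ≤ A * mnorm q (Ioo t (2 * t)) h * (e⁻¹ : ℝ≥0) := by gcongr
    _ = (A * e⁻¹ : ℝ≥0) * mnorm q (Ioo t (2 * t)) h := by
        rw [ENNReal.coe_mul]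
        ring
    _ ≤ _ := by
        gcongr
        exact le_add_self

/-! ### The kernel and the dyadic Schur test. -/

/-- The kernel `min (x / y, y / x)`. -/
noncomputable def ker (x y : ℝ) : ℝ := min (x / y) (y / x)

theorem ker_comm (x y : ℝ) : ker x y = ker y x := min_comm _ _

theorem ker_pos {x y : ℝ} (hx : 0 < x) (hy : 0 < y) : 0 < ker x y :=
  lt_min (by positivity) (by positivity)

theorem ker_le_one {x y : ℝ} (hx : 0 < x) (hy : 0 < y) : ker x y ≤ 1 := by
  rcases le_total x y with h | h
  · exact (min_le_left _ _).trans ((div_le_one hy).2 h)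
  · exact (min_le_right _ _).trans ((div_le_one hx).2 h)

theorem ker_self {x : ℝ} (hx : 0 < x) : ker x x = 1 := by
  rw [ker, min_self, div_self hx.ne']

theorem ker_of_le {x y : ℝ} (hx : 0 < x) (h : x ≤ y) : ker x y = x / y := by
  refine min_eq_left ?_
  have hy := hx.trans_le h
  exact ((div_le_one hy).2 h).trans ((one_le_div hx).2 h)

theorem ker_of_ge {x y : ℝ} (hy : 0 < y) (h : y ≤ x) : ker x y = y / x := by
  rw [ker_comm, ker_of_le hy h]

theorem ker_near {x y x' y' A B : ℝ} (hx : 0 < x) (hy : 0 < y) (hx' : 0 < x') (hy' : 0 < y')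
    (hA : 0 ≤ A) (hB : 0 ≤ B) (h1 : x ≤ A * x') (h2 : x' ≤ A * x) (h3 : y ≤ B * y')
    (h4 : y' ≤ B * y) : ker x y ≤ A * B * ker x' y' := by
  rw [ker, ker, mul_min_of_nonneg _ _ (mul_nonneg hA hB)]
  refine min_le_min ?_ ?_
  · rw [mul_div_assoc', div_le_div_iff₀ hy hy']
    calc x * y' ≤ (A * x') * (B * y) := by gcongr
      _ = _ := by ring
  · rw [mul_div_assoc', div_le_div_iff₀ hx hx']
    calc y * x' ≤ (B * y') * (A * x) := by gcongr
      _ = _ := by ring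

/-- `σ` grows at least like `t ^ p` and is doubling. -/
structure PowerLike (c p : ℝ) (σ : ℝ → ℝ) : Prop where
  one_le : 1 ≤ c
  exp_pos : 0 < p
  pos : ∀ t : ℝ, 0 < t → 0 < σ t
  low : ∀ s t : ℝ, 0 < s → s ≤ t → (t / s) ^ p * σ s ≤ c * σ t
  doubling : ∀ s t : ℝ, 0 < s → s ≤ t → t ≤ 2 * s → σ t ≤ c * σ s

theorem PowerLike.mono {c p : ℝ} {σ : ℝ → ℝ} (hσ : PowerLike c p σ) {s t : ℝ} (hs : 0 < s)
    (hst : s ≤ t) : σ s ≤ c * σ t :=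
  (le_mul_of_one_le_left (hσ.pos s hs).le
    (Real.one_le_rpow ((one_le_div hs).2 hst) hσ.exp_pos.le)).trans (hσ.low s t hs hst)

theorem PowerLike.id : PowerLike 2 1 fun t => t := by
  refine ⟨one_le_two, one_pos, fun _ h => h, fun s t hs hst => ?_, fun s t _ _ h => h⟩
  rw [Real.rpow_one, div_mul_cancel₀ _ hs.ne']
  linarith

theorem sum_le_of_geometric (F : Finset ℤ) (φ : ℤ → ℕ) (hφ : Set.InjOn φ F) (g : ℤ → ℝ≥0∞)
    (A q : ℝ≥0∞) (h : ∀ k ∈ F, g k ≤ A * q ^ φ k) : ∑ k ∈ F, g k ≤ A * (1 - q)⁻¹ := by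
  calc ∑ k ∈ F, g k ≤ ∑ k ∈ F, A * q ^ φ k := Finset.sum_le_sum h
    _ = A * ∑ n ∈ F.image φ, q ^ n := by rw [← Finset.mul_sum, Finset.sum_image hφ]
    _ ≤ A * ∑' n, q ^ n := by
        gcongr
        exact ENNReal.sum_le_tsum _
    _ = _ := by rw [ENNReal.tsum_geometric]

/-- Up to a constant σ(2^k) grows geometrically, so the terms decay geometrically on both sides of
the place where σ(2^k) crosses x. As σ is only almost monotone, the crossing index is chosen inside
each finite partial sum: the largest k with σ(2^k) ≤ x, and the smallest with σ(2^k) > x. -/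
theorem PowerLike.exists_tsum_ker_le {c p : ℝ} {σ : ℝ → ℝ} (hσ : PowerLike c p σ) {e : ℝ}
    (he : 0 < e) : ∃ D : ℝ≥0, ∀ x : ℝ, 0 < x →
      ∑' k : ℤ, ENNReal.ofReal (ker x (σ (2 ^ k)) ^ e) ≤ D := by
  have hc := hσ.one_le
  have hc0 : 0 < c := by linarith
  set b : ℝ := 2 ^ p with hb
  have hb1 : 1 < b := Real.one_lt_rpow one_lt_two hσ.exp_pos
  have hb0 : 0 < b := by positivity
  set q : ℝ := (b⁻¹) ^ e with hq
  have hq0 : 0 < q := by positivity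
  have hq1 : q < 1 := Real.rpow_lt_one (by positivity) (inv_lt_one_of_one_lt₀ hb1) he
  have step : ∀ k l : ℤ, k ≤ l →
      ENNReal.ofReal ((σ (2 ^ k) / σ (2 ^ l)) ^ e) ≤
        ENNReal.ofReal (c ^ e) * ENNReal.ofReal q ^ (l - k).toNat := by
    intro k l hkl
    have hk : (0 : ℝ) < 2 ^ k := by positivity
    have hl : (0 : ℝ) < 2 ^ l := by positivity
    have h1 := hσ.low (2 ^ k) (2 ^ l) hk (zpow_le_zpow_right₀ one_le_two hkl)
    have hσk := hσ.pos _ hk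
    have hσl := hσ.pos _ hl
    obtain ⟨n, hn⟩ : ∃ n : ℕ, l - k = n := ⟨(l - k).toNat, by omega⟩
    have h2 : ((2 : ℝ) ^ l / 2 ^ k) ^ p = b ^ n := by
      rw [← zpow_sub₀ two_ne_zero, hn, zpow_natCast, hb, ← Real.rpow_natCast,
        ← Real.rpow_natCast, ← Real.rpow_mul two_pos.le, ← Real.rpow_mul two_pos.le, mul_comm]
    rw [h2] at h1
    rw [hn, Int.toNat_natCast, ← ENNReal.ofReal_pow hq0.le, ← ENNReal.ofReal_mul (by positivity)]
    refine ENNReal.ofReal_le_ofReal ?_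
    calc (σ (2 ^ k) / σ (2 ^ l)) ^ e ≤ (c * (b⁻¹) ^ n) ^ e := by
          gcongr
          rw [div_le_iff₀ hσl, inv_pow, mul_right_comm, ← div_eq_mul_inv,
            le_div_iff₀ (by positivity), mul_comm]
          exact h1
      _ = c ^ e * q ^ n := by
          rw [Real.mul_rpow hc0.le (by positivity), hq, ← Real.rpow_natCast, ← Real.rpow_natCast,
            ← Real.rpow_mul (by positivity), ← Real.rpow_mul (by positivity), mul_comm e]
  set B : ℝ≥0∞ := ENNReal.ofReal (c ^ e) * (1 - ENNReal.ofReal q)⁻¹ with hB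
  have hBt : B ≠ ∞ := by
    have h1 : (1 - ENNReal.ofReal q) ≠ 0 := by
      rw [← ENNReal.ofReal_one, ← ENNReal.ofReal_sub _ hq0.le]
      simpa using hq1
    exact ENNReal.mul_ne_top ENNReal.ofReal_ne_top (ENNReal.inv_ne_top.2 h1)
  refine ⟨(B + B).toNNReal, fun x hx => ?_⟩
  rw [ENNReal.coe_toNNReal (by finiteness), ENNReal.tsum_eq_iSup_sum]
  refine iSup_le fun F => ?_
  rw [← Finset.sum_filter_add_sum_filter_not F fun k : ℤ => σ (2 ^ k) ≤ x]
  have h2 : ∀ k : ℤ, (0 : ℝ) < 2 ^ k := fun k => by positivity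
  refine add_le_add ?_ ?_
  · rcases (F.filter fun k : ℤ => σ (2 ^ k) ≤ x).eq_empty_or_nonempty with h | h
    · simp [h]
    · set G := F.filter fun k : ℤ => σ (2 ^ k) ≤ x
      set l := G.max' h
      have hl : σ (2 ^ l) ≤ x := (Finset.mem_filter.1 (G.max'_mem h)).2
      have hle : ∀ k ∈ G, k ≤ l := fun k hk => G.le_max' k hk
      refine sum_le_of_geometric G (fun k => (l - k).toNat) ?_ _ _ _ fun k hk => ?_
      · intro k hk k' hk' hkk'
        have := hle k hk
        have := hle k' hk'
        simp only at hkk'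
        omega
      · refine le_trans ?_ (step k l (hle k hk))
        have h1 := hσ.pos _ (h2 k)
        have h3 := hσ.pos _ (h2 l)
        have := ker_pos hx h1
        gcongr
        exact (min_le_right _ _).trans (by gcongr)
  · rcases (F.filter fun k : ℤ => ¬ σ (2 ^ k) ≤ x).eq_empty_or_nonempty with h | h
    · rw [h, Finset.sum_empty]
      exact zero_le
    · set G := F.filter fun k : ℤ => ¬ σ (2 ^ k) ≤ x
      set l := G.min' h
      have hl : x ≤ σ (2 ^ l) := (not_le.1 (Finset.mem_filter.1 (G.min'_mem h)).2).le
      have hle : ∀ k ∈ G, l ≤ k := fun k hk => G.min'_le k hk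
      refine sum_le_of_geometric G (fun k => (k - l).toNat) ?_ _ _ _ fun k hk => ?_
      · intro k hk k' hk' hkk'
        have := hle k hk
        have := hle k' hk'
        simp only at hkk'
        omega
      · refine le_trans ?_ (step l k (hle k hk))
        have h1 := hσ.pos _ (h2 k)
        have h3 := hσ.pos _ (h2 l)
        have := ker_pos hx h1
        gcongr
        exact (min_le_left _ _).trans (by gcongr)

theorem iUnion_Ico_two_zpow : ⋃ k : ℤ, Ico ((2 : ℝ) ^ k) (2 ^ (k + 1)) = Ioi 0 := by
  ext u
  simp only [mem_iUnion, mem_Ioi]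
  constructor
  · rintro ⟨k, hk⟩
    exact lt_of_lt_of_le (by positivity) hk.1
  · exact fun hu => exists_mem_Ico_zpow hu one_lt_two

theorem pairwise_disjoint_Ico_two_zpow :
    Pairwise (Function.onFun Disjoint fun k : ℤ => Ico ((2 : ℝ) ^ k) (2 ^ (k + 1))) := by
  have : Monotone fun k : ℤ => (2 : ℝ) ^ k := fun k l h => zpow_le_zpow_right₀ one_le_two h
  simpa [Order.succ_eq_add_one] using this.pairwise_disjoint_on_Ico_succ

theorem lintegral_Ioi_eq_tsum (f : ℝ → ℝ≥0∞) :
    ∫⁻ u in Ioi 0, f u ∂dtt = ∑' k : ℤ, ∫⁻ u in Ico ((2 : ℝ) ^ k) (2 ^ (k + 1)), f u ∂dtt := by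
  rw [← iUnion_Ico_two_zpow, lintegral_iUnion (fun _ => measurableSet_Ico)
    pairwise_disjoint_Ico_two_zpow]

theorem lintegral_Ioi_le_tsum {f : ℝ → ℝ≥0∞} {x : ℤ → ℝ≥0∞}
    (h : ∀ (k : ℤ), ∀ u ∈ Ico ((2 : ℝ) ^ k) (2 ^ (k + 1)), f u ≤ x k) :
    ∫⁻ u in Ioi 0, f u ∂dtt ≤ ∑' k, x k := by
  rw [lintegral_Ioi_eq_tsum]
  refine ENNReal.tsum_le_tsum fun k => ?_
  refine (setLIntegral_mono' measurableSet_Ico (h k)).trans ?_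
  rw [setLIntegral_const]
  refine mul_le_of_le_one_right' ?_
  rw [zpow_add_one₀ two_ne_zero, mul_comm]
  exact dtt_Ico_le (by positivity)

theorem mnorm_ker_le {q : ℝ≥0∞} (hq : q ≠ 0) {e : ℝ} (he : 0 < e) : ∃ D : ℝ≥0, ∀ t : ℝ, 0 < t →
    mnorm q (Ioi 0) (fun u => ENNReal.ofReal (ker u t ^ e)) ≤ D := by
  rcases eq_or_ne q ∞ with rfl | hq'
  · refine ⟨1, fun t ht => ?_⟩
    rw [mnorm_top]
    refine essSup_le_of_ae_le _ ((ae_restrict_iff' measurableSet_Ioi).2 (ae_of_all _ fun u hu => ?_))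
    rw [ENNReal.coe_one, ← ENNReal.ofReal_one]
    exact ENNReal.ofReal_le_ofReal
      (Real.rpow_le_one (ker_pos hu ht).le (ker_le_one hu ht) he.le)
  · have hp : 0 < q.toReal := ENNReal.toReal_pos hq hq'
    have hep : 0 < e * q.toReal := by positivity
    obtain ⟨D, hD⟩ := PowerLike.id.exists_tsum_ker_le hep
    set A : ℝ≥0 := ((2 : ℝ) ^ (e * q.toReal)).toNNReal with hA
    have hAc : ENNReal.ofReal ((2 : ℝ) ^ (e * q.toReal)) = A := rfl
    refine ⟨(A * D) ^ (1 / q.toReal), fun t ht => ?_⟩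
    rw [mnorm_of_ne_top hq hq', ENNReal.coe_rpow_of_nonneg _ (by positivity)]
    gcongr
    calc ∫⁻ u in Ioi 0, ENNReal.ofReal (ker u t ^ e) ^ q.toReal ∂dtt
        ≤ ∑' k : ℤ, A * ENNReal.ofReal (ker t (2 ^ k) ^ (e * q.toReal)) := by
          refine lintegral_Ioi_le_tsum fun k u hu => ?_
          have hk : (0 : ℝ) < 2 ^ k := by positivity
          have hu0 : 0 < u := hk.trans_le hu.1
          have hu2 := hu.2
          rw [zpow_add_one₀ two_ne_zero] at hu2
          have h1 : ker u t ≤ 2 * ker t (2 ^ k) := by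
            rw [ker_comm t]
            have := ker_near hu0 ht hk ht two_pos.le zero_le_one (by linarith)
              (by linarith [hu.1]) (one_mul t).ge (one_mul t).ge
            rwa [mul_one] at this
          have h2 := ker_pos hu0 ht
          have h3 := ker_pos ht hk
          rw [← hAc, ENNReal.ofReal_rpow_of_nonneg (by positivity) hp.le,
            ← Real.rpow_mul h2.le, ← ENNReal.ofReal_mul (by positivity),
            ← Real.mul_rpow two_pos.le h3.le]
          gcongr
      _ = A * ∑' k : ℤ, ENNReal.ofReal (ker t (2 ^ k) ^ (e * q.toReal)) := ENNReal.tsum_mul_left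
      _ ≤ (A * D : ℝ≥0) := by
          push_cast
          gcongr
          exact hD t ht

/-- A Schur test: functions dominated through the kernel `ker u (σ t) ^ ε`. -/
theorem PowerLike.mnorm_le {r : ℝ≥0∞} (hr : r ≠ 0) {c p : ℝ} {σ : ℝ → ℝ} (hσ : PowerLike c p σ)
    {ε : ℝ} (hε : 0 < ε) (C m : ℝ) (A : ℝ≥0) : ∃ D : ℝ≥0, ∀ h g : ℝ → ℝ≥0∞, Moderate C m g →
      (∀ t : ℝ, 0 < t → ∀ M : ℝ≥0∞,
        (∀ u : ℝ, 0 < u → ENNReal.ofReal (ker u (σ t) ^ ε) * g u ≤ M) → h t ≤ A * M) →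
      mnorm r (Ioi 0) h ≤ D * mnorm r (Ioi 0) g := by
  obtain ⟨B, -, hB⟩ := Moderate.le_mnorm hr C m
  rcases eq_or_ne r ∞ with rfl | hr'
  · refine ⟨A * B, fun h g hg hh => ?_⟩
    rw [mnorm_top]
    refine essSup_le_of_ae_le _ ((ae_restrict_iff' measurableSet_Ioi).2 (ae_of_all _ fun t ht => ?_))
    push_cast
    rw [mul_assoc]
    refine hh t ht _ fun u hu => ?_
    calc ENNReal.ofReal (ker u (σ t) ^ ε) * g u ≤ 1 * g u := by
          gcongr
          rw [← ENNReal.ofReal_one]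
          have := hσ.pos t ht
          exact ENNReal.ofReal_le_ofReal
            (Real.rpow_le_one (ker_pos hu this).le (ker_le_one hu this) hε.le)
      _ = g u := one_mul _
      _ ≤ B * mnorm ∞ (Ioo u (2 * u)) g := hB g hg u u hu le_rfl (by linarith)
      _ ≤ _ := by
          gcongr
          exact mnorm_mono_set (fun v hv => hu.trans hv.1) _
  have hq : 0 < r.toReal := ENNReal.toReal_pos hr hr'
  set q := r.toReal with hqdef
  obtain ⟨D, hD⟩ := hσ.exists_tsum_ker_le (show 0 < ε * q by positivity)
  have hc := hσ.one_le
  set E : ℝ≥0 := ((2 * c) ^ ε * (C * 2 ^ m)).toNNReal with hE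
  have hEc : ENNReal.ofReal ((2 * c) ^ ε * (C * 2 ^ m)) = E := rfl
  refine ⟨((A * E) ^ q * (D * B ^ q)) ^ (1 / q), fun h g hg hh => ?_⟩
  -- The hypothesis says that h(t) is at most A times the supremum over u of ker(u, σ(t))^ε g(u).
  -- The q-th power of that supremum is bounded by a dyadic sum of q-th powers for every q > 0, so
  -- no convexity is used.
  set x : ℤ → ℝ≥0∞ := fun k =>
    ∑' j : ℤ, ENNReal.ofReal (ker (2 ^ j) (σ (2 ^ k)) ^ (ε * q)) * g (2 ^ j) ^ q with hx
  have h2 : ∀ k : ℤ, (0 : ℝ) < 2 ^ k := fun k => by positivity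
  have hpt : ∀ (k : ℤ), ∀ t ∈ Ico ((2 : ℝ) ^ k) (2 ^ (k + 1)),
      h t ^ q ≤ ((A * E) ^ q : ℝ≥0) * x k := by
    intro k t ht
    have ht0 : 0 < t := (h2 k).trans_le ht.1
    have ht2 := ht.2
    rw [zpow_add_one₀ two_ne_zero] at ht2
    have h3 : h t ≤ A * (E * x k ^ (1 / q)) := by
      refine hh t ht0 _ fun u hu => ?_
      obtain ⟨j, hj⟩ := exists_mem_Ico_zpow hu one_lt_two
      have hj2 := hj.2
      rw [zpow_add_one₀ two_ne_zero] at hj2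
      have hk1 := ker_near hu (hσ.pos t ht0) (h2 j) (hσ.pos _ (h2 k)) two_pos.le
        (by linarith : 0 ≤ c) (by linarith) (by linarith [hj.1])
        (hσ.doubling _ _ (h2 k) ht.1 (by linarith)) (hσ.mono (h2 k) ht.1)
      have hg1 := hg 2 u (2 ^ j) one_le_two hu (h2 j) (by linarith) (by linarith [hj.1])
      have hkp := ker_pos hu (hσ.pos t ht0)
      have hkp' := ker_pos (h2 j) (hσ.pos _ (h2 k))
      calc ENNReal.ofReal (ker u (σ t) ^ ε) * g u
          ≤ ENNReal.ofReal ((2 * c * ker (2 ^ j) (σ (2 ^ k))) ^ ε) *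
              (ENNReal.ofReal (C * 2 ^ m) * g (2 ^ j)) := by gcongr
        _ = E * (ENNReal.ofReal (ker (2 ^ j) (σ (2 ^ k)) ^ ε) * g (2 ^ j)) := by
            rw [Real.mul_rpow (by positivity) hkp'.le, ← hEc,
              ENNReal.ofReal_mul (by positivity),
              ENNReal.ofReal_mul (p := (2 * c) ^ ε) (by positivity)]
            ring
        _ ≤ E * x k ^ (1 / q) := by
            gcongr
            rw [one_div, ENNReal.le_rpow_inv_iff hq, ENNReal.mul_rpow_of_nonneg _ _ hq.le,
              ENNReal.ofReal_rpow_of_nonneg (by positivity) hq.le, ← Real.rpow_mul hkp'.le]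
            exact ENNReal.le_tsum (f := fun j : ℤ =>
              ENNReal.ofReal (ker (2 ^ j) (σ (2 ^ k)) ^ (ε * q)) * g (2 ^ j) ^ q) j
    calc h t ^ q ≤ (A * (E * x k ^ (1 / q))) ^ q := by gcongr
      _ = _ := by
          rw [← mul_assoc, ENNReal.mul_rpow_of_nonneg _ _ hq.le, ← ENNReal.rpow_mul,
            one_div_mul_cancel hq.ne', ENNReal.rpow_one, ENNReal.coe_rpow_of_nonneg _ hq.le,
            ENNReal.coe_mul]
  have hgj : ∀ j : ℤ, g (2 ^ j) ^ q ≤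
      B ^ q * ∫⁻ u in Ico ((2 : ℝ) ^ j) (2 ^ (j + 1)), g u ^ q ∂dtt := by
    intro j
    have h1 := hB g hg (2 ^ j) (2 ^ j) (h2 j) le_rfl (by linarith [h2 j])
    rw [mnorm_of_ne_top hr hr'] at h1
    calc g (2 ^ j) ^ q ≤ (B * (∫⁻ u in Ioo ((2 : ℝ) ^ j) (2 * 2 ^ j), g u ^ q ∂dtt) ^ (1 / q)) ^ q := by
          gcongr
      _ = B ^ q * ∫⁻ u in Ioo ((2 : ℝ) ^ j) (2 * 2 ^ j), g u ^ q ∂dtt := by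
          rw [ENNReal.mul_rpow_of_nonneg _ _ hq.le, ← ENNReal.rpow_mul, one_div_mul_cancel hq.ne',
            ENNReal.rpow_one]
      _ ≤ _ := by
          rw [zpow_add_one₀ two_ne_zero, mul_comm _ (2 : ℝ)]
          gcongr
          exact Ioo_subset_Ico_self
  rw [mnorm_of_ne_top hr hr', mnorm_of_ne_top hr hr', ENNReal.coe_rpow_of_nonneg _ (by positivity),
    ← ENNReal.mul_rpow_of_nonneg _ _ (by positivity)]
  gcongr
  -- After exchanging the sums, the inner sum over k of the kernel is bounded uniformly in j.
  calc ∫⁻ t in Ioi 0, h t ^ q ∂dtt ≤ ∑' k, ((A * E) ^ q : ℝ≥0) * x k := lintegral_Ioi_le_tsum hpt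
    _ = ((A * E) ^ q : ℝ≥0) * ∑' j : ℤ, ∑' k : ℤ,
          ENNReal.ofReal (ker (2 ^ j) (σ (2 ^ k)) ^ (ε * q)) * g (2 ^ j) ^ q := by
        rw [ENNReal.tsum_mul_left, ENNReal.tsum_comm]
    _ ≤ ((A * E) ^ q : ℝ≥0) * ∑' j : ℤ, D * (B ^ q *
          ∫⁻ u in Ico ((2 : ℝ) ^ j) (2 ^ (j + 1)), g u ^ q ∂dtt) := by
        gcongr with j
        rw [ENNReal.tsum_mul_right]
        exact mul_le_mul' (hD _ (h2 j)) (hgj j)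
    _ = _ := by
        rw [ENNReal.tsum_mul_left, ENNReal.tsum_mul_left, ← lintegral_Ioi_eq_tsum]
        push_cast
        rw [ENNReal.coe_rpow_of_nonneg B hq.le]
        ring

/-! ### Weights of nonzero index and change of variable. -/

/-- Giving up half of the index in the Potter bound leaves w(u) ≲ (u/t)^(α/2) w(t), and the
remaining power is a kernel whose norm is bounded uniformly in t. -/
theorem RegVary.mnorm_Ioo_le {q : ℝ≥0∞} (hq : q ≠ 0) {α : ℝ} (hα : 0 < α) {w : ℝ → ℝ}
    (hw : RegVary α w) : ∃ D : ℝ≥0, ∀ t : ℝ, 0 < t →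
      mnorm q (Ioo 0 t) (fun u => ENNReal.ofReal (w u)) ≤ D * ENNReal.ofReal (w t) := by
  obtain ⟨C, hC, h⟩ := hw.bound (α / 2) (by positivity)
  obtain ⟨D, hD⟩ := mnorm_ker_le hq (half_pos hα)
  refine ⟨C.toNNReal * D, fun t ht => ?_⟩
  have hwt := hw.pos t ht
  calc mnorm q (Ioo 0 t) (fun u => ENNReal.ofReal (w u))
      ≤ mnorm q (Ioo 0 t) fun u => ENNReal.ofReal (C * w t) * ENNReal.ofReal (ker u t ^ (α / 2)) := by
        refine mnorm_mono measurableSet_Ioo fun u hu => ?_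
        rw [← ENNReal.ofReal_mul (by positivity), ker_of_le hu.1 hu.2.le]
        refine ENNReal.ofReal_le_ofReal ((h u t hu.1 hu.2.le).2.trans_eq ?_)
        rw [← inv_div t u, Real.inv_rpow (by have := hu.1; positivity),
          ← Real.rpow_neg (by have := hu.1; positivity)]
        ring_nf
    _ = ENNReal.ofReal (C * w t) * mnorm q (Ioo 0 t) fun u => ENNReal.ofReal (ker u t ^ (α / 2)) :=
        mnorm_const_mul hq _ ENNReal.ofReal_ne_top _
    _ ≤ ENNReal.ofReal (C * w t) * D := by
        gcongr
        exact (mnorm_mono_set Ioo_subset_Ioi_self _).trans (hD t ht)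
    _ = _ := by
        rw [ENNReal.ofReal_mul hC.le, ENNReal.coe_mul, ENNReal.ofReal]
        ring

theorem RegVary.mnorm_Ioi_le {q : ℝ≥0∞} (hq : q ≠ 0) {α : ℝ} (hα : α < 0) {w : ℝ → ℝ}
    (hw : RegVary α w) : ∃ D : ℝ≥0, ∀ t : ℝ, 0 < t →
      mnorm q (Ioi t) (fun u => ENNReal.ofReal (w u)) ≤ D * ENNReal.ofReal (w t) := by
  obtain ⟨C, hC, h⟩ := hw.bound (-α / 2) (by linarith)
  obtain ⟨D, hD⟩ := mnorm_ker_le hq (show 0 < -α / 2 by linarith)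
  refine ⟨C.toNNReal * D, fun t ht => ?_⟩
  have hwt := hw.pos t ht
  calc mnorm q (Ioi t) (fun u => ENNReal.ofReal (w u))
      ≤ mnorm q (Ioi t) fun u => ENNReal.ofReal (C * w t) * ENNReal.ofReal (ker u t ^ (-α / 2)) := by
        refine mnorm_mono measurableSet_Ioi fun u hu => ?_
        have hu0 : 0 < u := ht.trans hu
        rw [← ENNReal.ofReal_mul (by positivity), ker_of_ge ht (le_of_lt hu)]
        refine ENNReal.ofReal_le_ofReal ((h t u ht (le_of_lt hu)).1.trans_eq ?_)
        rw [← inv_div u t, Real.inv_rpow (by positivity), ← Real.rpow_neg (by positivity)]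
        ring_nf
    _ = ENNReal.ofReal (C * w t) * mnorm q (Ioi t) fun u => ENNReal.ofReal (ker u t ^ (-α / 2)) :=
        mnorm_const_mul hq _ ENNReal.ofReal_ne_top _
    _ ≤ ENNReal.ofReal (C * w t) * D := by
        gcongr
        exact (mnorm_mono_set (Ioi_subset_Ioi ht.le) _).trans (hD t ht)
    _ = _ := by
        rw [ENNReal.ofReal_mul hC.le, ENNReal.coe_mul, ENNReal.ofReal]
        ring

theorem Moderate.comp {κ : ℝ} {ρ : ℝ → ℝ} (hρ : RegVary κ ρ) (C m : ℝ) :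
    ∃ C' m' : ℝ, ∀ h : ℝ → ℝ≥0∞, Moderate C m h → Moderate C' m' fun t => h (ρ t) := by
  obtain ⟨D, n, hD, hn, H⟩ := hρ.near
  refine ⟨C * D ^ m, n * m, fun h hh R s t hR hs ht hst hts => ?_⟩
  have h1 : 1 ≤ D * R ^ n := one_le_mul_of_one_le_of_one_le hD (Real.one_le_rpow hR hn)
  refine (hh (D * R ^ n) (ρ s) (ρ t) h1 (hρ.pos s hs) (hρ.pos t ht) (H R s t hR hs ht hst hts)
    (H R t s hR ht hs hts hst)).trans_eq ?_
  rw [Real.mul_rpow (by positivity) (by positivity), ← Real.rpow_mul (by positivity), mul_assoc]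

theorem RegVary.powerLike {κ : ℝ} (hκ : 0 < κ) {ρ : ℝ → ℝ} (hρ : RegVary κ ρ) :
    ∃ c : ℝ, PowerLike c (κ / 2) ρ := by
  obtain ⟨C, hC, h⟩ := hρ.bound (κ / 2) (by positivity)
  obtain ⟨D, m, hD, hm, H⟩ := hρ.near
  have h2m : 1 ≤ (2 : ℝ) ^ m := Real.one_le_rpow one_le_two hm
  refine ⟨C + D * 2 ^ m, ⟨?_, by positivity, hρ.pos, fun s t hs hst => ?_, fun s t hs hst hts => ?_⟩⟩
  · nlinarith
  · have ht := hs.trans_le hst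
    have hρt := hρ.pos t ht
    have hq : 0 < t / s := by positivity
    calc (t / s) ^ (κ / 2) * ρ s ≤ (t / s) ^ (κ / 2) * (C * (t / s) ^ (κ / 2 - κ) * ρ t) := by
          gcongr
          exact (h s t hs hst).2
      _ = C * ((t / s) ^ (κ / 2) * (t / s) ^ (κ / 2 - κ)) * ρ t := by ring
      _ = C * ρ t := by
          rw [← Real.rpow_add hq]
          ring_nf
          simp
      _ ≤ _ := by
          gcongr
          linarith [show 0 < D * 2 ^ m by positivity]
  · have ht := hs.trans_le hst
    have hρs := hρ.pos s hs
    refine (H 2 t s one_le_two ht hs hts (by linarith)).trans ?_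
    gcongr
    linarith

/-- A generalized inverse of a regularly varying function of positive index. -/
theorem RegVary.exists_inverse {κ : ℝ} (hκ : 0 < κ) {ρ : ℝ → ℝ} (hρ : RegVary κ ρ) :
    ∃ (τ : ℝ → ℝ) (c p A : ℝ), PowerLike c p τ ∧ 1 ≤ A ∧
      ∀ u : ℝ, 0 < u → ρ (τ u) ≤ A * u ∧ u ≤ A * ρ (τ u) := by
  obtain ⟨c, hc⟩ := hρ.powerLike hκ
  obtain ⟨C, m₀, hC, hm₀, H₀⟩ := hρ.near
  -- The exponent m₀ may vanish, while 1 / m is to serve as the growth exponent of the inverse.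
  set m : ℝ := m₀ + 1 with hmdef
  have hm : 0 < m := by positivity
  have H : ∀ R s t : ℝ, 1 ≤ R → 0 < s → 0 < t → s ≤ R * t → t ≤ R * s →
      ρ s ≤ C * R ^ m * ρ t := fun R s t hR hs ht hst hts => by
    refine (H₀ R s t hR hs ht hst hts).trans ?_
    have := hρ.pos t ht
    gcongr
    linarith
  clear H₀
  set p : ℝ := κ / 2 with hp
  have hp0 : 0 < p := by positivity
  have hc1 := hc.one_le
  have hc0 : 0 < c := by linarith
  have hb : 1 < (2 : ℝ) ^ p := Real.one_lt_rpow one_lt_two hp0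
  have hpow : ∀ n : ℕ, ((2 : ℝ) ^ n) ^ p = ((2 : ℝ) ^ p) ^ n := fun n => by
    rw [← Real.rpow_natCast, ← Real.rpow_natCast, ← Real.rpow_mul two_pos.le,
      ← Real.rpow_mul two_pos.le, mul_comm]
  have hρ1 := hρ.pos 1 one_pos
  have hex : ∀ u : ℝ, 0 < u → ∃ t : ℝ, 0 < t ∧ ρ t ≤ c * u ∧ u ≤ c * ρ t := by
    intro u hu
    -- The value of the inverse at u is 2^k for the greatest k with ρ(2^k) ≤ u. Power growth of ρ
    -- bounds such k from above and provides one; doubling then yields u ≲ ρ(2^k).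
    obtain ⟨k, hk, hmax⟩ := Int.exists_greatest_of_bdd (P := fun k : ℤ => ρ (2 ^ k) ≤ u) (by
      obtain ⟨n, hn⟩ := pow_unbounded_of_one_lt (c * u / ρ 1) hb
      refine ⟨n, fun z hz => ?_⟩
      by_contra! hlt
      obtain ⟨l, rfl⟩ := Int.eq_ofNat_of_zero_le (show 0 ≤ z by omega)
      have h1 := hc.low 1 (2 ^ (l : ℤ)) one_pos (by
        rw [zpow_natCast]
        exact one_le_pow₀ one_le_two)
      rw [div_one, zpow_natCast, hpow] at h1
      rw [zpow_natCast] at hz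
      have h2 : ((2 : ℝ) ^ p) ^ n ≤ (2 ^ p) ^ l := by
        gcongr
        · exact hb.le
        · omega
      rw [div_lt_iff₀ hρ1] at hn
      have h3 : ((2 : ℝ) ^ p) ^ n * ρ 1 ≤ (2 ^ p) ^ l * ρ 1 := by gcongr
      have h4 : c * ρ (2 ^ l) ≤ c * u := by gcongr
      linarith) (by
      obtain ⟨n, hn⟩ := pow_unbounded_of_one_lt (c * ρ 1 / u) hb
      refine ⟨-n, ?_⟩
      have h0 : (0 : ℝ) < 2 ^ (-n : ℤ) := by positivity
      have h1 := hc.low (2 ^ (-n : ℤ)) 1 h0 (by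
        rw [zpow_neg, zpow_natCast]
        exact inv_le_one_of_one_le₀ (one_le_pow₀ one_le_two))
      rw [one_div, ← zpow_neg, neg_neg, zpow_natCast, hpow] at h1
      rw [div_lt_iff₀ hu] at hn
      have h5 : ((2 : ℝ) ^ p) ^ n * ρ (2 ^ (-n : ℤ)) ≤ (2 ^ p) ^ n * u := h1.trans hn.le
      exact le_of_mul_le_mul_left h5 (by positivity))
    have h0 : (0 : ℝ) < 2 ^ k := by positivity
    refine ⟨2 ^ k, h0, ?_, ?_⟩
    · exact hk.trans (le_mul_of_one_le_left hu.le hc1)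
    · have h1 : u < ρ (2 ^ (k + 1)) := by
        by_contra! hle
        have := hmax (k + 1) hle
        omega
      rw [zpow_add_one₀ two_ne_zero] at h1
      exact h1.le.trans (hc.doubling _ _ h0 (by linarith) (by linarith))
  choose! τ hτ0 hτ1 hτ2 using hex
  set K : ℝ := c * c ^ 2 with hK
  have hK1 : 1 ≤ K := one_le_mul_of_one_le_of_one_le hc1 (one_le_pow₀ hc1)
  have hK0 : 0 < K := by positivity
  set L : ℝ := C * c ^ 2 with hL
  have hL0 : 0 < L := by positivity
  have lowτ : ∀ s t : ℝ, 0 < s → 0 < t → τ s ≤ τ t → (τ t / τ s) ^ p ≤ K * (t / s) := by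
    intro s t hs ht hle
    have h1 := hc.low _ _ (hτ0 s hs) hle
    have hρs := hρ.pos _ (hτ0 s hs)
    have h2 : (τ t / τ s) ^ p * s ≤ K * t := by
      have h3 := hτ0 s hs
      have h4 := hτ0 t ht
      calc (τ t / τ s) ^ p * s ≤ (τ t / τ s) ^ p * (c * ρ (τ s)) := by
            gcongr
            exact hτ2 s hs
        _ = c * ((τ t / τ s) ^ p * ρ (τ s)) := by ring
        _ ≤ c * (c * (c * t)) :=
            mul_le_mul_of_nonneg_left
              (h1.trans (mul_le_mul_of_nonneg_left (hτ1 t ht) hc0.le)) hc0.le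
        _ = _ := by rw [hK]; ring
    rw [mul_div_assoc', le_div_iff₀ hs]
    exact h2
  have lowτ' : ∀ s t : ℝ, 0 < s → 0 < t → τ s ≤ τ t → ∀ x : ℝ, K * (t / s) ≤ x →
      τ t ≤ x ^ (1 / p) * τ s := by
    intro s t hs ht hle x hx
    have h3 := hτ0 s hs
    have h4 := hτ0 t ht
    rw [← div_le_iff₀ h3]
    calc τ t / τ s = ((τ t / τ s) ^ p) ^ (1 / p) := by
          rw [← Real.rpow_mul (by positivity), mul_one_div_cancel hp0.ne', Real.rpow_one]
      _ ≤ x ^ (1 / p) := by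
          gcongr
          exact (lowτ s t hs ht hle).trans hx
  -- The three constants serve the lower bound when τ keeps the order of s and t, the lower bound
  -- when τ reverses it, and doubling.
  refine ⟨τ, max (L ^ (1 / m)) (max (K ^ (1 / m) * K ^ (1 / p)) ((K * 2) ^ (1 / p))), 1 / m, c,
    ⟨?_, by positivity, hτ0, fun s t hs hst => ?_, fun s t hs hst hts => ?_⟩, hc1,
    fun u hu => ⟨hτ1 u hu, hτ2 u hu⟩⟩
  · refine le_max_of_le_right (le_max_of_le_left ?_)
    exact one_le_mul_of_one_le_of_one_le (Real.one_le_rpow hK1 (by positivity))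
      (Real.one_le_rpow hK1 (by positivity))
  · have ht := hs.trans_le hst
    have h3 := hτ0 s hs
    have h4 := hτ0 t ht
    rcases le_total (τ s) (τ t) with hle | hle
    · have hR : 1 ≤ τ t / τ s := (one_le_div h3).2 hle
      have h5 : t / s ≤ L * (τ t / τ s) ^ m := by
        rw [div_le_iff₀ hs]
        calc t ≤ c * ρ (τ t) := hτ2 t ht
          _ ≤ c * (C * (τ t / τ s) ^ m * ρ (τ s)) := by
              gcongr
              refine H _ _ _ hR h4 h3 ?_ ?_
              · rw [div_mul_cancel₀ _ h3.ne']
              · exact hle.trans (le_mul_of_one_le_left h4.le hR)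
          _ ≤ c * (C * (τ t / τ s) ^ m * (c * s)) := by
              gcongr
              exact hτ1 s hs
          _ = _ := by rw [hL]; ring
      calc (t / s) ^ (1 / m) * τ s ≤ (L * (τ t / τ s) ^ m) ^ (1 / m) * τ s := by gcongr
        _ = L ^ (1 / m) * (τ t / τ s) * τ s := by
            rw [Real.mul_rpow hL0.le (by positivity), ← Real.rpow_mul (by positivity),
              mul_one_div_cancel hm.ne', Real.rpow_one]
        _ = L ^ (1 / m) * τ t := by rw [mul_assoc, div_mul_cancel₀ _ h3.ne']
        _ ≤ _ := by
            gcongr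
            exact le_max_left _ _
    -- A reversal of order is possible only if t/s ≤ K, and then τ(s) and τ(t) are comparable.
    · have hts : s / t ≤ 1 := (div_le_one ht).2 hst
      have h5 : t / s ≤ K := by
        have h6 := lowτ t s ht hs hle
        have h7 : 1 ≤ (τ s / τ t) ^ p := Real.one_le_rpow ((one_le_div h4).2 hle) hp0.le
        rw [div_le_iff₀ hs]
        rw [mul_div_assoc', le_div_iff₀ ht] at h6
        nlinarith
      calc (t / s) ^ (1 / m) * τ s ≤ K ^ (1 / m) * (K ^ (1 / p) * τ t) := by
            gcongr
            exact lowτ' t s ht hs hle K (mul_le_of_le_one_right hK0.le hts)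
        _ = K ^ (1 / m) * K ^ (1 / p) * τ t := by ring
        _ ≤ _ := by
            gcongr
            exact le_max_of_le_right (le_max_left _ _)
  · have ht := hs.trans_le hst
    have h3 := hτ0 s hs
    rcases le_total (τ s) (τ t) with hle | hle
    · refine (lowτ' s t hs ht hle (K * 2) ?_).trans ?_
      · gcongr
        exact (div_le_iff₀ hs).2 hts
      · gcongr
        exact le_max_of_le_right (le_max_right _ _)
    · refine hle.trans (le_mul_of_one_le_left h3.le ?_)
      refine le_max_of_le_right (le_max_of_le_left ?_)
      exact one_le_mul_of_one_le_of_one_le (Real.one_le_rpow hK1 (by positivity))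
        (Real.one_le_rpow hK1 (by positivity))

/-- The Schur test with σ = ρ, used only at u = ρ(t), where the kernel is 1. It replaces the
substitution rule, which would need a derivative of ρ. -/
theorem mnorm_comp_le {r : ℝ≥0∞} (hr : r ≠ 0) {κ : ℝ} (hκ : 0 < κ) {ρ : ℝ → ℝ}
    (hρ : RegVary κ ρ) {α : ℝ} {w : ℝ → ℝ} (hw : RegVary α w) : ∃ D : ℝ≥0, ∀ G : ℝ → ℝ≥0∞,
      QuasiConc G → mnorm r (Ioi 0) (fun t => ENNReal.ofReal (w (ρ t)) * G (ρ t)) ≤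
        D * mnorm r (Ioi 0) fun u => ENNReal.ofReal (w u) * G u := by
  obtain ⟨c, hc⟩ := hρ.powerLike hκ
  obtain ⟨C, m, hC, hm, hmod⟩ := hw.moderate
  obtain ⟨D, hD⟩ := hc.mnorm_le hr one_pos C m 1
  refine ⟨D, fun G hG => hD _ _ (hmod G hG) fun t ht M hM => ?_⟩
  have := hM (ρ t) (hρ.pos t ht)
  rw [ker_self (hρ.pos t ht)] at this
  simpa using this

/-- Now σ is the generalized inverse τ. Since ρ(τ(u)) is comparable to u, moderateness identifies
the values of w G at these two points. -/
theorem mnorm_le_comp {r : ℝ≥0∞} (hr : r ≠ 0) {κ : ℝ} (hκ : 0 < κ) {ρ : ℝ → ℝ}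
    (hρ : RegVary κ ρ) {α : ℝ} {w : ℝ → ℝ} (hw : RegVary α w) : ∃ D : ℝ≥0, ∀ G : ℝ → ℝ≥0∞,
      QuasiConc G → mnorm r (Ioi 0) (fun u => ENNReal.ofReal (w u) * G u) ≤
        D * mnorm r (Ioi 0) fun t => ENNReal.ofReal (w (ρ t)) * G (ρ t) := by
  obtain ⟨τ, c, p, A, hτ, hA, hAτ⟩ := hρ.exists_inverse hκ
  obtain ⟨C, m, hC, hm, hmod⟩ := hw.moderate
  obtain ⟨C', m', hmod'⟩ := Moderate.comp hρ C m
  obtain ⟨D, hD⟩ := hτ.mnorm_le hr one_pos C' m' (C * A ^ m).toNNReal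
  refine ⟨D, fun G hG => hD _ _ (hmod' _ (hmod G hG)) fun u hu M hM => ?_⟩
  have h1 := hτ.pos u hu
  have h2 := hM (τ u) h1
  rw [ker_self h1, Real.one_rpow, ENNReal.ofReal_one, one_mul] at h2
  refine (hmod G hG A u (ρ (τ u)) hA hu (hρ.pos _ h1) (hAτ u hu).2 (hAτ u hu).1).trans ?_
  exact mul_le_mul' le_rfl h2

/-! ### Slow variation of primitives -/

theorem RegVary.le_mnorm_Ioo {q : ℝ≥0∞} (hq : q ≠ 0) {α : ℝ} {w : ℝ → ℝ} (hw : RegVary α w) :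
    ∃ D : ℝ≥0, ∀ t : ℝ, 0 < t →
      ENNReal.ofReal (w t) ≤ D * mnorm q (Ioo 0 t) fun u => ENNReal.ofReal (w u) := by
  obtain ⟨C, m, hC, hm, hmod⟩ := hw.moderate_self
  obtain ⟨D, -, hD⟩ := Moderate.le_mnorm hq C m
  refine ⟨D, fun t ht => (hD _ hmod t (t / 2) (by positivity) (by linarith) (by linarith)).trans ?_⟩
  gcongr
  exact mnorm_mono_set (Ioo_subset_Ioo (by positivity) (by linarith)) _

theorem RegVary.le_mnorm_Ioi {q : ℝ≥0∞} (hq : q ≠ 0) {α : ℝ} {w : ℝ → ℝ} (hw : RegVary α w) :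
    ∃ D : ℝ≥0, ∀ t : ℝ, 0 < t →
      ENNReal.ofReal (w t) ≤ D * mnorm q (Ioi t) fun u => ENNReal.ofReal (w u) := by
  obtain ⟨C, m, hC, hm, hmod⟩ := hw.moderate_self
  obtain ⟨D, -, hD⟩ := Moderate.le_mnorm hq C m
  refine ⟨D, fun t ht => (hD _ hmod t t ht le_rfl (by linarith)).trans ?_⟩
  gcongr
  exact mnorm_mono_set Ioo_subset_Ioi_self _

theorem RegVary.mnorm_Ioo_ne_zero {q : ℝ≥0∞} (hq : q ≠ 0) {α : ℝ} {w : ℝ → ℝ}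
    (hw : RegVary α w) {t : ℝ} (ht : 0 < t) :
    mnorm q (Ioo 0 t) (fun u => ENNReal.ofReal (w u)) ≠ 0 := by
  obtain ⟨D, hD⟩ := hw.le_mnorm_Ioo hq
  intro h
  have := hD t ht
  rw [h, mul_zero, nonpos_iff_eq_zero, ENNReal.ofReal_eq_zero] at this
  exact this.not_gt (hw.pos t ht)

theorem RegVary.mnorm_Ioi_ne_zero {q : ℝ≥0∞} (hq : q ≠ 0) {α : ℝ} {w : ℝ → ℝ}
    (hw : RegVary α w) {t : ℝ} (ht : 0 < t) :
    mnorm q (Ioi t) (fun u => ENNReal.ofReal (w u)) ≠ 0 := by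
  obtain ⟨D, hD⟩ := hw.le_mnorm_Ioi hq
  intro h
  have := hD t ht
  rw [h, mul_zero, nonpos_iff_eq_zero, ENNReal.ofReal_eq_zero] at this
  exact this.not_gt (hw.pos t ht)

/-- On [s, t) the factor (u/s)^(ε/2) ≥ 1 is inserted to give the weight positive index. Its norm is
then ≲ (t/s)^(ε/2) b(t) ≲ (t/s)^ε b(s), and b(s) is dominated by the norm over (0, s). -/
theorem RegVary.mnorm_Ioo_growth {q : ℝ≥0∞} (hq : q ≠ 0) {b : ℝ → ℝ} (hb : RegVary 0 b) {ε : ℝ}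
    (hε : 0 < ε) : ∃ D : ℝ≥0, ∀ s t : ℝ, 0 < s → s ≤ t →
      mnorm q (Ioo 0 t) (fun u => ENNReal.ofReal (b u)) ≤
        D * ENNReal.ofReal ((t / s) ^ ε) * mnorm q (Ioo 0 s) fun u => ENNReal.ofReal (b u) := by
  obtain ⟨A, hA, hU⟩ := mnorm_union hq
  have hε2 : 0 < ε / 2 := by positivity
  have hv : RegVary (ε / 2) fun u => u ^ (ε / 2) * b u :=
    ((RegVary.rpow_id (ε / 2)).mul hb).congr (by ring) fun _ _ => rfl
  obtain ⟨E, hE⟩ := hv.mnorm_Ioo_le hq hε2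
  obtain ⟨C, hC, hbd⟩ := hb.bound (ε / 2) hε2
  obtain ⟨F, hF⟩ := hb.le_mnorm_Ioo hq
  refine ⟨A * (1 + E * C.toNNReal * F), fun s t hs hst => ?_⟩
  have ht := hs.trans_le hst
  have hbt := hb.pos t ht
  have hbs := hb.pos s hs
  set B := mnorm q (Ioo 0 s) fun u => ENNReal.ofReal (b u) with hB
  have hq1 : 1 ≤ t / s := (one_le_div hs).2 hst
  have h1 : mnorm q (Ico s t) (fun u => ENNReal.ofReal (b u)) ≤
      E * C.toNNReal * F * ENNReal.ofReal ((t / s) ^ ε) * B := by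
    calc mnorm q (Ico s t) (fun u => ENNReal.ofReal (b u))
        ≤ mnorm q (Ico s t) fun u => ENNReal.ofReal (s ^ (-(ε / 2))) *
            ENNReal.ofReal (u ^ (ε / 2) * b u) := by
          refine mnorm_mono measurableSet_Ico fun u hu => ?_
          have hu0 : 0 < u := hs.trans_le hu.1
          have hbu := hb.pos u hu0
          rw [← ENNReal.ofReal_mul (by positivity), ← mul_assoc]
          refine ENNReal.ofReal_le_ofReal (le_mul_of_one_le_left hbu.le ?_)
          rw [Real.rpow_neg hs.le, inv_mul_eq_div, ← Real.div_rpow hu0.le hs.le]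
          exact Real.one_le_rpow ((one_le_div hs).2 hu.1) hε2.le
      _ = ENNReal.ofReal (s ^ (-(ε / 2))) *
            mnorm q (Ico s t) fun u => ENNReal.ofReal (u ^ (ε / 2) * b u) :=
          mnorm_const_mul hq _ ENNReal.ofReal_ne_top _
      _ ≤ ENNReal.ofReal (s ^ (-(ε / 2))) * (E * ENNReal.ofReal (t ^ (ε / 2) * b t)) := by
          gcongr
          have hsub : Ico s t ⊆ Ioo 0 t := fun u hu => ⟨hs.trans_le hu.1, hu.2⟩
          exact (mnorm_mono_set hsub _).trans (hE t ht)
      _ = E * ENNReal.ofReal ((t / s) ^ (ε / 2) * b t) := by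
          rw [mul_left_comm, ← ENNReal.ofReal_mul (by positivity), ← mul_assoc,
            Real.rpow_neg hs.le, inv_mul_eq_div, ← Real.div_rpow ht.le hs.le]
      _ ≤ E * ENNReal.ofReal (C * (t / s) ^ ε * b s) := by
          refine mul_le_mul' le_rfl (ENNReal.ofReal_le_ofReal ?_)
          calc (t / s) ^ (ε / 2) * b t
              ≤ (t / s) ^ (ε / 2) * (C * (t / s) ^ (0 + ε / 2) * b s) := by
                gcongr
                exact (hbd s t hs hst).1
            _ = C * ((t / s) ^ (ε / 2) * (t / s) ^ (0 + ε / 2)) * b s := by ring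
            _ = _ := by
                rw [← Real.rpow_add (by positivity)]
                ring_nf
      _ = E * (C.toNNReal * ENNReal.ofReal ((t / s) ^ ε) * ENNReal.ofReal (b s)) := by
          rw [ENNReal.ofReal_mul (by positivity), ENNReal.ofReal_mul hC.le, ENNReal.ofReal]
      _ ≤ E * (C.toNNReal * ENNReal.ofReal ((t / s) ^ ε) * (F * B)) := by
          gcongr
          exact hF s hs
      _ = _ := by ring
  calc mnorm q (Ioo 0 t) (fun u => ENNReal.ofReal (b u))
      ≤ mnorm q (Ioo 0 s ∪ Ico s t) (fun u => ENNReal.ofReal (b u)) := by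
        refine mnorm_mono_set (fun u hu => ?_) _
        rcases lt_or_ge u s with h | h
        · exact Or.inl ⟨hu.1, h⟩
        · exact Or.inr ⟨h, hu.2⟩
    _ ≤ A * (B + mnorm q (Ico s t) (fun u => ENNReal.ofReal (b u))) := hU _ _ _
    _ ≤ A * (ENNReal.ofReal ((t / s) ^ ε) * B +
          E * C.toNNReal * F * ENNReal.ofReal ((t / s) ^ ε) * B) := by
        gcongr
        refine le_mul_of_one_le_left zero_le ?_
        rw [← ENNReal.ofReal_one]
        exact ENNReal.ofReal_le_ofReal (Real.one_le_rpow hq1 hε.le)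
    _ = _ := by
        push_cast
        ring

theorem ne_top_of_growth {F : ℝ → ℝ≥0∞} {D E : ℝ≥0} {ε : ℝ}
    (h : ∀ s t : ℝ, 0 < s → s ≤ t → F s ≤ E * F t ∧ F t ≤ D * ENNReal.ofReal ((t / s) ^ ε) * F s)
    {x : ℝ} (hx : 0 < x) (hFx : F x ≠ ∞) {t : ℝ} (ht : 0 < t) : F t ≠ ∞ := by
  rcases le_total t x with hle | hle
  · exact ne_top_of_le_ne_top (by finiteness) (h t x ht hle).1
  · exact ne_top_of_le_ne_top (by finiteness) (h x t hx hle).2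

theorem regVary_toReal {F : ℝ → ℝ≥0∞} (h0 : ∀ t : ℝ, 0 < t → F t ≠ 0)
    (ht : ∀ t : ℝ, 0 < t → F t ≠ ∞) (h : ∀ ε : ℝ, 0 < ε → ∃ D E : ℝ≥0, ∀ s t : ℝ, 0 < s → s ≤ t →
      F s ≤ E * F t ∧ F t ≤ D * ENNReal.ofReal ((t / s) ^ ε) * F s) :
    RegVary 0 fun t => (F t).toReal := by
  refine ⟨fun t h' => ENNReal.toReal_pos (h0 t h') (ht t h'), fun ε hε => ?_⟩
  obtain ⟨D, E, hDE⟩ := h ε hε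
  refine ⟨D + E + 1, by positivity, fun s t hs hst => ?_⟩
  have ht0 := hs.trans_le hst
  have hq1 : 1 ≤ t / s := (one_le_div hs).2 hst
  have hq : 1 ≤ (t / s) ^ ε := Real.one_le_rpow hq1 hε.le
  have hFs := ht s hs
  have hFt := ht t ht0
  obtain ⟨h1, h2⟩ := hDE s t hs hst
  have h1' := ENNReal.toReal_mono (by finiteness) h1
  have h2' := ENNReal.toReal_mono (by finiteness) h2
  rw [ENNReal.toReal_mul, ENNReal.coe_toReal] at h1'
  rw [ENNReal.toReal_mul, ENNReal.toReal_mul, ENNReal.coe_toReal,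
    ENNReal.toReal_ofReal (by positivity)] at h2'
  rw [zero_add, sub_zero]
  have hD : 0 ≤ (D : ℝ) := D.2
  have hE : 0 ≤ (E : ℝ) := E.2
  constructor
  · refine h2'.trans ?_
    gcongr
    linarith
  · refine h1'.trans ?_
    gcongr
    nlinarith

theorem RegVary.mnorm_Ioo_ne_top {q : ℝ≥0∞} (hq : q ≠ 0) {b : ℝ → ℝ} (hb : RegVary 0 b) {x : ℝ}
    (hx : 0 < x) (h : mnorm q (Ioo 0 x) (fun u => ENNReal.ofReal (b u)) ≠ ∞) {t : ℝ} (ht : 0 < t) :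
    mnorm q (Ioo 0 t) (fun u => ENNReal.ofReal (b u)) ≠ ∞ := by
  obtain ⟨D, hD⟩ := hb.mnorm_Ioo_growth hq one_pos
  refine ne_top_of_growth (F := fun t => mnorm q (Ioo 0 t) (fun u => ENNReal.ofReal (b u)))
    (D := D) (E := 1) (ε := 1) (fun s t hs hst => ⟨?_, hD s t hs hst⟩) hx h ht
  rw [ENNReal.coe_one, one_mul]
  exact mnorm_mono_set (Ioo_subset_Ioo_right hst) _

theorem RegVary.mnorm_Ioo_toReal {q : ℝ≥0∞} (hq : q ≠ 0) {b : ℝ → ℝ} (hb : RegVary 0 b)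
    (h : mnorm q (Ioo 0 1) (fun u => ENNReal.ofReal (b u)) ≠ ∞) :
    RegVary 0 fun t => (mnorm q (Ioo 0 t) fun u => ENNReal.ofReal (b u)).toReal := by
  refine regVary_toReal (fun t ht => hb.mnorm_Ioo_ne_zero hq ht)
    (fun t ht => hb.mnorm_Ioo_ne_top hq one_pos h ht) fun ε hε => ?_
  obtain ⟨D, hD⟩ := hb.mnorm_Ioo_growth hq hε
  refine ⟨D, 1, fun s t hs hst => ⟨?_, hD s t hs hst⟩⟩
  rw [ENNReal.coe_one, one_mul]
  exact mnorm_mono_set (Ioo_subset_Ioo_right hst) _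

/-- `‖b(s) ‖a‖_{q,(0,s)}‖_{r,(0,t)} + ‖b‖_{r,(t,∞)} ‖a‖_{q,(0,t)}` with respect to `du / u`. -/
noncomputable def primitiveSum (r : ℝ≥0∞) (b : ℝ → ℝ) (q : ℝ≥0∞) (a : ℝ → ℝ) (t : ℝ) : ℝ≥0∞ :=
  mnorm r (Ioo 0 t) (fun s => ENNReal.ofReal (b s) *
    mnorm q (Ioo 0 s) fun u => ENNReal.ofReal (a u)) +
  mnorm r (Ioi t) (fun s => ENNReal.ofReal (b s)) *
    mnorm q (Ioo 0 t) fun u => ENNReal.ofReal (a u)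

/-- `‖b(s) ‖a‖_{q,(0,min(s,t))}‖_{r,(0,∞)}`, which is equivalent to `primitiveSum`. -/
noncomputable def primitiveMin (r : ℝ≥0∞) (b : ℝ → ℝ) (q : ℝ≥0∞) (a : ℝ → ℝ) (t : ℝ) : ℝ≥0∞ :=
  mnorm r (Ioi 0) fun s => ENNReal.ofReal (b s) *
    mnorm q (Ioo 0 (min s t)) fun u => ENNReal.ofReal (a u)

/-- The two summands are the parts s < t and s > t of `primitiveMin`. The latter form is the one in
which monotonicity and growth in t are visible. -/
theorem primitiveSum_le {r q : ℝ≥0∞} (hr : r ≠ 0) (a b : ℝ → ℝ) {t : ℝ} (ht : 0 < t) :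
    primitiveSum r b q a t ≤ 2 * primitiveMin r b q a t := by
  rw [two_mul]
  refine add_le_add ?_ ?_
  · refine le_trans (mnorm_mono measurableSet_Ioo fun s hs => ?_)
      (mnorm_mono_set Ioo_subset_Ioi_self _)
    rw [min_eq_left hs.2.le]
  · rw [mul_comm]
    refine (const_mul_mnorm_le hr _ _ _).trans ?_
    refine le_trans (mnorm_mono measurableSet_Ioi fun s hs => ?_)
      (mnorm_mono_set (Ioi_subset_Ioi ht.le) _)
    rw [min_eq_right (le_of_lt hs), mul_comm]

theorem primitiveMin_le {r : ℝ≥0∞} (hr : r ≠ 0) : ∃ C : ℝ≥0, ∀ (q : ℝ≥0∞) (a b : ℝ → ℝ) (t : ℝ),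
    0 < t → mnorm q (Ioo 0 t) (fun u => ENNReal.ofReal (a u)) ≠ ∞ →
    primitiveMin r b q a t ≤ C * primitiveSum r b q a t := by
  obtain ⟨C, -, hC⟩ := mnorm_union hr
  refine ⟨C, fun q a b t ht hA => ?_⟩
  have hset : Ioi (0 : ℝ) ⊆ Ioo 0 t ∪ Ici t := fun u hu => by
    rcases lt_or_ge u t with h | h
    · exact Or.inl ⟨hu, h⟩
    · exact Or.inr h
  refine ((mnorm_mono_set hset _).trans (hC _ _ _)).trans ?_
  gcongr
  refine add_le_add ?_ ?_
  · refine mnorm_mono measurableSet_Ioo fun s hs => ?_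
    rw [min_eq_left hs.2.le]
  · rw [mnorm_congr_set Ioi_ae_eq_Ici.symm, mul_comm, ← mnorm_const_mul hr _ hA]
    refine mnorm_mono measurableSet_Ioi fun s hs => ?_
    rw [min_eq_right (le_of_lt hs), mul_comm]

theorem primitiveMin_mono {r q : ℝ≥0∞} (a b : ℝ → ℝ) {s t : ℝ} (hst : s ≤ t) :
    primitiveMin r b q a s ≤ primitiveMin r b q a t := by
  refine mnorm_mono measurableSet_Ioi fun u _ => ?_
  gcongr
  exact mnorm_mono_set (Ioo_subset_Ioo_right (min_le_min_left _ hst)) _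

/-- Here t enters only through the inner upper limit, and min(u, t)/min(u, s) ≤ t/s. The growth of
the inner primitive therefore passes through the outer norm, whatever b is. -/
theorem primitiveMin_growth {r q : ℝ≥0∞} (hr : r ≠ 0) (hq : q ≠ 0) {a : ℝ → ℝ} (ha : RegVary 0 a)
    {ε : ℝ} (hε : 0 < ε) : ∃ D : ℝ≥0, ∀ (b : ℝ → ℝ) (s t : ℝ), 0 < s → s ≤ t →
      primitiveMin r b q a t ≤ D * ENNReal.ofReal ((t / s) ^ ε) * primitiveMin r b q a s := by
  obtain ⟨D, hD⟩ := ha.mnorm_Ioo_growth hq hε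
  refine ⟨D, fun b s t hs hst => ?_⟩
  rw [primitiveMin, primitiveMin, ← mnorm_const_mul hr _ (by finiteness)]
  refine mnorm_mono measurableSet_Ioi fun u hu => ?_
  have hu0 : 0 < u := hu
  have hms : 0 < min u s := lt_min hu hs
  have h1 := hD (min u s) (min u t) hms (min_le_min_left _ hst)
  have h2 : min u t / min u s ≤ t / s := by
    rw [div_le_div_iff₀ hms hs]
    rcases le_total u s with h | h
    · rw [min_eq_left h, min_eq_left (h.trans hst)]
      nlinarith
    · rw [min_eq_right h]
      nlinarith [min_le_right u t]
  have h3 : 0 < min u t := lt_min hu (hs.trans_le hst)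
  calc ENNReal.ofReal (b u) * mnorm q (Ioo 0 (min u t)) (fun u => ENNReal.ofReal (a u))
      ≤ ENNReal.ofReal (b u) * (D * ENNReal.ofReal ((t / s) ^ ε) *
          mnorm q (Ioo 0 (min u s)) (fun u => ENNReal.ofReal (a u))) := by
        gcongr
        refine h1.trans ?_
        gcongr
    _ = _ := by ring

/-- An inner norm infinite at 1/2 would be infinite on all of (1/2, 1), a set of positive mass where
b > 0, and the iterated norm would be infinite. -/
theorem RegVary.ne_top_of_mnorm_primitive {r q : ℝ≥0∞} (hr : r ≠ 0) (hq : q ≠ 0) {a b : ℝ → ℝ}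
    (ha : RegVary 0 a) (hb : RegVary 0 b)
    (h : mnorm r (Ioo 0 1) (fun s => ENNReal.ofReal (b s) *
      mnorm q (Ioo 0 s) fun u => ENNReal.ofReal (a u)) ≠ ∞) {t : ℝ} (ht : 0 < t) :
    mnorm q (Ioo 0 t) (fun u => ENNReal.ofReal (a u)) ≠ ∞ := by
  refine ha.mnorm_Ioo_ne_top hq (show (0 : ℝ) < 1 / 2 by norm_num) (fun htop => h ?_) ht
  rw [eq_top_iff]
  refine le_trans ?_ (mnorm_mono_set (Ioo_subset_Ioo_left (show (0 : ℝ) ≤ 1 / 2 by norm_num)) _)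
  calc (∞ : ℝ≥0∞) = ∞ * 2⁻¹ ^ (1 / r.toReal) := by
        rw [ENNReal.top_mul]
        simp
    _ ≤ mnorm r (Ioo (1 / 2) (2 * (1 / 2))) fun _ => ∞ :=
        le_mnorm_Ioo_const hr (by norm_num) _
    _ ≤ _ := by
        norm_num
        refine mnorm_mono measurableSet_Ioo fun s hs => ?_
        have h1 : mnorm q (Ioo 0 s) (fun u => ENNReal.ofReal (a u)) = ∞ := by
          rw [eq_top_iff, ← htop]
          exact mnorm_mono_set (Ioo_subset_Ioo_right hs.1.le) _
        have h2 := hb.pos s (by linarith [hs.1])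
        rw [h1, ENNReal.mul_top]
        simpa using h2

/-- The assumptions on the weights `a` and `b` of the space `𝓛`. -/
structure AdmissibleL (r : ℝ≥0∞) (b : ℝ → ℝ) (q : ℝ≥0∞) (a : ℝ → ℝ) : Prop where
  hr : r ≠ 0
  hq : q ≠ 0
  ha : RegVary 0 a
  hb : RegVary 0 b
  fin_top : mnorm r (Ioi 1) (fun s => ENNReal.ofReal (b s)) ≠ ∞
  fin_zero : mnorm r (Ioo 0 1) (fun s => ENNReal.ofReal (b s) *
    mnorm q (Ioo 0 s) fun u => ENNReal.ofReal (a u)) ≠ ∞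

namespace AdmissibleL

variable {r q : ℝ≥0∞} {a b : ℝ → ℝ}

theorem prim_ne_top (h : AdmissibleL r b q a) {t : ℝ} (ht : 0 < t) :
    mnorm q (Ioo 0 t) (fun u => ENNReal.ofReal (a u)) ≠ ∞ :=
  h.ha.ne_top_of_mnorm_primitive h.hr h.hq h.hb h.fin_zero ht

theorem sum_ne_zero (h : AdmissibleL r b q a) {t : ℝ} (ht : 0 < t) :
    primitiveSum r b q a t ≠ 0 := by
  intro h0
  rw [primitiveSum, add_eq_zero, mul_eq_zero] at h0
  rcases h0.2 with h1 | h1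
  · exact h.hb.mnorm_Ioi_ne_zero h.hr ht h1
  · exact h.ha.mnorm_Ioo_ne_zero h.hq ht h1

theorem sum_growth (h : AdmissibleL r b q a) {ε : ℝ} (hε : 0 < ε) :
    ∃ D E : ℝ≥0, ∀ s t : ℝ, 0 < s → s ≤ t →
      primitiveSum r b q a s ≤ E * primitiveSum r b q a t ∧
      primitiveSum r b q a t ≤ D * ENNReal.ofReal ((t / s) ^ ε) * primitiveSum r b q a s := by
  obtain ⟨C, hC⟩ := primitiveMin_le h.hr
  obtain ⟨D, hD⟩ := primitiveMin_growth h.hr h.hq h.ha hε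
  refine ⟨2 * D * C, 2 * C, fun s t hs hst => ⟨?_, ?_⟩⟩
  · have ht := hs.trans_le hst
    calc primitiveSum r b q a s ≤ 2 * primitiveMin r b q a s := primitiveSum_le h.hr a b hs
      _ ≤ 2 * primitiveMin r b q a t := by
          gcongr
          exact primitiveMin_mono a b hst
      _ ≤ 2 * (C * primitiveSum r b q a t) := by
          gcongr
          exact hC q a b t ht (h.prim_ne_top ht)
      _ = _ := by
          push_cast
          ring
  · have ht := hs.trans_le hst
    calc primitiveSum r b q a t ≤ 2 * primitiveMin r b q a t := primitiveSum_le h.hr a b ht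
      _ ≤ 2 * (D * ENNReal.ofReal ((t / s) ^ ε) * primitiveMin r b q a s) := by
          gcongr
          exact hD b s t hs hst
      _ ≤ 2 * (D * ENNReal.ofReal ((t / s) ^ ε) * (C * primitiveSum r b q a s)) := by
          gcongr
          exact hC q a b s hs (h.prim_ne_top hs)
      _ = _ := by
          push_cast
          ring

theorem sum_ne_top (h : AdmissibleL r b q a) {t : ℝ} (ht : 0 < t) :
    primitiveSum r b q a t ≠ ∞ := by
  obtain ⟨D, E, hDE⟩ := h.sum_growth one_pos
  exact ne_top_of_growth hDE one_pos (ENNReal.add_ne_top.2 ⟨h.fin_zero,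
    ENNReal.mul_ne_top h.fin_top (h.prim_ne_top one_pos)⟩) ht

theorem regVary (h : AdmissibleL r b q a) :
    RegVary 0 fun t => (primitiveSum r b q a t).toReal :=
  regVary_toReal (fun _ ht => h.sum_ne_zero ht) (fun _ ht => h.sum_ne_top ht) fun _ hε =>
    h.sum_growth hε

end AdmissibleL

/-! ### The functionals of the spaces `𝓡` and `𝓛` -/

/-- `‖b(s) ‖w k‖_{q,(s,∞)}‖_{r,(0,∞)}`. -/
noncomputable def funR (r : ℝ≥0∞) (b : ℝ → ℝ) (q : ℝ≥0∞) (w : ℝ → ℝ) (k : ℝ → ℝ≥0∞) : ℝ≥0∞ :=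
  mnorm r (Ioi 0) fun s => ENNReal.ofReal (b s) *
    mnorm q (Ioi s) fun u => ENNReal.ofReal (w u) * k u

/-- `‖b(s) ‖w k‖_{q,(0,s)}‖_{r,(0,∞)}`. -/
noncomputable def funL (r : ℝ≥0∞) (b : ℝ → ℝ) (q : ℝ≥0∞) (w : ℝ → ℝ) (k : ℝ → ℝ≥0∞) : ℝ≥0∞ :=
  mnorm r (Ioi 0) fun s => ENNReal.ofReal (b s) *
    mnorm q (Ioo 0 s) fun u => ENNReal.ofReal (w u) * k u

/-- `‖b(s) ‖w k‖_{q,(s,t)}‖_{r,(0,t)}`. -/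
noncomputable def locR (r : ℝ≥0∞) (b : ℝ → ℝ) (q : ℝ≥0∞) (w : ℝ → ℝ) (k : ℝ → ℝ≥0∞) (t : ℝ) :
    ℝ≥0∞ :=
  mnorm r (Ioo 0 t) fun s => ENNReal.ofReal (b s) *
    mnorm q (Ioo s t) fun u => ENNReal.ofReal (w u) * k u

/-- `‖b(s) ‖w k‖_{q,(t,s)}‖_{r,(t,∞)}`. -/
noncomputable def locL (r : ℝ≥0∞) (b : ℝ → ℝ) (q : ℝ≥0∞) (w : ℝ → ℝ) (k : ℝ → ℝ≥0∞) (t : ℝ) :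
    ℝ≥0∞ :=
  mnorm r (Ioi t) fun s => ENNReal.ofReal (b s) *
    mnorm q (Ioo t s) fun u => ENNReal.ofReal (w u) * k u

theorem weight_mul_mnorm_le {r q : ℝ≥0∞} (hr : r ≠ 0) {S : Set ℝ} (hS : MeasurableSet S)
    (b : ℝ → ℝ) {T : ℝ → Set ℝ} (hT : ∀ s, MeasurableSet (T s)) (hq : q ≠ 0) (w : ℝ → ℝ)
    {f g : ℝ → ℝ≥0∞} {c : ℝ≥0∞} (hc : c ≠ ∞) (h : ∀ s ∈ S, ∀ u ∈ T s, f u ≤ c * g u) :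
    mnorm r S (fun s => ENNReal.ofReal (b s) * mnorm q (T s) fun u => ENNReal.ofReal (w u) * f u) ≤
      c * mnorm r S fun s => ENNReal.ofReal (b s) *
        mnorm q (T s) fun u => ENNReal.ofReal (w u) * g u := by
  rw [← mnorm_const_mul hr _ hc]
  refine mnorm_mono hS fun s hs => ?_
  rw [mul_left_comm, ← mnorm_const_mul hq _ hc]
  gcongr
  refine mnorm_mono (hT s) fun u hu => ?_
  rw [mul_left_comm]
  gcongr
  exact h s hs u hu

/-- Monotonicity of T makes the inner norm monotone in s, hence measurable, as the splitting of the
outer norm requires. -/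
theorem weight_mul_mnorm_add {r q : ℝ≥0∞} (hr : r ≠ 0) (hq : q ≠ 0) {α β : ℝ} {b w : ℝ → ℝ}
    (hb : RegVary β b) (hw : RegVary α w) : ∃ C : ℝ≥0, ∀ (S : Set ℝ) (T : ℝ → Set ℝ),
      MeasurableSet S → S ⊆ Ioi 0 → (∀ s, MeasurableSet (T s)) → (∀ s ∈ S, T s ⊆ Ioi 0) →
      (Monotone T ∨ Antitone T) → ∀ f g : ℝ → ℝ≥0∞, Measurable f →
      mnorm r S (fun s => ENNReal.ofReal (b s) *
          mnorm q (T s) fun u => ENNReal.ofReal (w u) * (f u + g u)) ≤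
        C * (mnorm r S (fun s => ENNReal.ofReal (b s) *
            mnorm q (T s) fun u => ENNReal.ofReal (w u) * f u) +
          mnorm r S fun s => ENNReal.ofReal (b s) *
            mnorm q (T s) fun u => ENNReal.ofReal (w u) * g u) := by
  obtain ⟨A, -, hA⟩ := mnorm_weight_add hr hb
  obtain ⟨B, -, hB⟩ := mnorm_weight_add hq hw
  refine ⟨B * A, fun S T hS hS0 hT hT0 hmono f g hf => ?_⟩
  have hm : Measurable fun s => mnorm q (T s) fun u => ENNReal.ofReal (w u) * f u := by
    rcases hmono with h | h
    · exact Monotone.measurable fun s t hst => mnorm_mono_set (h hst) _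
    · exact Antitone.measurable fun s t hst => mnorm_mono_set (h hst) _
  calc mnorm r S (fun s => ENNReal.ofReal (b s) *
          mnorm q (T s) fun u => ENNReal.ofReal (w u) * (f u + g u))
      ≤ mnorm r S (fun s => B * (ENNReal.ofReal (b s) *
          ((mnorm q (T s) fun u => ENNReal.ofReal (w u) * f u) +
            mnorm q (T s) fun u => ENNReal.ofReal (w u) * g u))) := by
        refine mnorm_mono hS fun s hs => ?_
        rw [mul_left_comm]
        gcongr
        exact hB (T s) (hT s) (hT0 s hs) f g hf
    _ = B * mnorm r S (fun s => ENNReal.ofReal (b s) *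
          ((mnorm q (T s) fun u => ENNReal.ofReal (w u) * f u) +
            mnorm q (T s) fun u => ENNReal.ofReal (w u) * g u)) :=
        mnorm_const_mul hr _ ENNReal.coe_ne_top _
    _ ≤ B * (A * _) := mul_le_mul' le_rfl (hA S hS hS0 _ _ hm)
    _ = _ := by
        push_cast
        ring

theorem locR_add {r q : ℝ≥0∞} (hr : r ≠ 0) (hq : q ≠ 0) {α β : ℝ} {b w : ℝ → ℝ}
    (hb : RegVary β b) (hw : RegVary α w) : ∃ C : ℝ≥0, ∀ (f g : ℝ → ℝ≥0∞) (t : ℝ), Measurable f →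
      locR r b q w (fun u => f u + g u) t ≤ C * (locR r b q w f t + locR r b q w g t) := by
  obtain ⟨C, hC⟩ := weight_mul_mnorm_add hr hq hb hw
  exact ⟨C, fun f g t hf => hC _ (fun s => Ioo s t) measurableSet_Ioo Ioo_subset_Ioi_self
    (fun _ => measurableSet_Ioo) (fun s hs u hu => hs.1.trans hu.1)
    (Or.inr fun s s' h => Ioo_subset_Ioo_left h) f g hf⟩

theorem locL_add {r q : ℝ≥0∞} (hr : r ≠ 0) (hq : q ≠ 0) {α β : ℝ} {b w : ℝ → ℝ}
    (hb : RegVary β b) (hw : RegVary α w) : ∃ C : ℝ≥0, ∀ (f g : ℝ → ℝ≥0∞) (t : ℝ), 0 < t →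
      Measurable f →
      locL r b q w (fun u => f u + g u) t ≤ C * (locL r b q w f t + locL r b q w g t) := by
  obtain ⟨C, hC⟩ := weight_mul_mnorm_add hr hq hb hw
  exact ⟨C, fun f g t ht hf => hC _ (fun s => Ioo t s) measurableSet_Ioi (Ioi_subset_Ioi ht.le)
    (fun _ => measurableSet_Ioo) (fun s _ u hu => ht.trans hu.1)
    (Or.inl fun s s' h => Ioo_subset_Ioo_right h) f g hf⟩

theorem locR_le_funR {r q : ℝ≥0∞} (b w : ℝ → ℝ) (k : ℝ → ℝ≥0∞) (t : ℝ) :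
    locR r b q w k t ≤ funR r b q w k := by
  refine le_trans (mnorm_mono measurableSet_Ioo fun s _ => ?_)
    (mnorm_mono_set Ioo_subset_Ioi_self _)
  gcongr
  exact mnorm_mono_set Ioo_subset_Ioi_self _

theorem locL_le_funL {r q : ℝ≥0∞} (b w : ℝ → ℝ) (k : ℝ → ℝ≥0∞) {t : ℝ} (ht : 0 < t) :
    locL r b q w k t ≤ funL r b q w k := by
  refine le_trans (mnorm_mono measurableSet_Ioi fun s _ => ?_)
    (mnorm_mono_set (Ioi_subset_Ioi ht.le) _)
  gcongr
  exact mnorm_mono_set (Ioo_subset_Ioo_left ht.le) _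

/-- For s < t the inner interval contains (t, 2t), where w k is comparable to its value at t. -/
theorem le_funR {r q : ℝ≥0∞} (hr : r ≠ 0) (hq : q ≠ 0) {α : ℝ} (b : ℝ → ℝ) {w : ℝ → ℝ}
    (hw : RegVary α w) : ∃ C : ℝ≥0, ∀ k : ℝ → ℝ≥0∞, QuasiConc k → ∀ t : ℝ, 0 < t →
      ENNReal.ofReal (w t) * k t * mnorm r (Ioo 0 t) (fun u => ENNReal.ofReal (b u)) ≤
        C * funR r b q w k := by
  obtain ⟨C, m, hC, hm, hmod⟩ := hw.moderate
  obtain ⟨D, -, hD⟩ := Moderate.le_mnorm hq C m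
  refine ⟨D, fun k hk t ht => (const_mul_mnorm_le hr _ _ _).trans ?_⟩
  rw [funR, ← mnorm_const_mul hr _ ENNReal.coe_ne_top]
  refine le_trans (mnorm_mono measurableSet_Ioo fun s hs => ?_)
    (mnorm_mono_set Ioo_subset_Ioi_self _)
  rw [mul_comm, mul_left_comm (D : ℝ≥0∞)]
  refine mul_le_mul' le_rfl ?_
  refine (hD _ (hmod k hk) t t ht le_rfl (by linarith)).trans ?_
  gcongr
  exact mnorm_mono_set (fun u hu => hs.2.trans hu.1) _

/-- Nothing above t is available, so s is kept below t/2 and the inner norm is taken over (t/2, t);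
the primitive of b loses only a constant. This bound removes the middle term when θ = 0. -/
theorem le_locR {r q : ℝ≥0∞} (hr : r ≠ 0) (hq : q ≠ 0) {α : ℝ} {b : ℝ → ℝ} (hb : RegVary 0 b)
    {w : ℝ → ℝ} (hw : RegVary α w) : ∃ C : ℝ≥0, ∀ k : ℝ → ℝ≥0∞, QuasiConc k → ∀ t : ℝ, 0 < t →
      ENNReal.ofReal (w t) * k t * mnorm r (Ioo 0 t) (fun u => ENNReal.ofReal (b u)) ≤
        C * locR r b q w k t := by
  obtain ⟨C, m, hC, hm, hmod⟩ := hw.moderate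
  obtain ⟨D, -, hD⟩ := Moderate.le_mnorm hq C m
  obtain ⟨E, hE⟩ := hb.mnorm_Ioo_growth hr one_pos
  refine ⟨E * 2 * D, fun k hk t ht => ?_⟩
  have ht2 : 0 < t / 2 := by positivity
  have h1 := hE (t / 2) t ht2 (by linarith)
  rw [div_div_cancel₀ ht.ne', Real.rpow_one, ENNReal.ofReal_ofNat] at h1
  calc ENNReal.ofReal (w t) * k t * mnorm r (Ioo 0 t) (fun u => ENNReal.ofReal (b u))
      ≤ ENNReal.ofReal (w t) * k t *
          (E * 2 * mnorm r (Ioo 0 (t / 2)) (fun u => ENNReal.ofReal (b u))) := by gcongr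
    _ = E * 2 * (ENNReal.ofReal (w t) * k t *
          mnorm r (Ioo 0 (t / 2)) (fun u => ENNReal.ofReal (b u))) := by ring
    _ ≤ E * 2 * (D * locR r b q w k t) := by
        refine mul_le_mul' le_rfl ?_
        refine (const_mul_mnorm_le hr _ _ _).trans ?_
        rw [locR, ← mnorm_const_mul hr _ ENNReal.coe_ne_top]
        refine le_trans (mnorm_mono measurableSet_Ioo fun s hs => ?_)
          (mnorm_mono_set (Ioo_subset_Ioo_right (by linarith)) _)
        rw [mul_comm, mul_left_comm (D : ℝ≥0∞)]
        refine mul_le_mul' le_rfl ?_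
        refine (hD _ (hmod k hk) t (t / 2) ht2 (by linarith) (by linarith)).trans ?_
        gcongr
        refine mnorm_mono_set (T := Ioo s t) (fun u hu => ⟨hs.2.trans hu.1, ?_⟩) _
        linarith [hu.2]
    _ = _ := by
        push_cast
        ring

/-- The profile k(min(u, t)) stands for the part f₀ of a decomposition at t. It is constant beyond
t, where the negative index reduces the tails of w and b w to their values at t. -/
theorem funR_min_le {r q : ℝ≥0∞} (hr : r ≠ 0) (hq : q ≠ 0) {α : ℝ} (hα : α < 0) {b : ℝ → ℝ}
    (hb : RegVary 0 b) {w : ℝ → ℝ} (hw : RegVary α w) : ∃ C : ℝ≥0, ∀ k : ℝ → ℝ≥0∞,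
      ∀ t : ℝ, 0 < t → k t ≠ ∞ →
      funR r b q w (fun u => k (min u t)) ≤ C * (locR r b q w k t +
        ENNReal.ofReal (w t) * k t * mnorm r (Ioo 0 t) fun u => ENNReal.ofReal (b u)) := by
  obtain ⟨U, hU1, hU⟩ := mnorm_union hr
  obtain ⟨V, hV1, hV⟩ := mnorm_union hq
  obtain ⟨A, -, hA⟩ := mnorm_weight_add hr hb
  obtain ⟨E, hE⟩ := hw.mnorm_Ioi_le hq hα
  have hbw : RegVary α fun t => b t * w t := (hb.mul hw).congr (zero_add _) fun _ _ => rfl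
  obtain ⟨F, hF⟩ := hbw.mnorm_Ioi_le hr hα
  obtain ⟨G, hG⟩ := hb.le_mnorm_Ioo hr
  refine ⟨U * (V * (A * (1 + E)) + E * F * G), fun k t ht hkt => ?_⟩
  set B := mnorm r (Ioo 0 t) fun u => ENNReal.ofReal (b u) with hB
  have hset : Ioi (0 : ℝ) ⊆ Ioo 0 t ∪ Ici t := fun u hu => by
    rcases lt_or_ge u t with h | h
    · exact Or.inl ⟨hu, h⟩
    · exact Or.inr h
  have hconst : E * (ENNReal.ofReal (w t) * k t) ≠ ∞ := by finiteness
  have hlow : mnorm r (Ioo 0 t) (fun s => ENNReal.ofReal (b s) *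
      mnorm q (Ioi s) fun u => ENNReal.ofReal (w u) * k (min u t)) ≤
      V * (A * (1 + E)) * (locR r b q w k t + ENNReal.ofReal (w t) * k t * B) := by
    have hin : ∀ s ∈ Ioo 0 t, mnorm q (Ioi s) (fun u => ENNReal.ofReal (w u) * k (min u t)) ≤
        V * (E * (ENNReal.ofReal (w t) * k t) +
          mnorm q (Ioo s t) fun u => ENNReal.ofReal (w u) * k u) := by
      intro s hs
      have hset' : Ioi s ⊆ Ici t ∪ Ioo s t := fun u hu => by
        rcases lt_or_ge u t with h | h
        · exact Or.inr ⟨hu, h⟩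
        · exact Or.inl h
      refine ((mnorm_mono_set hset' _).trans (hV _ _ _)).trans ?_
      refine mul_le_mul' le_rfl (add_le_add ?_ (mnorm_mono measurableSet_Ioo fun u hu => ?_))
      · rw [mnorm_congr_set Ioi_ae_eq_Ici.symm]
        calc mnorm q (Ioi t) (fun u => ENNReal.ofReal (w u) * k (min u t))
            = mnorm q (Ioi t) (fun u => k t * ENNReal.ofReal (w u)) :=
              mnorm_congr measurableSet_Ioi fun u hu => by rw [min_eq_right (le_of_lt hu), mul_comm]
          _ = k t * mnorm q (Ioi t) (fun u => ENNReal.ofReal (w u)) := mnorm_const_mul hq _ hkt _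
          _ ≤ k t * (E * ENNReal.ofReal (w t)) := by
              gcongr
              exact hE t ht
          _ = _ := by ring
      · rw [min_eq_left hu.2.le]
    calc mnorm r (Ioo 0 t) (fun s => ENNReal.ofReal (b s) *
          mnorm q (Ioi s) fun u => ENNReal.ofReal (w u) * k (min u t))
        ≤ mnorm r (Ioo 0 t) (fun s => V * (ENNReal.ofReal (b s) *
            (E * (ENNReal.ofReal (w t) * k t) +
            mnorm q (Ioo s t) fun u => ENNReal.ofReal (w u) * k u))) := by
          refine mnorm_mono measurableSet_Ioo fun s hs => ?_
          rw [mul_left_comm]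
          gcongr
          exact hin s hs
      _ = V * mnorm r (Ioo 0 t) (fun s => ENNReal.ofReal (b s) *
            (E * (ENNReal.ofReal (w t) * k t) +
            mnorm q (Ioo s t) fun u => ENNReal.ofReal (w u) * k u)) :=
          mnorm_const_mul hr _ ENNReal.coe_ne_top _
      _ ≤ V * (A * (mnorm r (Ioo 0 t) (fun s => ENNReal.ofReal (b s) *
            (E * (ENNReal.ofReal (w t) * k t))) + locR r b q w k t)) := by
          gcongr
          exact hA _ measurableSet_Ioo Ioo_subset_Ioi_self _ _ measurable_const
      _ = V * (A * (E * (ENNReal.ofReal (w t) * k t) * B + locR r b q w k t)) := by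
          congr 3
          rw [← mnorm_const_mul hr _ hconst]
          exact mnorm_congr measurableSet_Ioo fun u _ => mul_comm _ _
      _ ≤ V * (A * ((1 + E) * (ENNReal.ofReal (w t) * k t * B) +
            (1 + E) * locR r b q w k t)) := by
          refine mul_le_mul' le_rfl (mul_le_mul' le_rfl (add_le_add ?_ ?_))
          · rw [mul_assoc]
            gcongr
            exact le_add_self
          · exact le_mul_of_one_le_left zero_le le_self_add
      _ = _ := by ring
  have hhigh : mnorm r (Ici t) (fun s => ENNReal.ofReal (b s) *
      mnorm q (Ioi s) fun u => ENNReal.ofReal (w u) * k (min u t)) ≤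
      E * F * G * (locR r b q w k t + ENNReal.ofReal (w t) * k t * B) := by
    rw [mnorm_congr_set Ioi_ae_eq_Ici.symm]
    calc mnorm r (Ioi t) (fun s => ENNReal.ofReal (b s) *
          mnorm q (Ioi s) fun u => ENNReal.ofReal (w u) * k (min u t))
        ≤ mnorm r (Ioi t) (fun s => k t * E * ENNReal.ofReal (b s * w s)) := by
          refine mnorm_mono measurableSet_Ioi fun s hs => ?_
          have hs0 : 0 < s := ht.trans hs
          have h1 : mnorm q (Ioi s) (fun u => ENNReal.ofReal (w u) * k (min u t)) ≤
              k t * (E * ENNReal.ofReal (w s)) := by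
            calc mnorm q (Ioi s) (fun u => ENNReal.ofReal (w u) * k (min u t))
                = mnorm q (Ioi s) (fun u => k t * ENNReal.ofReal (w u)) :=
                  mnorm_congr measurableSet_Ioi fun u hu => by
                    rw [min_eq_right (le_of_lt (lt_trans hs hu)), mul_comm]
              _ = k t * mnorm q (Ioi s) (fun u => ENNReal.ofReal (w u)) :=
                  mnorm_const_mul hq _ hkt _
              _ ≤ _ := by
                  gcongr
                  exact hE s hs0
          rw [ENNReal.ofReal_mul (hb.pos s hs0).le]
          calc _ ≤ ENNReal.ofReal (b s) * (k t * (E * ENNReal.ofReal (w s))) := by gcongr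
            _ = _ := by ring
      _ = k t * E * mnorm r (Ioi t) (fun s => ENNReal.ofReal (b s * w s)) :=
          mnorm_const_mul hr _ (by finiteness) _
      _ ≤ k t * E * (F * (G * B * ENNReal.ofReal (w t))) := by
          gcongr
          refine (hF t ht).trans ?_
          rw [ENNReal.ofReal_mul (hb.pos t ht).le]
          gcongr
          exact hG t ht
      _ = E * F * G * (ENNReal.ofReal (w t) * k t * B) := by ring
      _ ≤ _ := by
          gcongr
          exact le_add_self
  refine ((mnorm_mono_set hset _).trans (hU _ _ _)).trans ?_
  refine (mul_le_mul' le_rfl (add_le_add hlow hhigh)).trans_eq ?_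
  push_cast
  ring

/-- With positive index the inner interval (s, t) may be enlarged to (0, t). The inner bound no
longer depends on s, and the outer norm is that of b alone. -/
theorem locR_le {r q : ℝ≥0∞} (hr : r ≠ 0) (hq : q ≠ 0) {β : ℝ} (hβ : 0 < β) {b w φ : ℝ → ℝ}
    (hφ : RegVary β fun u => w u * φ u) (hw : ∀ u : ℝ, 0 < u → 0 < w u) : ∃ C : ℝ≥0, 1 ≤ C ∧
      ∀ (k : ℝ → ℝ≥0∞) (M : ℝ≥0∞), M ≠ ∞ → ∀ t : ℝ, 0 < t →
      (∀ u ∈ Ioo 0 t, k u ≤ M * ENNReal.ofReal (φ u)) →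
      locR r b q w k t ≤ C * M * ENNReal.ofReal (w t * φ t) *
        mnorm r (Ioo 0 t) fun u => ENNReal.ofReal (b u) := by
  obtain ⟨C, hC⟩ := hφ.mnorm_Ioo_le hq hβ
  refine ⟨1 + C, le_self_add, fun k M hM t ht hk => ?_⟩
  rw [← mnorm_const_mul hr _ (by finiteness)]
  refine mnorm_mono measurableSet_Ioo fun s hs => ?_
  rw [mul_comm]
  gcongr
  calc mnorm q (Ioo s t) (fun u => ENNReal.ofReal (w u) * k u)
      ≤ mnorm q (Ioo 0 t) (fun u => M * ENNReal.ofReal (w u * φ u)) := by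
        refine le_trans (mnorm_mono measurableSet_Ioo fun u hu => ?_)
          (mnorm_mono_set (Ioo_subset_Ioo_left hs.1.le) _)
        have hu0 := hs.1.trans hu.1
        rw [ENNReal.ofReal_mul (hw u hu0).le, mul_left_comm]
        gcongr
        exact hk u ⟨hu0, hu.2⟩
    _ = M * mnorm q (Ioo 0 t) (fun u => ENNReal.ofReal (w u * φ u)) := mnorm_const_mul hq _ hM _
    _ ≤ M * ((1 + C : ℝ≥0) * ENNReal.ofReal (w t * φ t)) := by
        gcongr
        refine (hC t ht).trans ?_
        gcongr
        exact le_add_self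
    _ = _ := by ring

/-- Since k(u) ≥ (u/t) k(t) for u ≤ t, the factor u⁻¹ cancels and `primitiveMin` is what remains. -/
theorem le_funL {r q : ℝ≥0∞} {a b : ℝ → ℝ} (h : AdmissibleL r b q a) {k : ℝ → ℝ≥0∞}
    (hk : QuasiConc k) {t : ℝ} (ht : 0 < t) :
    ENNReal.ofReal t⁻¹ * k t * primitiveSum r b q a t ≤
      2 * funL r b q (fun u => u ^ (-1 : ℝ) * a u) k := by
  refine (mul_le_mul' le_rfl (primitiveSum_le h.hr a b ht)).trans ?_
  rw [mul_left_comm]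
  refine mul_le_mul' le_rfl ((const_mul_mnorm_le h.hr _ _ _).trans ?_)
  refine mnorm_mono measurableSet_Ioi fun s hs => ?_
  rw [mul_left_comm]
  refine mul_le_mul' le_rfl ((const_mul_mnorm_le h.hq _ _ _).trans ?_)
  refine le_trans (mnorm_mono measurableSet_Ioo fun u hu => ?_)
    (mnorm_mono_set (Ioo_subset_Ioo_right (min_le_left _ _)) _)
  have hu0 : 0 < u := hu.1
  have hut : u ≤ t := hu.2.le.trans (min_le_right _ _)
  calc ENNReal.ofReal t⁻¹ * k t * ENNReal.ofReal (a u)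
      ≤ ENNReal.ofReal t⁻¹ * (ENNReal.ofReal (t / u) * k u) * ENNReal.ofReal (a u) := by
        gcongr
        exact (hk u t hu0 hut).2
    _ = ENNReal.ofReal (t⁻¹ * (t / u)) * ENNReal.ofReal (a u) * k u := by
        rw [ENNReal.ofReal_mul (by positivity)]
        ring
    _ = _ := by
        rw [← ENNReal.ofReal_mul (by positivity)]
        simp only [Real.rpow_neg_one]
        congr 3
        field_simp

/-- This profile stands for the part f₁. On (0, t] it is linear and cancels u⁻¹; its contributions
to s < t and s > t are the two terms of `primitiveSum`. -/
theorem funL_max_le {r q : ℝ≥0∞} {a b : ℝ → ℝ} (h : AdmissibleL r b q a) : ∃ C : ℝ≥0,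
    ∀ k : ℝ → ℝ≥0∞, ∀ t : ℝ, 0 < t → k t ≠ ∞ →
      funL r b q (fun u => u ^ (-1 : ℝ) * a u)
        (fun u => if u ≤ t then ENNReal.ofReal (u / t) * k t else k u) ≤
      C * (locL r b q (fun u => u ^ (-1 : ℝ) * a u) k t +
        ENNReal.ofReal t⁻¹ * k t * primitiveSum r b q a t) := by
  obtain ⟨U, hU1, hU⟩ := mnorm_union h.hr
  obtain ⟨V, hV1, hV⟩ := mnorm_union h.hq
  obtain ⟨A, -, hA⟩ := mnorm_weight_add h.hr h.hb
  refine ⟨U * (1 + V * A), fun k t ht hkt => ?_⟩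
  set w : ℝ → ℝ := fun u => u ^ (-1 : ℝ) * a u with hw
  set k' : ℝ → ℝ≥0∞ := fun u => if u ≤ t then ENNReal.ofReal (u / t) * k t else k u with hk'
  set c := ENNReal.ofReal t⁻¹ * k t with hc
  have hct : c ≠ ∞ := by finiteness
  have hwk : ∀ u : ℝ, 0 < u → u ≤ t →
      ENNReal.ofReal (w u) * k' u = c * ENNReal.ofReal (a u) := by
    intro u hu hut
    have hau := h.ha.pos u hu
    simp only [hk', hw, hc, if_pos hut]
    rw [← mul_assoc, ← ENNReal.ofReal_mul (by positivity), mul_right_comm (_ ^ (-1 : ℝ)),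
      mul_right_comm (ENNReal.ofReal t⁻¹), ← ENNReal.ofReal_mul (by positivity), Real.rpow_neg_one]
    congr 2
    field_simp
  have hin : ∀ s : ℝ, s ≤ t → mnorm q (Ioo 0 s) (fun u => ENNReal.ofReal (w u) * k' u) =
      c * mnorm q (Ioo 0 s) fun u => ENNReal.ofReal (a u) := by
    intro s hs
    rw [← mnorm_const_mul h.hq _ hct]
    exact mnorm_congr measurableSet_Ioo fun u hu => hwk u hu.1 (hu.2.le.trans hs)
  have hset : Ioi (0 : ℝ) ⊆ Ioo 0 t ∪ Ici t := fun u hu => by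
    rcases lt_or_ge u t with h | h
    · exact Or.inl ⟨hu, h⟩
    · exact Or.inr h
  have hlow : mnorm r (Ioo 0 t) (fun s => ENNReal.ofReal (b s) *
      mnorm q (Ioo 0 s) fun u => ENNReal.ofReal (w u) * k' u) ≤ c * primitiveSum r b q a t := by
    refine le_trans (le_of_eq ?_) (mul_le_mul' le_rfl le_self_add)
    rw [← mnorm_const_mul h.hr _ hct]
    refine mnorm_congr measurableSet_Ioo fun s hs => ?_
    rw [hin s hs.2.le, mul_left_comm]
  have hhigh : mnorm r (Ici t) (fun s => ENNReal.ofReal (b s) *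
      mnorm q (Ioo 0 s) fun u => ENNReal.ofReal (w u) * k' u) ≤
      V * A * (locL r b q w k t + c * primitiveSum r b q a t) := by
    rw [mnorm_congr_set Ioi_ae_eq_Ici.symm]
    have hin' : ∀ s ∈ Ioi t, mnorm q (Ioo 0 s) (fun u => ENNReal.ofReal (w u) * k' u) ≤
        V * (c * mnorm q (Ioo 0 t) (fun u => ENNReal.ofReal (a u)) +
          mnorm q (Ioo t s) fun u => ENNReal.ofReal (w u) * k u) := by
      intro s hs
      have hset' : Ioo 0 s ⊆ Ioc 0 t ∪ Ioo t s := fun u hu => by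
        rcases le_or_gt u t with h | h
        · exact Or.inl ⟨hu.1, h⟩
        · exact Or.inr ⟨h, hu.2⟩
      refine ((mnorm_mono_set hset' _).trans (hV _ _ _)).trans ?_
      refine mul_le_mul' le_rfl (add_le_add (le_of_eq ?_)
        (mnorm_mono measurableSet_Ioo fun u hu => ?_))
      · rw [mnorm_congr_set Ioo_ae_eq_Ioc.symm, hin t le_rfl]
      · simp only [hk', if_neg (not_le.2 hu.1)]
        exact le_rfl
    have hAt := h.prim_ne_top ht
    calc mnorm r (Ioi t) (fun s => ENNReal.ofReal (b s) *
          mnorm q (Ioo 0 s) fun u => ENNReal.ofReal (w u) * k' u)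
        ≤ mnorm r (Ioi t) (fun s => V * (ENNReal.ofReal (b s) *
            (c * mnorm q (Ioo 0 t) (fun u => ENNReal.ofReal (a u)) +
            mnorm q (Ioo t s) fun u => ENNReal.ofReal (w u) * k u))) := by
          refine mnorm_mono measurableSet_Ioi fun s hs => ?_
          rw [mul_left_comm]
          exact mul_le_mul' le_rfl (hin' s hs)
      _ = V * mnorm r (Ioi t) (fun s => ENNReal.ofReal (b s) *
            (c * mnorm q (Ioo 0 t) (fun u => ENNReal.ofReal (a u)) +
            mnorm q (Ioo t s) fun u => ENNReal.ofReal (w u) * k u)) :=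
          mnorm_const_mul h.hr _ ENNReal.coe_ne_top _
      _ ≤ V * (A * (mnorm r (Ioi t) (fun s => ENNReal.ofReal (b s) *
            (c * mnorm q (Ioo 0 t) (fun u => ENNReal.ofReal (a u)))) + locL r b q w k t)) :=
          mul_le_mul' le_rfl
            (hA _ measurableSet_Ioi (Ioi_subset_Ioi ht.le) _ _ measurable_const)
      _ ≤ V * (A * (c * primitiveSum r b q a t + locL r b q w k t)) := by
          refine mul_le_mul' le_rfl (mul_le_mul' le_rfl (add_le_add ?_ le_rfl))
          refine le_trans (le_of_eq ?_) (mul_le_mul' le_rfl le_add_self)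
          rw [mul_comm (mnorm r _ _), ← mul_assoc, ← mnorm_const_mul h.hr _ (by finiteness)]
          exact mnorm_congr measurableSet_Ioi fun s _ => mul_comm _ _
      _ = _ := by ring
  refine ((mnorm_mono_set hset _).trans (hU _ _ _)).trans ?_
  calc _ ≤ U * (c * primitiveSum r b q a t +
        V * A * (locL r b q w k t + c * primitiveSum r b q a t)) :=
        mul_le_mul' le_rfl (add_le_add hlow hhigh)
    _ ≤ U * ((locL r b q w k t + c * primitiveSum r b q a t) +
        V * A * (locL r b q w k t + c * primitiveSum r b q a t)) := by
        gcongr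
        exact le_add_self
    _ = _ := by
        push_cast
        ring

/-- Negative index bounds the inner norm by M t⁻¹ a(t) φ(t) for all s. As a(t) is dominated by the
norm of a over (0, t), the tail of b completes the second term of `primitiveSum`. -/
theorem locL_le {r q : ℝ≥0∞} {a b : ℝ → ℝ} (h : AdmissibleL r b q a) {β : ℝ} (hβ : β < 0)
    {φ : ℝ → ℝ} (hφ0 : ∀ u : ℝ, 0 < u → 0 < φ u)
    (hφ : RegVary β fun u => u ^ (-1 : ℝ) * a u * φ u) : ∃ C : ℝ≥0, 1 ≤ C ∧
      ∀ (k : ℝ → ℝ≥0∞) (M : ℝ≥0∞), M ≠ ∞ → ∀ t : ℝ, 0 < t →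
      (∀ u ∈ Ioi t, k u ≤ M * ENNReal.ofReal (φ u)) →
      locL r b q (fun u => u ^ (-1 : ℝ) * a u) k t ≤
        C * M * ENNReal.ofReal (t⁻¹ * φ t) * primitiveSum r b q a t := by
  obtain ⟨C, hC⟩ := hφ.mnorm_Ioi_le h.hq hβ
  obtain ⟨D, hD⟩ := h.ha.le_mnorm_Ioo h.hq
  refine ⟨1 + C * D, le_self_add, fun k M hM t ht hk => ?_⟩
  have hφt := hφ0 t ht
  set T := mnorm r (Ioi t) (fun s => ENNReal.ofReal (b s))
  have hin : ∀ s ∈ Ioi t, mnorm q (Ioo t s)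
      (fun u => ENNReal.ofReal (u ^ (-1 : ℝ) * a u) * k u) ≤
        M * (C * ENNReal.ofReal (t ^ (-1 : ℝ) * a t * φ t)) := by
    intro s hs
    calc mnorm q (Ioo t s) (fun u => ENNReal.ofReal (u ^ (-1 : ℝ) * a u) * k u)
        ≤ mnorm q (Ioi t) (fun u => M * ENNReal.ofReal (u ^ (-1 : ℝ) * a u * φ u)) := by
          refine le_trans (mnorm_mono measurableSet_Ioo fun u hu => ?_)
            (mnorm_mono_set Ioo_subset_Ioi_self _)
          have hu0 : 0 < u := ht.trans hu.1
          have hau := h.ha.pos u hu0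
          rw [ENNReal.ofReal_mul (p := u ^ (-1 : ℝ) * a u) (by positivity), mul_left_comm]
          exact mul_le_mul' le_rfl (hk u hu.1)
      _ = M * mnorm q (Ioi t) (fun u => ENNReal.ofReal (u ^ (-1 : ℝ) * a u * φ u)) :=
          mnorm_const_mul h.hq _ hM _
      _ ≤ _ := mul_le_mul' le_rfl (hC t ht)
  calc locL r b q (fun u => u ^ (-1 : ℝ) * a u) k t
      ≤ mnorm r (Ioi t) (fun s => M * (C * ENNReal.ofReal (t ^ (-1 : ℝ) * a t * φ t)) *
          ENNReal.ofReal (b s)) := by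
        refine mnorm_mono measurableSet_Ioi fun s hs => ?_
        rw [mul_comm]
        exact mul_le_mul' (hin s hs) le_rfl
    _ = M * (C * ENNReal.ofReal (t ^ (-1 : ℝ) * a t * φ t)) * T :=
        mnorm_const_mul h.hr _ (by finiteness) _
    _ = C * M * ENNReal.ofReal (t⁻¹ * φ t) * (ENNReal.ofReal (a t) * T) := by
        rw [show t ^ (-1 : ℝ) * a t * φ t = t⁻¹ * φ t * a t by rw [Real.rpow_neg_one]; ring,
          ENNReal.ofReal_mul (by positivity)]
        ring
    _ ≤ C * M * ENNReal.ofReal (t⁻¹ * φ t) * (D * primitiveSum r b q a t) := by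
        refine mul_le_mul' le_rfl ?_
        calc ENNReal.ofReal (a t) * T
            ≤ D * mnorm q (Ioo 0 t) (fun u => ENNReal.ofReal (a u)) * T :=
              mul_le_mul' (hD t ht) le_rfl
          _ = D * (T * mnorm q (Ioo 0 t) (fun u => ENNReal.ofReal (a u))) := by ring
          _ ≤ _ := mul_le_mul' le_rfl le_add_self
    _ = (C * D) * M * ENNReal.ofReal (t⁻¹ * φ t) * primitiveSum r b q a t := by ring
    _ ≤ _ := by
        gcongr
        push_cast
        exact le_add_self

/-! ### The K-functional of a quasi-Banach couple. -/

section PeetreK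

variable {E : Type*} [AddCommGroup E]

theorem peetreK_le (N₀ N₁ : E → ℝ≥0∞) (t : ℝ) (f₀ f₁ : E) :
    peetreK N₀ N₁ t (f₀ + f₁) ≤ N₀ f₀ + ENNReal.ofReal t * N₁ f₁ :=
  iInf_le_of_le f₀ (iInf_le_of_le f₁ (iInf_le _ rfl))

theorem le_mul_peetreK {N₀ N₁ : E → ℝ≥0∞} {t : ℝ} {f : E} {x : ℝ≥0∞} {C : ℝ≥0} (hC : 1 ≤ C)
    (h : ∀ f₀ f₁ : E, f = f₀ + f₁ → x ≤ C * (N₀ f₀ + ENNReal.ofReal t * N₁ f₁)) :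
    x ≤ C * peetreK N₀ N₁ t f := by
  have hC0 : (C : ℝ≥0∞) ≠ 0 := by
    rw [ENNReal.coe_ne_zero]
    positivity
  have key : ∀ y : ℝ≥0∞, x ≤ C * y ↔ x / C ≤ y := fun y =>
    (ENNReal.div_le_iff' hC0 ENNReal.coe_ne_top).symm
  rw [key]
  exact le_iInf fun f₀ => le_iInf fun f₁ => le_iInf fun hf => (key _).1 (h f₀ f₁ hf)

theorem exists_of_peetreK_lt {N₀ N₁ : E → ℝ≥0∞} {t : ℝ} {f : E} {x : ℝ≥0∞}
    (h : peetreK N₀ N₁ t f < x) : ∃ f₀ f₁ : E, f = f₀ + f₁ ∧ N₀ f₀ + ENNReal.ofReal t * N₁ f₁ < x := by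
  simpa only [peetreK, iInf_lt_iff, exists_prop] using h

theorem peetreK_mono (N₀ N₁ : E → ℝ≥0∞) (f : E) : Monotone fun t => peetreK N₀ N₁ t f := by
  intro s t hst
  refine iInf_mono fun f₀ => iInf_mono fun f₁ => iInf_mono fun _ => ?_
  gcongr

theorem peetreK_quasiConc (N₀ N₁ : E → ℝ≥0∞) (f : E) : QuasiConc fun t => peetreK N₀ N₁ t f := by
  refine fun s t hs hst => ⟨peetreK_mono N₀ N₁ f hst, ?_⟩
  have hq : 1 ≤ t / s := (one_le_div hs).2 hst
  refine le_mul_peetreK (C := (t / s).toNNReal) (by simpa using hq) fun f₀ f₁ hf => ?_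
  rw [hf, mul_add]
  refine (peetreK_le _ _ _ _ _).trans (add_le_add ?_ ?_)
  · refine le_mul_of_one_le_left zero_le ?_
    simpa using hq
  · rw [← mul_assoc]
    gcongr
    change _ ≤ ENNReal.ofReal (t / s) * _
    rw [← ENNReal.ofReal_mul (by positivity), div_mul_cancel₀ _ hs.ne']

variable {𝕜 : Type*} [RCLike 𝕜] [Module 𝕜 E] [TopologicalSpace E]

theorem QuasiBanachIn.qnorm_zero (A : QuasiBanachIn 𝕜 E) : A.qnorm 0 = 0 := by
  simpa using A.qnorm_smul 0 0

theorem QuasiBanachIn.qnorm_neg (A : QuasiBanachIn 𝕜 E) (x : E) : A.qnorm (-x) = A.qnorm x := by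
  simpa using A.qnorm_smul (-1) x

theorem peetreK_zero (A₀ A₁ : QuasiBanachIn 𝕜 E) (t : ℝ) : peetreK A₀.qnorm A₁.qnorm t 0 = 0 := by
  have := peetreK_le A₀.qnorm A₁.qnorm t 0 0
  simpa [A₀.qnorm_zero, A₁.qnorm_zero] using this

theorem peetreK_neg_le_left (A₀ A₁ : QuasiBanachIn 𝕜 E) (t : ℝ) (f : E) :
    peetreK A₀.qnorm A₁.qnorm t (-f) ≤ A₀.qnorm f := by
  have := peetreK_le A₀.qnorm A₁.qnorm t (-f) 0
  simpa [A₁.qnorm_zero, A₀.qnorm_neg] using this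

theorem peetreK_neg_le_right (A₀ A₁ : QuasiBanachIn 𝕜 E) (t : ℝ) (f : E) :
    peetreK A₀.qnorm A₁.qnorm t (-f) ≤ ENNReal.ofReal t * A₁.qnorm f := by
  have := peetreK_le A₀.qnorm A₁.qnorm t 0 (-f)
  simpa [A₀.qnorm_zero, A₁.qnorm_neg] using this

theorem peetreK_add_le (A₀ A₁ : QuasiBanachIn 𝕜 E) : ∃ C : ℝ≥0, 1 ≤ C ∧ ∀ (t : ℝ) (f g : E),
    peetreK A₀.qnorm A₁.qnorm t (f + g) ≤
      C * (peetreK A₀.qnorm A₁.qnorm t f + peetreK A₀.qnorm A₁.qnorm t g) := by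
  obtain ⟨C₀, h₀⟩ := A₀.quasi_triangle
  obtain ⟨C₁, h₁⟩ := A₁.quasi_triangle
  set C : ℝ≥0 := 1 + C₀ + C₁ with hC
  have hC0 : (C₀ : ℝ≥0∞) ≤ C := by
    rw [ENNReal.coe_le_coe, hC, add_right_comm]
    exact le_add_self
  have hC1 : (C₁ : ℝ≥0∞) ≤ C := by
    rw [ENNReal.coe_le_coe, hC]
    exact le_add_self
  refine ⟨C, by rw [hC, add_assoc]; exact le_self_add, fun t f g => ?_⟩
  refine le_of_forall_gt fun x hx => ?_
  have hfin : peetreK A₀.qnorm A₁.qnorm t f + peetreK A₀.qnorm A₁.qnorm t g < x / C := by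
    rw [ENNReal.lt_div_iff_mul_lt (Or.inl ?_) (Or.inl ENNReal.coe_ne_top), mul_comm]
    · exact hx
    · rw [ENNReal.coe_ne_zero, hC]
      positivity
  obtain ⟨y, z, hy, hz, hyz⟩ : ∃ y z, peetreK A₀.qnorm A₁.qnorm t f < y ∧
      peetreK A₀.qnorm A₁.qnorm t g < z ∧ y + z < x / C := by
    obtain ⟨ε, hε, hεx⟩ := ENNReal.lt_iff_exists_add_pos_lt.1 hfin
    have hf : peetreK A₀.qnorm A₁.qnorm t f ≠ ∞ := fun h => by simp [h] at hfin
    have hg : peetreK A₀.qnorm A₁.qnorm t g ≠ ∞ := fun h => by simp [h] at hfin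
    have hε2 : ((ε / 2 : ℝ≥0) : ℝ≥0∞) ≠ 0 := by
      rw [ENNReal.coe_ne_zero]
      positivity
    refine ⟨_, _, ENNReal.lt_add_right hf hε2, ENNReal.lt_add_right hg hε2, ?_⟩
    refine lt_of_le_of_lt (le_of_eq ?_) hεx
    rw [add_add_add_comm, ← ENNReal.coe_add, add_halves]
  obtain ⟨f₀, f₁, rfl, hf⟩ := exists_of_peetreK_lt hy
  obtain ⟨g₀, g₁, rfl, hg⟩ := exists_of_peetreK_lt hz
  rw [add_add_add_comm]
  calc peetreK A₀.qnorm A₁.qnorm t (f₀ + g₀ + (f₁ + g₁))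
      ≤ A₀.qnorm (f₀ + g₀) + ENNReal.ofReal t * A₁.qnorm (f₁ + g₁) := peetreK_le _ _ _ _ _
    _ ≤ C * (A₀.qnorm f₀ + A₀.qnorm g₀) +
          ENNReal.ofReal t * (C * (A₁.qnorm f₁ + A₁.qnorm g₁)) := by
        gcongr
        · exact (h₀ _ _).trans (mul_le_mul' hC0 le_rfl)
        · exact (h₁ _ _).trans (mul_le_mul' hC1 le_rfl)
    _ = C * ((A₀.qnorm f₀ + ENNReal.ofReal t * A₁.qnorm f₁) +
          (A₀.qnorm g₀ + ENNReal.ofReal t * A₁.qnorm g₁)) := by ring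
    _ ≤ C * (y + z) := by gcongr
    _ < x := by
        rw [mul_comm]
        exact ENNReal.mul_lt_of_lt_div hyz

/-- There are decompositions with both parts arbitrarily small; continuity of the inclusions puts
their sum into any neighbourhood of 0, and the topology is Hausdorff. -/
theorem eq_zero_of_peetreK_eq_zero [IsTopologicalAddGroup E] [T2Space E]
    (A₀ A₁ : QuasiBanachIn 𝕜 E) {t : ℝ} (ht : 0 < t) {f : E}
    (h : peetreK A₀.qnorm A₁.qnorm t f = 0) : f = 0 := by
  by_contra hf
  have hU : ({f}ᶜ : Set E) ∈ 𝓝 (0 : E) := isOpen_compl_singleton.mem_nhds (Ne.symm hf)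
  have hadd : Tendsto (fun p : E × E => p.1 + p.2) (𝓝 (0, 0)) (𝓝 0) := by
    simpa using (continuous_add (M := E)).tendsto (0, 0)
  obtain ⟨V, hV, V', hV', hVV⟩ := mem_nhds_prod_iff.1 (hadd hU)
  obtain ⟨δ, hδ, hδV⟩ := A₀.continuous_incl V hV
  obtain ⟨δ', hδ', hδV'⟩ := A₁.continuous_incl V' hV'
  have ht' : ENNReal.ofReal t ≠ 0 := by simpa using ht
  have hlt : peetreK A₀.qnorm A₁.qnorm t f < min δ (ENNReal.ofReal t * δ') := by
    rw [h]
    exact lt_min hδ (ENNReal.mul_pos ht' hδ'.ne')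
  obtain ⟨f₀, f₁, hff, hlt⟩ := exists_of_peetreK_lt hlt
  have h0 : f₀ ∈ V := hδV _ (lt_of_le_of_lt le_self_add (hlt.trans_le (min_le_left _ _)))
  have h1 : f₁ ∈ V' := hδV' _ (by
    have h2 : ENNReal.ofReal t * A₁.qnorm f₁ < ENNReal.ofReal t * δ' :=
      lt_of_le_of_lt le_add_self (hlt.trans_le (min_le_right _ _))
    exact lt_of_mul_lt_mul_left' h2)
  have := hVV (Set.mk_mem_prod h0 h1)
  simp [hff] at this

/-- A near-optimal decomposition at `t` controls the `K`-functionals of both parts. -/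
theorem exists_decomposition (A₀ A₁ : QuasiBanachIn 𝕜 E) : ∃ C : ℝ≥0, ∀ (f : E) (t : ℝ), 0 < t →
    peetreK A₀.qnorm A₁.qnorm t f ≠ 0 → peetreK A₀.qnorm A₁.qnorm t f ≠ ∞ →
    ∃ f₀ f₁ : E, f = f₀ + f₁ ∧
      (∀ u : ℝ, 0 < u → peetreK A₀.qnorm A₁.qnorm u f₀ ≤
        C * peetreK A₀.qnorm A₁.qnorm (min u t) f) ∧
      ∀ u : ℝ, 0 < u → peetreK A₀.qnorm A₁.qnorm u f₁ ≤
        C * if u ≤ t then ENNReal.ofReal (u / t) * peetreK A₀.qnorm A₁.qnorm t f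
          else peetreK A₀.qnorm A₁.qnorm u f := by
  obtain ⟨C, hC1, hC⟩ := peetreK_add_le A₀ A₁
  refine ⟨C * 3, fun f t ht h0 htop => ?_⟩
  set k : ℝ → ℝ≥0∞ := fun u => peetreK A₀.qnorm A₁.qnorm u f with hk
  have hqc : QuasiConc k := peetreK_quasiConc _ _ f
  -- A factor 2 leaves room above the infimum because 0 < k(t) < ∞.
  have hlt : k t < 2 * k t := by
    rw [two_mul]
    exact ENNReal.lt_add_right htop h0
  obtain ⟨f₀, f₁, hf, hdec⟩ := exists_of_peetreK_lt hlt
  have h2 : A₀.qnorm f₀ ≤ 2 * k t := le_self_add.trans hdec.le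
  have h3 : ENNReal.ofReal t * A₁.qnorm f₁ ≤ 2 * k t := le_add_self.trans hdec.le
  have h4 : ∀ u : ℝ, 0 < u → ENNReal.ofReal u * A₁.qnorm f₁ ≤
      2 * (ENNReal.ofReal (u / t) * k t) := by
    intro u hu
    calc ENNReal.ofReal u * A₁.qnorm f₁
        = ENNReal.ofReal (u / t) * (ENNReal.ofReal t * A₁.qnorm f₁) := by
          rw [← mul_assoc, ← ENNReal.ofReal_mul (by positivity), div_mul_cancel₀ _ ht.ne']
      _ ≤ ENNReal.ofReal (u / t) * (2 * k t) := by gcongr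
      _ = _ := by ring
  have hC1' : (1 : ℝ≥0∞) ≤ C := by exact_mod_cast hC1
  have h23 : ∀ x : ℝ≥0∞, 2 * x ≤ (C * 3 : ℝ≥0) * x := fun x => by
    push_cast
    gcongr
    calc (2 : ℝ≥0∞) ≤ 1 * 3 := by norm_num
      _ ≤ C * 3 := by gcongr
  -- In f₀ = f - f₁ for u ≤ t, and in f₁ = f - f₀ for u > t, `f` contributes k(u) and the subtracted
  -- part at most 2 k(u).
  have h31 : ∀ x : ℝ≥0∞, C * (x + 2 * x) = (C * 3 : ℝ≥0) * x := fun x => by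
    push_cast
    ring
  refine ⟨f₀, f₁, hf, fun u hu => ?_, fun u hu => ?_⟩
  · rcases le_total u t with hut | hut
    · rw [min_eq_left hut, show f₀ = f + -f₁ by rw [hf, add_neg_cancel_right], ← h31]
      refine (hC u _ _).trans ?_
      gcongr
      refine (peetreK_neg_le_right A₀ A₁ u f₁).trans ((h4 u hu).trans ?_)
      gcongr
      calc ENNReal.ofReal (u / t) * k t ≤ ENNReal.ofReal (u / t) * (ENNReal.ofReal (t / u) * k u) := by
            gcongr
            exact (hqc u t hu hut).2
        _ = k u := by
            rw [← mul_assoc, ← ENNReal.ofReal_mul (by positivity), div_mul_div_cancel₀ ht.ne',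
              div_self hu.ne', ENNReal.ofReal_one, one_mul]
    · rw [min_eq_right hut]
      have := peetreK_neg_le_left A₀ A₁ u (-f₀)
      rw [neg_neg, A₀.qnorm_neg] at this
      exact this.trans (h2.trans (h23 _))
  · split_ifs with hut
    · have := peetreK_neg_le_right A₀ A₁ u (-f₁)
      rw [neg_neg, A₁.qnorm_neg] at this
      exact this.trans ((h4 u hu).trans (h23 _))
    · have hut' : t ≤ u := (not_le.1 hut).le
      rw [show f₁ = f + -f₀ by rw [hf]; abel, ← h31]
      refine (hC u _ _).trans ?_
      gcongr
      refine (peetreK_neg_le_left A₀ A₁ u f₀).trans (h2.trans ?_)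
      gcongr
      exact (hqc t u ht hut').1

end PeetreK

/-! ### The couple (𝓡, 𝓛) and its Holmstedt formula. -/

theorem ofReal_mul_inv_cancel {x : ℝ} (hx : 0 < x) :
    ENNReal.ofReal x * ENNReal.ofReal x⁻¹ = 1 := by
  rw [← ENNReal.ofReal_mul hx.le, mul_inv_cancel₀ hx.ne', ENNReal.ofReal_one]

theorem le_mul_ofReal_inv {x : ℝ} (hx : 0 < x) {k y : ℝ≥0∞} (h : ENNReal.ofReal x * k ≤ y) :
    k ≤ y * ENNReal.ofReal x⁻¹ := by
  calc k = ENNReal.ofReal x * k * ENNReal.ofReal x⁻¹ := by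
        rw [mul_right_comm, ofReal_mul_inv_cancel hx, one_mul]
    _ ≤ _ := by gcongr

/-- The parameters of the couple `(𝓡, 𝓛)` together with the assumptions on them. -/
structure Params where
  /-- The index of the space `𝓡`. -/
  θ₀ : ℝ
  /-- The outer exponent of the space `𝓡`. -/
  r₀ : ℝ≥0∞
  /-- The inner exponent of the space `𝓡`. -/
  q₀ : ℝ≥0∞
  /-- The outer exponent of the space `𝓛`. -/
  r₁ : ℝ≥0∞
  /-- The inner exponent of the space `𝓛`. -/
  q₁ : ℝ≥0∞
  /-- The inner weight of the space `𝓡`. -/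
  a₀ : ℝ → ℝ
  /-- The outer weight of the space `𝓡`. -/
  b₀ : ℝ → ℝ
  /-- The inner weight of the space `𝓛`. -/
  a₁ : ℝ → ℝ
  /-- The outer weight of the space `𝓛`. -/
  b₁ : ℝ → ℝ
  hθ₀ : 0 < θ₀
  hθ₀' : θ₀ < 1
  hr₀ : r₀ ≠ 0
  hq₀ : q₀ ≠ 0
  ha₀ : RegVary 0 a₀
  hb₀ : RegVary 0 b₀
  fin₀ : mnorm r₀ (Ioo 0 1) (fun u => ENNReal.ofReal (b₀ u)) ≠ ∞
  adm : AdmissibleL r₁ b₁ q₁ a₁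

namespace Params

variable (P : Params)

/-- The weight `u ^ (-θ₀) a₀(u)`. -/
noncomputable def w₀ (u : ℝ) : ℝ := u ^ (-P.θ₀) * P.a₀ u

/-- The primitive of `b₀`. -/
noncomputable def β (t : ℝ) : ℝ := (mnorm P.r₀ (Ioo 0 t) fun u => ENNReal.ofReal (P.b₀ u)).toReal

/-- The function `χ₁`. -/
noncomputable def χ₁ (t : ℝ) : ℝ := (primitiveSum P.r₁ P.b₁ P.q₁ P.a₁ t).toReal

/-- The function `ρ`. -/
noncomputable def ρ (t : ℝ) : ℝ := t ^ (1 - P.θ₀) * (P.a₀ t * P.β t / P.χ₁ t)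

theorem ofReal_β {t : ℝ} (ht : 0 < t) :
    ENNReal.ofReal (P.β t) = mnorm P.r₀ (Ioo 0 t) fun u => ENNReal.ofReal (P.b₀ u) :=
  ENNReal.ofReal_toReal (P.hb₀.mnorm_Ioo_ne_top P.hr₀ one_pos P.fin₀ ht)

theorem ofReal_χ₁ {t : ℝ} (ht : 0 < t) :
    ENNReal.ofReal (P.χ₁ t) = primitiveSum P.r₁ P.b₁ P.q₁ P.a₁ t :=
  ENNReal.ofReal_toReal (P.adm.sum_ne_top ht)

theorem regVary_w₀ : RegVary (-P.θ₀) P.w₀ :=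
  ((RegVary.rpow_id (-P.θ₀)).mul P.ha₀).congr (add_zero _) fun _ _ => rfl

theorem regVary_β : RegVary 0 P.β := P.hb₀.mnorm_Ioo_toReal P.hr₀ P.fin₀

theorem regVary_χ₁ : RegVary 0 P.χ₁ := P.adm.regVary

theorem regVary_ρ : RegVary (1 - P.θ₀) P.ρ :=
  ((RegVary.rpow_id (1 - P.θ₀)).mul ((P.ha₀.mul P.regVary_β).mul P.regVary_χ₁.inv)).congr
    (by ring) fun t _ => by rw [ρ, div_eq_mul_inv]

theorem w₀_pos {t : ℝ} (ht : 0 < t) : 0 < P.w₀ t := P.regVary_w₀.pos t ht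

theorem β_pos {t : ℝ} (ht : 0 < t) : 0 < P.β t := P.regVary_β.pos t ht

theorem χ₁_pos {t : ℝ} (ht : 0 < t) : 0 < P.χ₁ t := P.regVary_χ₁.pos t ht

theorem ρ_pos {t : ℝ} (ht : 0 < t) : 0 < P.ρ t := P.regVary_ρ.pos t ht

/-- The identity for which ρ is designed: the middle terms coming from 𝓡 and from 𝓛 coincide. -/
theorem ρ_mul {t : ℝ} (ht : 0 < t) : P.ρ t * t⁻¹ * P.χ₁ t = P.w₀ t * P.β t := by
  have := P.χ₁_pos ht
  rw [ρ, w₀, show 1 - P.θ₀ = -P.θ₀ + 1 by ring, Real.rpow_add_one ht.ne']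
  field_simp

/-- The functional of the space `𝓡`. -/
noncomputable def X₀ (k : ℝ → ℝ≥0∞) : ℝ≥0∞ := funR P.r₀ P.b₀ P.q₀ P.w₀ k

/-- The functional of the space `𝓛`. -/
noncomputable def X₁ (k : ℝ → ℝ≥0∞) : ℝ≥0∞ :=
  funL P.r₁ P.b₁ P.q₁ (fun u => u ^ (-1 : ℝ) * P.a₁ u) k

/-- The local functional belonging to `𝓡`. -/
noncomputable def I₀ (k : ℝ → ℝ≥0∞) (t : ℝ) : ℝ≥0∞ := locR P.r₀ P.b₀ P.q₀ P.w₀ k t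

/-- The local functional belonging to `𝓛`. -/
noncomputable def I₁ (k : ℝ → ℝ≥0∞) (t : ℝ) : ℝ≥0∞ :=
  locL P.r₁ P.b₁ P.q₁ (fun u => u ^ (-1 : ℝ) * P.a₁ u) k t

/-- The expression equivalent to the `K`-functional of `(𝓡, 𝓛)` at `ρ(t)`. -/
noncomputable def holmstedt (k : ℝ → ℝ≥0∞) (t : ℝ) : ℝ≥0∞ :=
  P.I₀ k t + ENNReal.ofReal (P.w₀ t * P.β t) * k t + ENNReal.ofReal (P.ρ t) * P.I₁ k t

theorem exists_le_X₀ : ∃ C : ℝ≥0, ∀ k : ℝ → ℝ≥0∞, QuasiConc k → ∀ t : ℝ, 0 < t →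
    ENNReal.ofReal (P.w₀ t * P.β t) * k t ≤ C * P.X₀ k := by
  obtain ⟨C, hC⟩ := le_funR P.hr₀ P.hq₀ P.b₀ P.regVary_w₀
  refine ⟨C, fun k hk t ht => ?_⟩
  rw [ENNReal.ofReal_mul (P.w₀_pos ht).le, P.ofReal_β ht, mul_right_comm]
  exact hC k hk t ht

theorem exists_le_I₀ : ∃ C : ℝ≥0, ∀ k : ℝ → ℝ≥0∞, QuasiConc k → ∀ t : ℝ, 0 < t →
    ENNReal.ofReal (P.w₀ t * P.β t) * k t ≤ C * P.I₀ k t := by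
  obtain ⟨C, hC⟩ := le_locR P.hr₀ P.hq₀ P.hb₀ P.regVary_w₀
  refine ⟨C, fun k hk t ht => ?_⟩
  rw [ENNReal.ofReal_mul (P.w₀_pos ht).le, P.ofReal_β ht, mul_right_comm]
  exact hC k hk t ht

theorem le_X₁ {k : ℝ → ℝ≥0∞} (hk : QuasiConc k) {t : ℝ} (ht : 0 < t) :
    ENNReal.ofReal (t⁻¹ * P.χ₁ t) * k t ≤ 2 * P.X₁ k := by
  rw [ENNReal.ofReal_mul (by positivity), P.ofReal_χ₁ ht, mul_right_comm]
  exact le_funL P.adm hk ht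

theorem I₀_le {β : ℝ} (hβ : 0 < β) {φ : ℝ → ℝ} (hφ0 : ∀ u : ℝ, 0 < u → 0 < φ u)
    (hφ : RegVary β fun u => P.w₀ u * φ u) : ∃ C : ℝ≥0, 1 ≤ C ∧
      ∀ (k : ℝ → ℝ≥0∞) (M : ℝ≥0∞), M ≠ ∞ → ∀ t : ℝ, 0 < t →
      (∀ u ∈ Ioo 0 t, k u ≤ M * ENNReal.ofReal (φ u)) →
      P.I₀ k t ≤ C * M * ENNReal.ofReal (P.w₀ t * P.β t * φ t) := by
  obtain ⟨C, hC1, hC⟩ := locR_le (b := P.b₀) P.hr₀ P.hq₀ hβ hφ P.regVary_w₀.pos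
  refine ⟨C, hC1, fun k M hM t ht hk => (hC k M hM t ht hk).trans_eq ?_⟩
  have := P.w₀_pos ht
  have := P.β_pos ht
  have := hφ0 t ht
  rw [mul_right_comm (P.w₀ t), ENNReal.ofReal_mul (p := P.w₀ t * φ t) (by positivity),
    P.ofReal_β ht, mul_assoc]

theorem I₁_le {β : ℝ} (hβ : β < 0) {φ : ℝ → ℝ} (hφ0 : ∀ u : ℝ, 0 < u → 0 < φ u)
    (hφ : RegVary β fun u => u ^ (-1 : ℝ) * P.a₁ u * φ u) : ∃ C : ℝ≥0, 1 ≤ C ∧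
      ∀ (k : ℝ → ℝ≥0∞) (M : ℝ≥0∞), M ≠ ∞ → ∀ t : ℝ, 0 < t →
      (∀ u ∈ Ioi t, k u ≤ M * ENNReal.ofReal (φ u)) →
      P.I₁ k t ≤ C * M * ENNReal.ofReal (t⁻¹ * φ t * P.χ₁ t) := by
  obtain ⟨C, hC1, hC⟩ := locL_le P.adm hβ hφ0 hφ
  refine ⟨C, hC1, fun k M hM t ht hk => (hC k M hM t ht hk).trans_eq ?_⟩
  have := hφ0 t ht
  rw [ENNReal.ofReal_mul (p := t⁻¹ * φ t) (by positivity), P.ofReal_χ₁ ht, mul_assoc]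

theorem exists_I₀_add (A : ℝ≥0) : ∃ C : ℝ≥0, ∀ (k f g : ℝ → ℝ≥0∞), Measurable f →
    (∀ u, k u ≤ A * (f u + g u)) → ∀ t : ℝ, P.I₀ k t ≤ C * (P.I₀ f t + P.I₀ g t) := by
  obtain ⟨C, hC⟩ := locR_add P.hr₀ P.hq₀ P.hb₀ P.regVary_w₀
  refine ⟨A * C, fun k f g hf hk t => ?_⟩
  refine (weight_mul_mnorm_le (g := fun u => f u + g u) P.hr₀ measurableSet_Ioo P.b₀
    (fun _ => measurableSet_Ioo) P.hq₀ P.w₀ (ENNReal.coe_ne_top (r := A))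
    fun s _ u _ => hk u).trans ?_
  rw [ENNReal.coe_mul, mul_assoc]
  exact mul_le_mul' le_rfl (hC f g t hf)

theorem exists_I₁_add (A : ℝ≥0) : ∃ C : ℝ≥0, ∀ (k f g : ℝ → ℝ≥0∞), Measurable f →
    (∀ u, k u ≤ A * (f u + g u)) → ∀ t : ℝ, 0 < t → P.I₁ k t ≤ C * (P.I₁ f t + P.I₁ g t) := by
  have hw : RegVary (-1 + 0) fun u => u ^ (-1 : ℝ) * P.a₁ u := (RegVary.rpow_id (-1)).mul P.adm.ha
  obtain ⟨C, hC⟩ := locL_add P.adm.hr P.adm.hq P.adm.hb hw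
  refine ⟨A * C, fun k f g hf hk t ht => ?_⟩
  refine (weight_mul_mnorm_le (g := fun u => f u + g u) P.adm.hr measurableSet_Ioi P.b₁
    (fun _ => measurableSet_Ioo) P.adm.hq (fun u => u ^ (-1 : ℝ) * P.a₁ u)
    (ENNReal.coe_ne_top (r := A)) fun s _ u _ => hk u).trans ?_
  rw [ENNReal.coe_mul, mul_assoc]
  exact mul_le_mul' le_rfl (hC f g t ht hf)

/-- Only I₁ is not immediate. The bound k ≲ X₀ / (w₀ β), put into I₁, meets a weight of index
-(1-θ₀) < 0, and `ρ_mul` cancels the remaining factors. -/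
theorem holmstedt_le_X₀ : ∃ C : ℝ≥0, ∀ k : ℝ → ℝ≥0∞, QuasiConc k → P.X₀ k ≠ ∞ → ∀ t : ℝ, 0 < t →
    P.holmstedt k t ≤ C * P.X₀ k := by
  obtain ⟨A, hA⟩ := P.exists_le_X₀
  have hv : RegVary (-P.θ₀) fun u => P.w₀ u * P.β u :=
    (P.regVary_w₀.mul P.regVary_β).congr (add_zero _) fun _ _ => rfl
  have hφ : RegVary (-(1 - P.θ₀)) fun u => u ^ (-1 : ℝ) * P.a₁ u * (P.w₀ u * P.β u)⁻¹ :=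
    (((RegVary.rpow_id (-1)).mul P.adm.ha).mul hv.inv).congr (by ring) fun _ _ => rfl
  obtain ⟨C, hC1, hC⟩ := P.I₁_le (by linarith [P.hθ₀']) (fun u hu => inv_pos.2 (hv.pos u hu)) hφ
  refine ⟨1 + A + C * A, fun k hk hX t ht => ?_⟩
  have hρ := P.ρ_pos ht
  have h3 : ENNReal.ofReal (P.ρ t) * P.I₁ k t ≤ C * A * P.X₀ k := by
    refine (mul_le_mul' le_rfl (hC k (A * P.X₀ k) (by finiteness) t ht fun u hu =>
      le_mul_ofReal_inv (hv.pos u (ht.trans hu)) (hA k hk u (ht.trans hu)))).trans_eq ?_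
    rw [mul_left_comm, ← ENNReal.ofReal_mul hρ.le]
    have h4 : P.ρ t * (t⁻¹ * (P.w₀ t * P.β t)⁻¹ * P.χ₁ t) = 1 := by
      rw [show P.ρ t * (t⁻¹ * (P.w₀ t * P.β t)⁻¹ * P.χ₁ t) =
        P.ρ t * t⁻¹ * P.χ₁ t * (P.w₀ t * P.β t)⁻¹ by ring, P.ρ_mul ht]
      exact mul_inv_cancel₀ (hv.pos t ht).ne'
    rw [h4, ENNReal.ofReal_one, mul_one, mul_assoc]
  calc P.holmstedt k t ≤ P.X₀ k + A * P.X₀ k + C * A * P.X₀ k :=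
        add_le_add (add_le_add (locR_le_funR _ _ _ _) (hA k hk t ht)) h3
    _ = _ := by
        push_cast
        ring

/-- The mirror image: k ≲ X₁ / (u⁻¹ χ₁), and the weight met in I₀ has index 1-θ₀ > 0. -/
theorem holmstedt_le_X₁ : ∃ C : ℝ≥0, ∀ k : ℝ → ℝ≥0∞, QuasiConc k → P.X₁ k ≠ ∞ → ∀ t : ℝ, 0 < t →
    P.holmstedt k t ≤ C * (ENNReal.ofReal (P.ρ t) * P.X₁ k) := by
  have hv : RegVary (-1) fun u => u⁻¹ * P.χ₁ u :=
    ((RegVary.rpow_id (-1)).mul P.regVary_χ₁).congr (add_zero _) fun u _ => by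
      rw [Real.rpow_neg_one]
  have hφ : RegVary (1 - P.θ₀) fun u => P.w₀ u * (u⁻¹ * P.χ₁ u)⁻¹ :=
    (P.regVary_w₀.mul hv.inv).congr (by ring) fun _ _ => rfl
  obtain ⟨C, hC1, hC⟩ := P.I₀_le (by linarith [P.hθ₀']) (fun u hu => inv_pos.2 (hv.pos u hu)) hφ
  refine ⟨C * 2 + 2 + 1, fun k hk hX t ht => ?_⟩
  have hρ := P.ρ_pos ht
  have hvt := hv.pos t ht
  have h4 : P.w₀ t * P.β t * (t⁻¹ * P.χ₁ t)⁻¹ = P.ρ t := by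
    rw [← P.ρ_mul ht, mul_assoc (P.ρ t), mul_assoc, mul_inv_cancel₀ hvt.ne', mul_one]
  have hb : ∀ u : ℝ, 0 < u → k u ≤ 2 * P.X₁ k * ENNReal.ofReal (u⁻¹ * P.χ₁ u)⁻¹ := fun u hu =>
    le_mul_ofReal_inv (hv.pos u hu) (P.le_X₁ hk hu)
  have h1 : P.I₀ k t ≤ C * 2 * (ENNReal.ofReal (P.ρ t) * P.X₁ k) := by
    refine (hC k (2 * P.X₁ k) (by finiteness) t ht fun u hu => hb u hu.1).trans_eq ?_
    rw [h4]
    ring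
  have h2 : ENNReal.ofReal (P.w₀ t * P.β t) * k t ≤ 2 * (ENNReal.ofReal (P.ρ t) * P.X₁ k) := by
    refine (mul_le_mul' le_rfl (hb t ht)).trans_eq ?_
    have := P.w₀_pos ht
    have := P.β_pos ht
    rw [mul_left_comm, ← ENNReal.ofReal_mul (by positivity), h4]
    ring
  calc P.holmstedt k t ≤ C * 2 * (ENNReal.ofReal (P.ρ t) * P.X₁ k) +
        2 * (ENNReal.ofReal (P.ρ t) * P.X₁ k) + ENNReal.ofReal (P.ρ t) * P.X₁ k :=
        add_le_add (add_le_add h1 h2) (mul_le_mul' le_rfl (locL_le_funL _ _ _ ht))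
    _ = _ := by
        push_cast
        ring

theorem exists_holmstedt_add (A : ℝ≥0) : ∃ C : ℝ≥0, ∀ (k f g : ℝ → ℝ≥0∞), Measurable f →
    (∀ u, k u ≤ A * (f u + g u)) → ∀ t : ℝ, 0 < t →
      P.holmstedt k t ≤ C * (P.holmstedt f t + P.holmstedt g t) := by
  obtain ⟨B, hB⟩ := P.exists_I₀_add A
  obtain ⟨C, hC⟩ := P.exists_I₁_add A
  refine ⟨A + B + C, fun k f g hf hk t ht => ?_⟩
  have hA' : (A : ℝ≥0∞) ≤ (A + B + C : ℝ≥0) := by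
    rw [ENNReal.coe_le_coe, add_assoc]
    exact le_self_add
  have hB' : (B : ℝ≥0∞) ≤ (A + B + C : ℝ≥0) := by
    rw [ENNReal.coe_le_coe, add_right_comm]
    exact le_add_self
  have hC' : (C : ℝ≥0∞) ≤ (A + B + C : ℝ≥0) := by
    rw [ENNReal.coe_le_coe]
    exact le_add_self
  calc P.holmstedt k t ≤ (A + B + C : ℝ≥0) * (P.I₀ f t + P.I₀ g t) +
        ENNReal.ofReal (P.w₀ t * P.β t) * ((A + B + C : ℝ≥0) * (f t + g t)) +
        ENNReal.ofReal (P.ρ t) * ((A + B + C : ℝ≥0) * (P.I₁ f t + P.I₁ g t)) := by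
        refine add_le_add (add_le_add ?_ (mul_le_mul' le_rfl ?_)) (mul_le_mul' le_rfl ?_)
        · exact (hB k f g hf hk t).trans (mul_le_mul' hB' le_rfl)
        · exact (hk t).trans (mul_le_mul' hA' le_rfl)
        · exact (hC k f g hf hk t ht).trans (mul_le_mul' hC' le_rfl)
    _ = _ := by
        simp only [holmstedt]
        ring

section Holmstedt

variable {𝕜 E : Type*} [RCLike 𝕜] [AddCommGroup E] [Module 𝕜 E] [TopologicalSpace E]
  (A₀ A₁ : QuasiBanachIn 𝕜 E)

/-- The `K`-functional of the couple `(𝓡, 𝓛)`. -/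
noncomputable def K (t : ℝ) (f : E) : ℝ≥0∞ :=
  peetreK (fun f => P.X₀ fun u => peetreK A₀.qnorm A₁.qnorm u f)
    (fun f => P.X₁ fun u => peetreK A₀.qnorm A₁.qnorm u f) t f

theorem holmstedt_le_K : ∃ C : ℝ≥0, 1 ≤ C ∧ ∀ (f : E) (t : ℝ), 0 < t →
    P.holmstedt (fun u => peetreK A₀.qnorm A₁.qnorm u f) t ≤ C * P.K A₀ A₁ (P.ρ t) f := by
  obtain ⟨A, hA1, hA⟩ := peetreK_add_le A₀ A₁
  obtain ⟨B, hB⟩ := P.exists_holmstedt_add A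
  obtain ⟨C, hC⟩ := P.holmstedt_le_X₀
  obtain ⟨D, hD⟩ := P.holmstedt_le_X₁
  have h1 : 1 ≤ 1 + B * (C + D) := le_self_add
  refine ⟨1 + B * (C + D), h1, fun f t ht => le_mul_peetreK h1 fun f₀ f₁ hf => ?_⟩
  have hρ := P.ρ_pos ht
  have hρ' : ENNReal.ofReal (P.ρ t) ≠ 0 := by simpa using hρ
  have hc0 : ((1 + B * (C + D) : ℝ≥0) : ℝ≥0∞) ≠ 0 := by
    rw [ENNReal.coe_ne_zero]
    positivity
  by_cases h0 : P.X₀ (fun u => peetreK A₀.qnorm A₁.qnorm u f₀) = ∞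
  · rw [h0, top_add, ENNReal.mul_top hc0]
    exact le_top
  by_cases h1 : P.X₁ (fun u => peetreK A₀.qnorm A₁.qnorm u f₁) = ∞
  · rw [h1, ENNReal.mul_top hρ', add_top, ENNReal.mul_top hc0]
    exact le_top
  set x := P.X₀ (fun u => peetreK A₀.qnorm A₁.qnorm u f₀)
  set y := ENNReal.ofReal (P.ρ t) * P.X₁ (fun u => peetreK A₀.qnorm A₁.qnorm u f₁)
  calc P.holmstedt (fun u => peetreK A₀.qnorm A₁.qnorm u f) t
      ≤ B * (P.holmstedt (fun u => peetreK A₀.qnorm A₁.qnorm u f₀) t +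
          P.holmstedt (fun u => peetreK A₀.qnorm A₁.qnorm u f₁) t) :=
        hB _ _ _ (peetreK_mono _ _ f₀).measurable (fun u => by rw [hf]; exact hA u f₀ f₁) t ht
    _ ≤ B * (C * x + D * y) :=
        mul_le_mul' le_rfl (add_le_add (hC _ (peetreK_quasiConc _ _ f₀) h0 t ht)
          (hD _ (peetreK_quasiConc _ _ f₁) h1 t ht))
    _ ≤ B * ((C + D) * x + (C + D) * y) := by
        gcongr
        · exact le_self_add
        · exact le_add_self
    _ = B * (C + D) * (x + y) := by ring
    _ ≤ _ := by
        push_cast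
        gcongr
        exact le_add_self

/-- The decomposition at t is fed into `funR_min_le` and `funL_max_le`. It is unavailable if k(t) =
∞, where the middle term is infinite, or if k(t) = 0, where f = 0. -/
theorem K_le_holmstedt [IsTopologicalAddGroup E] [T2Space E] : ∃ C : ℝ≥0, 1 ≤ C ∧
    ∀ (f : E) (t : ℝ), 0 < t →
      P.K A₀ A₁ (P.ρ t) f ≤ C * P.holmstedt (fun u => peetreK A₀.qnorm A₁.qnorm u f) t := by
  obtain ⟨A, hA⟩ := exists_decomposition A₀ A₁
  obtain ⟨B, hB⟩ := funR_min_le P.hr₀ P.hq₀ (neg_lt_zero.2 P.hθ₀) P.hb₀ P.regVary_w₀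
  obtain ⟨C, hC⟩ := funL_max_le P.adm
  refine ⟨1 + A * (B + C), le_self_add, fun f t ht => ?_⟩
  set k : ℝ → ℝ≥0∞ := fun u => peetreK A₀.qnorm A₁.qnorm u f with hk
  have hρ := P.ρ_pos ht
  have hw := P.w₀_pos ht
  have hβ := P.β_pos ht
  by_cases htop : k t = ∞
  · have h1 : ENNReal.ofReal (P.w₀ t * P.β t) ≠ 0 := by
      simpa using mul_pos hw hβ
    rw [holmstedt, htop, ENNReal.mul_top h1, add_top, top_add, ENNReal.mul_top]
    · exact le_top
    · rw [ENNReal.coe_ne_zero]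
      positivity
  by_cases h0 : k t = 0
  · have hf : f = 0 := eq_zero_of_peetreK_eq_zero A₀ A₁ ht h0
    have hz : ∀ w : ℝ → ℝ, (fun u => ENNReal.ofReal (w u) * peetreK A₀.qnorm A₁.qnorm u (0 : E)) =
        fun _ => 0 := fun w => by simp [peetreK_zero]
    have hmz : ∀ (q : ℝ≥0∞) (S : Set ℝ), mnorm q S (fun _ => 0) = 0 := fun q S => by
      simp [mnorm]
    have h1 := peetreK_le (fun f => P.X₀ fun u => peetreK A₀.qnorm A₁.qnorm u f)
      (fun f => P.X₁ fun u => peetreK A₀.qnorm A₁.qnorm u f) (P.ρ t) (0 : E) 0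
    have h2 : P.X₀ (fun u => peetreK A₀.qnorm A₁.qnorm u (0 : E)) = 0 := by
      simp only [X₀, funR, hz, hmz, mul_zero]
    have h3 : P.X₁ (fun u => peetreK A₀.qnorm A₁.qnorm u (0 : E)) = 0 := by
      simp only [X₁, funL, peetreK_zero, mul_zero, hmz]
    rw [h2, h3, mul_zero, add_zero, add_zero, ← hf] at h1
    exact h1.trans zero_le
  obtain ⟨f₀, f₁, hf, hf₀, hf₁⟩ := hA f t ht h0 htop
  have h1 : P.X₀ (fun u => peetreK A₀.qnorm A₁.qnorm u f₀) ≤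
      A * (B * (P.I₀ k t + ENNReal.ofReal (P.w₀ t * P.β t) * k t)) := by
    refine (weight_mul_mnorm_le (g := fun u => k (min u t)) P.hr₀ measurableSet_Ioi P.b₀
      (fun _ => measurableSet_Ioi) P.hq₀ P.w₀ (ENNReal.coe_ne_top (r := A))
      fun s hs u hu => hf₀ u (lt_trans hs hu)).trans ?_
    refine mul_le_mul' le_rfl ((hB k t ht htop).trans_eq ?_)
    rw [ENNReal.ofReal_mul hw.le, P.ofReal_β ht, mul_right_comm]
    rfl
  have h2 : P.X₁ (fun u => peetreK A₀.qnorm A₁.qnorm u f₁) ≤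
      A * (C * (P.I₁ k t + ENNReal.ofReal t⁻¹ * k t * ENNReal.ofReal (P.χ₁ t))) := by
    refine (weight_mul_mnorm_le
      (g := fun u => if u ≤ t then ENNReal.ofReal (u / t) * k t else k u) P.adm.hr measurableSet_Ioi
      P.b₁ (fun _ => measurableSet_Ioo) P.adm.hq (fun u => u ^ (-1 : ℝ) * P.a₁ u)
      (ENNReal.coe_ne_top (r := A)) fun s hs u hu => hf₁ u hu.1).trans ?_
    refine mul_le_mul' le_rfl ((hC k t ht htop).trans_eq ?_)
    rw [P.ofReal_χ₁ ht]
    rfl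
  have h3 : ENNReal.ofReal (P.ρ t) * (ENNReal.ofReal t⁻¹ * k t * ENNReal.ofReal (P.χ₁ t)) =
      ENNReal.ofReal (P.w₀ t * P.β t) * k t := by
    rw [← P.ρ_mul ht, ENNReal.ofReal_mul (by positivity), ENNReal.ofReal_mul hρ.le]
    ring
  set x := P.I₀ k t
  set y := ENNReal.ofReal (P.w₀ t * P.β t) * k t
  set z := ENNReal.ofReal (P.ρ t) * P.I₁ k t with hz
  calc P.K A₀ A₁ (P.ρ t) f
      ≤ P.X₀ (fun u => peetreK A₀.qnorm A₁.qnorm u f₀) +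
          ENNReal.ofReal (P.ρ t) * P.X₁ (fun u => peetreK A₀.qnorm A₁.qnorm u f₁) := by
        rw [hf]
        exact peetreK_le _ _ _ _ _
    _ ≤ A * (B * (x + y)) + ENNReal.ofReal (P.ρ t) *
          (A * (C * (P.I₁ k t + ENNReal.ofReal t⁻¹ * k t * ENNReal.ofReal (P.χ₁ t)))) :=
        add_le_add h1 (mul_le_mul' le_rfl h2)
    _ = A * B * (x + y) + A * C * (z + ENNReal.ofReal (P.ρ t) *
          (ENNReal.ofReal t⁻¹ * k t * ENNReal.ofReal (P.χ₁ t))) := by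
        rw [hz]
        ring
    _ = A * B * (x + y) + A * C * (z + y) := by rw [h3]
    _ ≤ A * B * (x + y + z) + A * C * (x + y + z) := by
        gcongr ?_ + ?_
        · exact mul_le_mul' le_rfl le_self_add
        · refine mul_le_mul' le_rfl ?_
          rw [add_assoc, add_comm z]
          exact le_add_self
    _ = A * (B + C) * (x + y + z) := by ring
    _ ≤ _ := by
        push_cast
        exact mul_le_mul' le_add_self le_rfl

end Holmstedt

/-! ### Hardy inequalities for the local functionals. -/

/-- The weight `w₀ β = t ^ (-θ₀) χ₀` multiplied by `W`. -/
theorem regVary_mul_w₀_β {γ : ℝ} {W : ℝ → ℝ} (hW : RegVary γ W) :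
    RegVary (γ - P.θ₀) fun u => W u * (P.w₀ u * P.β u) :=
  (hW.mul (P.regVary_w₀.mul P.regVary_β)).congr (by ring) fun _ _ => rfl

/-- The Schur test with σ the identity. If (u/t)^ε v(u) k(u) ≤ M for u < t, then k ≤ t^ε M / (u^ε v)
there. With ε = δ/2 the weight w₀ / (u^ε v) has index δ - ε > 0, so `I₀_le` applies; the powers of t
cancel and leave W I₀ ≲ M. -/
theorem hardy_I₀ {r : ℝ≥0∞} (hr : r ≠ 0) {δ : ℝ} (hδ : 0 < δ) {W : ℝ → ℝ} (hW : RegVary (-δ) W) :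
    ∃ D : ℝ≥0, ∀ k : ℝ → ℝ≥0∞, QuasiConc k →
      mnorm r (Ioi 0) (fun t => ENNReal.ofReal (W t) * P.I₀ k t) ≤
        D * mnorm r (Ioi 0) fun t => ENNReal.ofReal (W t * (P.w₀ t * P.β t)) * k t := by
  have hv := P.regVary_mul_w₀_β hW
  set v : ℝ → ℝ := fun u => W u * (P.w₀ u * P.β u) with hvdef
  set ε := δ / 2 with hε
  have hε0 : 0 < ε := by positivity
  have hψ : RegVary (ε + (-δ - P.θ₀)) fun u => u ^ ε * v u := (RegVary.rpow_id ε).mul hv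
  have hφ : RegVary ε fun u => P.w₀ u * (u ^ ε * v u)⁻¹ :=
    (P.regVary_w₀.mul hψ.inv).congr (by rw [hε]; ring) fun _ _ => rfl
  obtain ⟨B, hB1, hB⟩ := P.I₀_le hε0 (fun u hu => inv_pos.2 (hψ.pos u hu)) hφ
  obtain ⟨C, m, hC, hm, hmod⟩ := hv.moderate
  obtain ⟨D, hD⟩ := PowerLike.id.mnorm_le hr hε0 C m B
  refine ⟨D, fun k hk => hD _ _ (hmod k hk) fun t ht M hM => ?_⟩
  by_cases hMt : M = ∞
  · rw [hMt, ENNReal.mul_top]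
    · exact le_top
    · rw [ENNReal.coe_ne_zero]
      positivity
  have htε : 0 < t ^ ε := by positivity
  have hWt := hW.pos t ht
  have hvt := hv.pos t ht
  refine (mul_le_mul' le_rfl (hB k (ENNReal.ofReal (t ^ ε) * M) (by finiteness) t ht
    fun u hu => ?_)).trans_eq ?_
  · have hvu := hv.pos u hu.1
    have hu0 : 0 < u := hu.1
    refine le_mul_ofReal_inv (hψ.pos u hu0) ?_
    have e : ENNReal.ofReal (u ^ ε * v u) =
        ENNReal.ofReal (t ^ ε) * ENNReal.ofReal (ker u t ^ ε) * ENNReal.ofReal (v u) := by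
      rw [← ENNReal.ofReal_mul htε.le, ker_of_le hu0 hu.2.le, ← ENNReal.ofReal_mul (by positivity),
        Real.div_rpow hu0.le ht.le, mul_div_cancel₀ _ htε.ne']
    rw [e, mul_assoc, mul_assoc]
    exact mul_le_mul' le_rfl (hM u hu0)
  · rw [show ENNReal.ofReal (W t) * (B * (ENNReal.ofReal (t ^ ε) * M) *
        ENNReal.ofReal (P.w₀ t * P.β t * (t ^ ε * v t)⁻¹)) = B * M * (ENNReal.ofReal (W t) *
        ENNReal.ofReal (t ^ ε) * ENNReal.ofReal (P.w₀ t * P.β t * (t ^ ε * v t)⁻¹)) by ring,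
      ← ENNReal.ofReal_mul hWt.le, ← ENNReal.ofReal_mul (by positivity),
      show W t * t ^ ε * (P.w₀ t * P.β t * (t ^ ε * v t)⁻¹) = t ^ ε * v t * (t ^ ε * v t)⁻¹ by
        simp only [hvdef]; ring,
      mul_inv_cancel₀ (by positivity), ENNReal.ofReal_one, mul_one]

/-- The same argument on (t, ∞). The gap 1-θ₀-γ is halved: one half pays for the kernel, the other
leaves the negative index that `I₁_le` requires. -/
theorem hardy_I₁ {r : ℝ≥0∞} (hr : r ≠ 0) {γ : ℝ} (hγ : γ < 1 - P.θ₀) {W : ℝ → ℝ}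
    (hW : RegVary (-γ) W) : ∃ D : ℝ≥0, ∀ k : ℝ → ℝ≥0∞, QuasiConc k →
      mnorm r (Ioi 0) (fun t => ENNReal.ofReal (W t * P.ρ t) * P.I₁ k t) ≤
        D * mnorm r (Ioi 0) fun t => ENNReal.ofReal (W t * (P.w₀ t * P.β t)) * k t := by
  have hv := P.regVary_mul_w₀_β hW
  set v : ℝ → ℝ := fun u => W u * (P.w₀ u * P.β u) with hvdef
  set ε := (1 - P.θ₀ - γ) / 2 with hε
  have hε0 : 0 < ε := by linarith
  have hψ : RegVary (-ε + (-γ - P.θ₀)) fun u => u ^ (-ε) * v u := (RegVary.rpow_id (-ε)).mul hv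
  have hφ : RegVary (-ε) fun u => u ^ (-1 : ℝ) * P.a₁ u * (u ^ (-ε) * v u)⁻¹ :=
    (((RegVary.rpow_id (-1)).mul P.adm.ha).mul hψ.inv).congr (by rw [hε]; ring) fun _ _ => rfl
  obtain ⟨B, hB1, hB⟩ := P.I₁_le (neg_lt_zero.2 hε0) (fun u hu => inv_pos.2 (hψ.pos u hu)) hφ
  obtain ⟨C, m, hC, hm, hmod⟩ := hv.moderate
  obtain ⟨D, hD⟩ := PowerLike.id.mnorm_le hr hε0 C m B
  refine ⟨D, fun k hk => hD _ _ (hmod k hk) fun t ht M hM => ?_⟩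
  by_cases hMt : M = ∞
  · rw [hMt, ENNReal.mul_top]
    · exact le_top
    · rw [ENNReal.coe_ne_zero]
      positivity
  have htε : 0 < t ^ (-ε) := by positivity
  have hWt := hW.pos t ht
  have hvt := hv.pos t ht
  have hρt := P.ρ_pos ht
  refine (mul_le_mul' le_rfl (hB k (ENNReal.ofReal (t ^ (-ε)) * M) (by finiteness) t ht
    fun u hu => ?_)).trans_eq ?_
  · have hu0 : 0 < u := ht.trans hu
    have hvu := hv.pos u hu0
    refine le_mul_ofReal_inv (hψ.pos u hu0) ?_
    have e : ENNReal.ofReal (u ^ (-ε) * v u) =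
        ENNReal.ofReal (t ^ (-ε)) * ENNReal.ofReal (ker u t ^ ε) * ENNReal.ofReal (v u) := by
      rw [← ENNReal.ofReal_mul htε.le, ker_of_ge ht (le_of_lt hu),
        ← ENNReal.ofReal_mul (by positivity), Real.div_rpow ht.le hu0.le, Real.rpow_neg ht.le,
        Real.rpow_neg hu0.le, mul_div_assoc', inv_mul_cancel₀ (by positivity), one_div]
    rw [e, mul_assoc, mul_assoc]
    exact mul_le_mul' le_rfl (hM u hu0)
  · rw [show ENNReal.ofReal (W t * P.ρ t) * (B * (ENNReal.ofReal (t ^ (-ε)) * M) *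
        ENNReal.ofReal (t⁻¹ * (t ^ (-ε) * v t)⁻¹ * P.χ₁ t)) = B * M * (ENNReal.ofReal (W t * P.ρ t) *
        ENNReal.ofReal (t ^ (-ε)) * ENNReal.ofReal (t⁻¹ * (t ^ (-ε) * v t)⁻¹ * P.χ₁ t)) by ring,
      ← ENNReal.ofReal_mul (by positivity), ← ENNReal.ofReal_mul (by positivity),
      show W t * P.ρ t * t ^ (-ε) * (t⁻¹ * (t ^ (-ε) * v t)⁻¹ * P.χ₁ t) =
          t ^ (-ε) * (W t * (P.ρ t * t⁻¹ * P.χ₁ t)) * (t ^ (-ε) * v t)⁻¹ by ring,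
      P.ρ_mul ht, mul_inv_cancel₀ (by positivity), ENNReal.ofReal_one, mul_one]

/-- This index decides which Hardy inequality is available: `hardy_I₀` asks for θ > 0, `hardy_I₁`
for θ < 1. -/
theorem regVary_comp_ρ {a : ℝ → ℝ} (ha : RegVary 0 a) {θ : ℝ} (hθ : 0 ≤ θ) :
    RegVary (-((1 - P.θ₀) * θ)) fun t => P.ρ t ^ (-θ) * a (P.ρ t) :=
  ((P.regVary_ρ.rpow hθ).inv.mul (ha.comp P.regVary_ρ)).congr (add_zero _) fun t ht => by
    rw [Real.rpow_neg (P.ρ_pos ht).le]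

/-- I₀ and I₁ are measurable by monotonicity. By `ρ_mul` the middle term is W ρ times t⁻¹ χ₁ k, so
it shares a regularly varying weight with I₁ and can be split from it. -/
theorem mnorm_holmstedt_le {r : ℝ≥0∞} (hr : r ≠ 0) {γ : ℝ} {W : ℝ → ℝ} (hW : RegVary γ W) :
    ∃ C : ℝ≥0, ∀ k : ℝ → ℝ≥0∞,
      mnorm r (Ioi 0) (fun t => ENNReal.ofReal (W t) * P.holmstedt k t) ≤
        C * (mnorm r (Ioi 0) (fun t => ENNReal.ofReal (W t) * P.I₀ k t) +
          (mnorm r (Ioi 0) (fun t => ENNReal.ofReal (W t * P.ρ t) * P.I₁ k t) +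
          mnorm r (Ioi 0) fun t => ENNReal.ofReal (W t * (P.w₀ t * P.β t)) * k t)) := by
  obtain ⟨A, hA1, hA⟩ := mnorm_weight_add hr hW
  obtain ⟨B, hB1, hB⟩ := mnorm_weight_add hr (hW.mul P.regVary_ρ)
  refine ⟨A * B, fun k => ?_⟩
  have hm₀ : Measurable (P.I₀ k) := by
    refine Monotone.measurable fun s t hst => ?_
    refine le_trans (mnorm_mono measurableSet_Ioo fun u _ => mul_le_mul' le_rfl ?_)
      (mnorm_mono_set (Ioo_subset_Ioo_right hst) _)
    exact mnorm_mono_set (Ioo_subset_Ioo_right hst) _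
  have hm₁ : Measurable (P.I₁ k) := by
    refine Antitone.measurable fun s t hst => ?_
    refine le_trans (mnorm_mono measurableSet_Ioi fun u _ => mul_le_mul' le_rfl ?_)
      (mnorm_mono_set (Ioi_subset_Ioi hst) _)
    exact mnorm_mono_set (Ioo_subset_Ioo_left hst) _
  set x := mnorm r (Ioi 0) fun t => ENNReal.ofReal (W t) * P.I₀ k t
  set y := mnorm r (Ioi 0) fun t => ENNReal.ofReal (W t * P.ρ t) * P.I₁ k t
  set z := mnorm r (Ioi 0) fun t => ENNReal.ofReal (W t * (P.w₀ t * P.β t)) * k t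
  have h1 : mnorm r (Ioi 0) (fun t => ENNReal.ofReal (W t) *
      (ENNReal.ofReal (P.w₀ t * P.β t) * k t + ENNReal.ofReal (P.ρ t) * P.I₁ k t)) ≤
        B * (y + z) := by
    refine le_trans (le_of_eq ?_) ((hB (Ioi 0) measurableSet_Ioi le_rfl (P.I₁ k)
      (fun t => ENNReal.ofReal (t⁻¹ * P.χ₁ t) * k t) hm₁).trans_eq ?_)
    · refine mnorm_congr measurableSet_Ioi fun t ht => ?_
      have ht0 : 0 < t := ht
      have := P.ρ_pos ht0
      have := hW.pos t ht0
      rw [← P.ρ_mul ht0, mul_assoc (P.ρ t), ENNReal.ofReal_mul (p := P.ρ t) (by positivity),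
        ENNReal.ofReal_mul (p := W t) (by positivity)]
      ring
    · congr 2
      refine mnorm_congr measurableSet_Ioi fun t ht => ?_
      have ht0 : 0 < t := ht
      have := P.ρ_pos ht0
      have := hW.pos t ht0
      rw [← mul_assoc, ← ENNReal.ofReal_mul (by positivity), ← P.ρ_mul ht0]
      congr 2
      ring
  calc mnorm r (Ioi 0) (fun t => ENNReal.ofReal (W t) * P.holmstedt k t)
      = mnorm r (Ioi 0) (fun t => ENNReal.ofReal (W t) * (P.I₀ k t +
          (ENNReal.ofReal (P.w₀ t * P.β t) * k t + ENNReal.ofReal (P.ρ t) * P.I₁ k t))) := by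
        simp only [holmstedt, add_assoc]
    _ ≤ A * (x + mnorm r (Ioi 0) fun t => ENNReal.ofReal (W t) *
          (ENNReal.ofReal (P.w₀ t * P.β t) * k t + ENNReal.ofReal (P.ρ t) * P.I₁ k t)) :=
        hA (Ioi 0) measurableSet_Ioi le_rfl _ _ hm₀
    _ ≤ A * (B * x + B * (y + z)) := by
        gcongr
        exact le_mul_of_one_le_left zero_le (by exact_mod_cast hB1)
    _ = _ := by
        push_cast
        ring

theorem I₀_le_holmstedt (k : ℝ → ℝ≥0∞) (t : ℝ) : P.I₀ k t ≤ P.holmstedt k t := by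
  rw [holmstedt, add_assoc]
  exact le_self_add

theorem mid_le_holmstedt (k : ℝ → ℝ≥0∞) (t : ℝ) :
    ENNReal.ofReal (P.w₀ t * P.β t) * k t ≤ P.holmstedt k t := by
  rw [holmstedt, add_right_comm]
  exact le_add_self

theorem I₁_le_holmstedt (k : ℝ → ℝ≥0∞) (t : ℝ) :
    ENNReal.ofReal (P.ρ t) * P.I₁ k t ≤ P.holmstedt k t := le_add_self

/-! ### The interpolation norms for θ in (0, 1), θ = 0 and θ = 1. -/

section Interpolation

variable {𝕜 E : Type*} [RCLike 𝕜] [AddCommGroup E] [Module 𝕜 E] [TopologicalSpace E]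
  (A₀ A₁ : QuasiBanachIn 𝕜 E)

/-- The quasi-norm of `(𝓡, 𝓛)_{θ,r,a}`. -/
noncomputable def interp (θ : ℝ) (r : ℝ≥0∞) (a : ℝ → ℝ) (f : E) : ℝ≥0∞ :=
  mnorm r (Ioi 0) fun u => ENNReal.ofReal (u ^ (-θ) * a u) * P.K A₀ A₁ u f

theorem interp_le_holmstedt [IsTopologicalAddGroup E] [T2Space E] {r : ℝ≥0∞} (hr : r ≠ 0)
    {a : ℝ → ℝ} (ha : RegVary 0 a) (θ : ℝ) : ∃ C : ℝ≥0, ∀ f : E,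
      P.interp A₀ A₁ θ r a f ≤ C * mnorm r (Ioi 0) fun t =>
        ENNReal.ofReal (P.ρ t ^ (-θ) * a (P.ρ t)) *
          P.holmstedt (fun u => peetreK A₀.qnorm A₁.qnorm u f) t := by
  obtain ⟨C, hC1, hC⟩ := P.K_le_holmstedt A₀ A₁
  have hκ : 0 < 1 - P.θ₀ := by linarith [P.hθ₀']
  obtain ⟨D, hD⟩ := mnorm_le_comp hr hκ P.regVary_ρ ((RegVary.rpow_id (-θ)).mul ha)
  refine ⟨D * C, fun f => (hD _ (peetreK_quasiConc _ _ f)).trans ?_⟩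
  rw [ENNReal.coe_mul, mul_assoc]
  refine mul_le_mul' le_rfl ?_
  rw [← mnorm_const_mul hr _ ENNReal.coe_ne_top]
  refine (mnorm_mono measurableSet_Ioi fun t ht => ?_)
  rw [mul_left_comm]
  exact mul_le_mul' le_rfl (hC f t ht)

theorem holmstedt_le_interp {r : ℝ≥0∞} (hr : r ≠ 0) {a : ℝ → ℝ} (ha : RegVary 0 a) (θ : ℝ) :
    ∃ C : ℝ≥0, ∀ f : E, mnorm r (Ioi 0) (fun t =>
        ENNReal.ofReal (P.ρ t ^ (-θ) * a (P.ρ t)) *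
          P.holmstedt (fun u => peetreK A₀.qnorm A₁.qnorm u f) t) ≤
      C * P.interp A₀ A₁ θ r a f := by
  obtain ⟨C, hC1, hC⟩ := P.holmstedt_le_K A₀ A₁
  have hκ : 0 < 1 - P.θ₀ := by linarith [P.hθ₀']
  obtain ⟨D, hD⟩ := mnorm_comp_le hr hκ P.regVary_ρ ((RegVary.rpow_id (-θ)).mul ha)
  refine ⟨C * D, fun f => ?_⟩
  rw [ENNReal.coe_mul, mul_assoc]
  refine le_trans ?_ (mul_le_mul' le_rfl (hD _ (peetreK_quasiConc _ _ f)))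
  rw [← mnorm_const_mul hr _ ENNReal.coe_ne_top]
  refine mnorm_mono measurableSet_Ioi fun t ht => ?_
  rw [mul_left_comm]
  exact mul_le_mul' le_rfl (hC f t ht)

/-- The norm `‖ρ ^ (-θ) a(ρ) t ^ (-θ₀) χ₀ K(t, f)‖`. -/
noncomputable def midNorm (θ : ℝ) (r : ℝ≥0∞) (a : ℝ → ℝ) (f : E) : ℝ≥0∞ :=
  mnorm r (Ioi 0) fun t => ENNReal.ofReal (P.ρ t ^ (-θ) * a (P.ρ t) * (P.w₀ t * P.β t)) *
    peetreK A₀.qnorm A₁.qnorm t f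

theorem midNorm_le_interp {r : ℝ≥0∞} (hr : r ≠ 0) {a : ℝ → ℝ} (ha : RegVary 0 a) (θ : ℝ) :
    ∃ C : ℝ≥0, ∀ f : E, P.midNorm A₀ A₁ θ r a f ≤ C * P.interp A₀ A₁ θ r a f := by
  obtain ⟨C, hC⟩ := P.holmstedt_le_interp A₀ A₁ hr ha θ
  refine ⟨C, fun f => le_trans (mnorm_mono measurableSet_Ioi fun t ht => ?_) (hC f)⟩
  have h1 := P.ρ_pos (show 0 < t from ht)
  have h2 := ha.pos _ h1
  rw [ENNReal.ofReal_mul (p := P.ρ t ^ (-θ) * a (P.ρ t)) (by positivity), mul_assoc]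
  exact mul_le_mul' le_rfl (P.mid_le_holmstedt _ t)

variable [IsTopologicalAddGroup E] [T2Space E]

theorem interp_le_midNorm {r : ℝ≥0∞} (hr : r ≠ 0) {a : ℝ → ℝ} (ha : RegVary 0 a) {θ : ℝ}
    (hθ : 0 < θ) (hθ' : θ < 1) : ∃ C : ℝ≥0, ∀ f : E,
      P.interp A₀ A₁ θ r a f ≤ C * P.midNorm A₀ A₁ θ r a f := by
  have hκ : 0 < 1 - P.θ₀ := by linarith [P.hθ₀']
  have hW := P.regVary_comp_ρ ha hθ.le
  obtain ⟨C, hC⟩ := P.interp_le_holmstedt A₀ A₁ hr ha θ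
  obtain ⟨D, hD⟩ := P.mnorm_holmstedt_le hr hW
  obtain ⟨B₀, hB₀⟩ := P.hardy_I₀ hr (mul_pos hκ hθ) hW
  obtain ⟨B₁, hB₁⟩ := P.hardy_I₁ hr (mul_lt_of_lt_one_right hκ hθ') hW
  refine ⟨C * (D * (B₀ + (B₁ + 1))), fun f => ?_⟩
  have hk := peetreK_quasiConc A₀.qnorm A₁.qnorm f
  calc P.interp A₀ A₁ θ r a f ≤ C * (D * (B₀ * P.midNorm A₀ A₁ θ r a f +
        (B₁ * P.midNorm A₀ A₁ θ r a f + P.midNorm A₀ A₁ θ r a f))) :=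
        (hC f).trans (mul_le_mul' le_rfl ((hD _).trans (mul_le_mul' le_rfl
          (add_le_add (hB₀ _ hk) (add_le_add (hB₁ _ hk) le_rfl)))))
    _ = _ := by
        push_cast
        ring

/-- The weight has index 0, so only I₁ can be absorbed into the middle term; that term in turn is
pointwise ≲ I₀ by `exists_le_I₀`. -/
theorem interp_equiv_zero {r : ℝ≥0∞} (hr : r ≠ 0) {a : ℝ → ℝ} (ha : RegVary 0 a) :
    ∃ C : ℝ≥0, ∀ f : E,
      P.interp A₀ A₁ 0 r a f ≤ C * (mnorm r (Ioi 0) fun t =>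
        ENNReal.ofReal (a (P.ρ t)) * P.I₀ (fun u => peetreK A₀.qnorm A₁.qnorm u f) t) ∧
      (mnorm r (Ioi 0) fun t =>
        ENNReal.ofReal (a (P.ρ t)) * P.I₀ (fun u => peetreK A₀.qnorm A₁.qnorm u f) t) ≤
          C * P.interp A₀ A₁ 0 r a f := by
  have hκ : 0 < 1 - P.θ₀ := by linarith [P.hθ₀']
  have hW := P.regVary_comp_ρ ha le_rfl
  obtain ⟨C, hC⟩ := P.interp_le_holmstedt A₀ A₁ hr ha 0
  obtain ⟨D, hD⟩ := P.mnorm_holmstedt_le hr hW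
  obtain ⟨B₁, hB₁⟩ := P.hardy_I₁ hr (by simpa using hκ) hW
  obtain ⟨F, hF⟩ := P.exists_le_I₀
  obtain ⟨G, hG⟩ := P.holmstedt_le_interp A₀ A₁ hr ha 0
  refine ⟨C * (D * (1 + (B₁ + 1) * F)) + G, fun f => ?_⟩
  have hk := peetreK_quasiConc A₀.qnorm A₁.qnorm f
  have hW0 : ∀ t, P.ρ t ^ (-(0 : ℝ)) * a (P.ρ t) = a (P.ρ t) := fun t => by simp
  set x := mnorm r (Ioi 0) fun t =>
    ENNReal.ofReal (a (P.ρ t)) * P.I₀ (fun u => peetreK A₀.qnorm A₁.qnorm u f) t with hx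
  have hmid : P.midNorm A₀ A₁ 0 r a f ≤ F * x := by
    rw [hx, ← mnorm_const_mul hr _ ENNReal.coe_ne_top]
    refine mnorm_mono measurableSet_Ioi fun t ht => ?_
    have h1 := ha.pos _ (P.ρ_pos (show 0 < t from ht))
    rw [hW0, ENNReal.ofReal_mul h1.le, mul_assoc, mul_left_comm (F : ℝ≥0∞)]
    exact mul_le_mul' le_rfl (hF _ hk t ht)
  have hDf := hD fun u => peetreK A₀.qnorm A₁.qnorm u f
  have hB₁f := hB₁ _ hk
  constructor
  · have h1 : P.interp A₀ A₁ 0 r a f ≤ C * (D * (x + (B₁ * P.midNorm A₀ A₁ 0 r a f +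
        P.midNorm A₀ A₁ 0 r a f))) := by
      refine (hC f).trans (mul_le_mul' le_rfl (hDf.trans (mul_le_mul' le_rfl
        (add_le_add (le_of_eq ?_) (add_le_add hB₁f le_rfl)))))
      simp only [hW0, hx]
    refine h1.trans ?_
    calc C * (D * (x + (B₁ * P.midNorm A₀ A₁ 0 r a f + P.midNorm A₀ A₁ 0 r a f)))
        ≤ C * (D * (x + (B₁ * (F * x) + F * x))) := by gcongr
      _ = (C * (D * (1 + (B₁ + 1) * F)) : ℝ≥0) * x := by
          push_cast
          ring
      _ ≤ _ := by
          gcongr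
          exact le_self_add
  · refine le_trans (mnorm_mono measurableSet_Ioi fun t _ => ?_) ((hG f).trans ?_)
    · rw [hW0]
      exact mul_le_mul' le_rfl (P.I₀_le_holmstedt _ t)
    · gcongr
      exact le_add_self

/-- Only I₀ can be absorbed here. The factor ρ in front of I₁ cancels ρ⁻¹ from the weight, and the
middle term has to be kept. -/
theorem interp_equiv_one {r : ℝ≥0∞} (hr : r ≠ 0) {a : ℝ → ℝ} (ha : RegVary 0 a) :
    ∃ C : ℝ≥0, ∀ f : E,
      P.interp A₀ A₁ 1 r a f ≤ C * (P.midNorm A₀ A₁ 1 r a f + mnorm r (Ioi 0) fun t =>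
        ENNReal.ofReal (a (P.ρ t)) * P.I₁ (fun u => peetreK A₀.qnorm A₁.qnorm u f) t) ∧
      (mnorm r (Ioi 0) fun t =>
        ENNReal.ofReal (a (P.ρ t)) * P.I₁ (fun u => peetreK A₀.qnorm A₁.qnorm u f) t) ≤
          C * P.interp A₀ A₁ 1 r a f := by
  have hκ : 0 < 1 - P.θ₀ := by linarith [P.hθ₀']
  have hW := P.regVary_comp_ρ ha zero_le_one
  obtain ⟨C, hC⟩ := P.interp_le_holmstedt A₀ A₁ hr ha 1
  obtain ⟨D, hD⟩ := P.mnorm_holmstedt_le hr hW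
  obtain ⟨B₀, hB₀⟩ := P.hardy_I₀ hr (by simpa using hκ) hW
  obtain ⟨G, hG⟩ := P.holmstedt_le_interp A₀ A₁ hr ha 1
  refine ⟨C * (D * (B₀ + 1)) + G, fun f => ?_⟩
  have hk := peetreK_quasiConc A₀.qnorm A₁.qnorm f
  have hW1 : ∀ t : ℝ, 0 < t → P.ρ t ^ (-(1 : ℝ)) * a (P.ρ t) * P.ρ t = a (P.ρ t) :=
    fun t ht => by
      rw [Real.rpow_neg_one, mul_right_comm, inv_mul_cancel₀ (P.ρ_pos ht).ne', one_mul]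
  set x := mnorm r (Ioi 0) fun t =>
    ENNReal.ofReal (a (P.ρ t)) * P.I₁ (fun u => peetreK A₀.qnorm A₁.qnorm u f) t with hx
  have hDf := hD fun u => peetreK A₀.qnorm A₁.qnorm u f
  set y := P.midNorm A₀ A₁ 1 r a f with hy
  constructor
  · have h1 : P.interp A₀ A₁ 1 r a f ≤ C * (D * (B₀ * y + (x + y))) := by
      refine (hC f).trans (mul_le_mul' le_rfl (hDf.trans (mul_le_mul' le_rfl
        (add_le_add (hB₀ _ hk) (add_le_add (le_of_eq ?_) le_rfl)))))
      exact mnorm_congr measurableSet_Ioi fun t ht => by rw [hW1 t ht]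
    refine h1.trans ?_
    calc C * (D * (B₀ * y + (x + y))) ≤ C * (D * (B₀ * (y + x) + (y + x))) := by
          rw [add_comm x y]
          gcongr
          exact le_self_add
      _ = (C * (D * (B₀ + 1)) : ℝ≥0) * (y + x) := by
          push_cast
          ring
      _ ≤ _ := by
          gcongr
          exact le_self_add
  · refine le_trans (mnorm_mono measurableSet_Ioi fun t ht => ?_) ((hG f).trans ?_)
    · have h1 := P.ρ_pos (show 0 < t from ht)
      have h2 := ha.pos _ h1
      rw [← hW1 t ht, ENNReal.ofReal_mul (p := P.ρ t ^ (-(1 : ℝ)) * a (P.ρ t)) (by positivity),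
        mul_assoc, hW1 t ht]
      exact mul_le_mul' le_rfl (P.I₁_le_holmstedt _ t)
    · gcongr
      exact le_add_self

end Interpolation

end Params

/-! ### Translation to the norms of the statement, and conclusion. -/

theorem Embeds.of_le {E : Type*} {N M : E → ℝ≥0∞} {C : ℝ≥0} (h : ∀ f, M f ≤ C * N f) :
    Embeds N M :=
  ⟨fun f hf => (h f).trans_lt (ENNReal.mul_lt_top ENNReal.coe_lt_top hf), C, fun f _ => h f⟩

theorem wnorm_one {q : ℝ≥0∞} (hq : q ≠ 0) {S : Set ℝ} (hS : MeasurableSet S) (hS0 : S ⊆ Ioi 0)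
    (w : ℝ → ℝ) : wnorm q 0 S w (fun _ => 1) = mnorm q S fun u => ENNReal.ofReal (w u) := by
  rw [wnorm_eq_mnorm hq 0 hS hS0]
  simp

theorem wnorm_zero {q : ℝ≥0∞} (hq : q ≠ 0) {S : Set ℝ} (hS : MeasurableSet S) (hS0 : S ⊆ Ioi 0)
    (w : ℝ → ℝ) {F G : ℝ → ℝ≥0∞} (h : ∀ u ∈ S, F u = G u) :
    wnorm q 0 S w F = mnorm q S fun u => ENNReal.ofReal (w u) * G u := by
  rw [wnorm_eq_mnorm hq 0 hS hS0]
  refine mnorm_congr hS fun u hu => ?_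
  rw [h u hu, Real.rpow_zero, one_mul]

theorem chi0_eq {r₀ : ℝ≥0∞} (hr₀ : r₀ ≠ 0) (b₀ a₀ : ℝ → ℝ) (t : ℝ) :
    chi0 r₀ b₀ a₀ t = a₀ t * (mnorm r₀ (Ioo 0 t) fun u => ENNReal.ofReal (b₀ u)).toReal := by
  rw [chi0, wnorm_one hr₀ measurableSet_Ioo Ioo_subset_Ioi_self]

theorem chi1_eq {r₁ q₁ : ℝ≥0∞} (hr₁ : r₁ ≠ 0) (hq₁ : q₁ ≠ 0) (b₁ a₁ : ℝ → ℝ) {t : ℝ}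
    (ht : 0 < t) : chi1 r₁ b₁ q₁ a₁ t = (primitiveSum r₁ b₁ q₁ a₁ t).toReal := by
  rw [chi1, wnorm_zero hr₁ measurableSet_Ioo Ioo_subset_Ioi_self b₁ fun s _ =>
      wnorm_one hq₁ measurableSet_Ioo Ioo_subset_Ioi_self a₁,
    wnorm_one hr₁ measurableSet_Ioi (Ioi_subset_Ioi ht.le),
    wnorm_one hq₁ measurableSet_Ioo Ioo_subset_Ioi_self]
  rfl

theorem normR_eq {E : Type*} [AddCommGroup E] (N₀ N₁ : E → ℝ≥0∞) (θ : ℝ) {r q : ℝ≥0∞} (hr : r ≠ 0)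
    (hq : q ≠ 0) (b a : ℝ → ℝ) (f : E) :
    normR N₀ N₁ θ r b q a f = funR r b q (fun u => u ^ (-θ) * a u) fun u => peetreK N₀ N₁ u f :=
  wnorm_zero hr measurableSet_Ioi le_rfl b fun _ hs =>
    wnorm_eq_mnorm hq _ measurableSet_Ioi (Ioi_subset_Ioi (le_of_lt hs)) _ _

theorem normL_eq {E : Type*} [AddCommGroup E] (N₀ N₁ : E → ℝ≥0∞) (θ : ℝ) {r q : ℝ≥0∞} (hr : r ≠ 0)
    (hq : q ≠ 0) (b a : ℝ → ℝ) (f : E) :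
    normL N₀ N₁ θ r b q a f = funL r b q (fun u => u ^ (-θ) * a u) fun u => peetreK N₀ N₁ u f :=
  wnorm_zero hr measurableSet_Ioi le_rfl b fun _ _ =>
    wnorm_eq_mnorm hq _ measurableSet_Ioo Ioo_subset_Ioi_self _ _

theorem normRL_eq {E : Type*} [AddCommGroup E] (N₀ N₁ : E → ℝ≥0∞) (θ : ℝ) {s r q : ℝ≥0∞}
    (hs : s ≠ 0) (hr : r ≠ 0) (hq : q ≠ 0) (c b a : ℝ → ℝ) (f : E) :
    normRL N₀ N₁ θ s c r b q a f = mnorm s (Ioi 0) fun t => ENNReal.ofReal (c t) *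
      locR r b q (fun u => u ^ (-θ) * a u) (fun u => peetreK N₀ N₁ u f) t :=
  wnorm_zero hs measurableSet_Ioi le_rfl c fun _ _ =>
    wnorm_zero hr measurableSet_Ioo Ioo_subset_Ioi_self b fun _ hu =>
      wnorm_eq_mnorm hq _ measurableSet_Ioo (fun _ hv => hu.1.trans hv.1) _ _

theorem normLR_eq {E : Type*} [AddCommGroup E] (N₀ N₁ : E → ℝ≥0∞) (θ : ℝ) {s r q : ℝ≥0∞}
    (hs : s ≠ 0) (hr : r ≠ 0) (hq : q ≠ 0) (c b a : ℝ → ℝ) (f : E) :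
    normLR N₀ N₁ θ s c r b q a f = mnorm s (Ioi 0) fun t => ENNReal.ofReal (c t) *
      locL r b q (fun u => u ^ (-θ) * a u) (fun u => peetreK N₀ N₁ u f) t :=
  wnorm_zero hs measurableSet_Ioi le_rfl c fun _ ht =>
    wnorm_zero hr measurableSet_Ioi (Ioi_subset_Ioi (le_of_lt ht)) b fun _ _ =>
      wnorm_eq_mnorm hq _ measurableSet_Ioo (fun _ hv => lt_trans ht hv.1) _ _

namespace Params

variable (P : Params)

/-- With ρ = t^(1-θ₀) χ₀/χ₁ and w₀ β = t^(-θ₀) χ₀, the exponents of t add up to -η and those of χ₀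
to 1-θ. Thus the middle norm is a standard norm. -/
theorem weight_eq (a : ℝ → ℝ) (θ : ℝ) {t : ℝ} (ht : 0 < t) :
    P.ρ t ^ (-θ) * a (P.ρ t) * (P.w₀ t * P.β t) = t ^ (-((1 - θ) * P.θ₀ + θ)) *
      ((P.a₀ t * P.β t) ^ (1 - θ) * P.χ₁ t ^ θ * a (P.ρ t)) := by
  have hχ₀ : 0 < P.a₀ t * P.β t := mul_pos (P.ha₀.pos t ht) (P.β_pos ht)
  have hχ₁ := P.χ₁_pos ht
  have h1 : P.ρ t ^ (-θ) =
      t ^ ((1 - P.θ₀) * -θ) * ((P.a₀ t * P.β t) ^ (-θ) * P.χ₁ t ^ θ) := by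
    rw [ρ, Real.mul_rpow (by positivity) (by positivity), ← Real.rpow_mul ht.le,
      Real.div_rpow hχ₀.le hχ₁.le, Real.rpow_neg hχ₁.le, div_inv_eq_mul]
  have h2 : P.w₀ t * P.β t = t ^ (-P.θ₀) * (P.a₀ t * P.β t) := by
    rw [w₀]
    ring
  have h3 : (P.a₀ t * P.β t) ^ (1 - θ) = (P.a₀ t * P.β t) ^ (-θ) * (P.a₀ t * P.β t) := by
    rw [← Real.rpow_add_one hχ₀.ne']
    ring_nf
  have h4 : t ^ (-((1 - θ) * P.θ₀ + θ)) = t ^ ((1 - P.θ₀) * -θ) * t ^ (-P.θ₀) := by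
    rw [← Real.rpow_add ht]
    ring_nf
  rw [h1, h2, h3, h4]
  ring

end Params

end LimitingInterpolation

theorem theorem38 {𝕜 E : Type*} [RCLike 𝕜] [AddCommGroup E] [Module 𝕜 E] [TopologicalSpace E]
    [IsTopologicalAddGroup E] [ContinuousSMul 𝕜 E] [T2Space E]
    (A₀ A₁ : QuasiBanachIn 𝕜 E)
    (hA : ∃ x : E, x ≠ 0 ∧ A₀.qnorm x < ∞ ∧ A₁.qnorm x < ∞)
    (θ₀ : ℝ) (hθ₀ : 0 < θ₀) (hθ₀' : θ₀ < 1)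
    (r r₀ q₀ r₁ q₁ : ℝ≥0∞) (hr : 0 < r) (hr₀ : 0 < r₀) (hq₀ : 0 < q₀) (hr₁ : 0 < r₁) (hq₁ : 0 < q₁)
    (a a₀ b₀ a₁ b₁ : ℝ → ℝ) (ha : SlowlyVarying a) (ha₀ : SlowlyVarying a₀)
    (hb₀ : SlowlyVarying b₀) (ha₁ : SlowlyVarying a₁) (hb₁ : SlowlyVarying b₁)
    (h₀ : wnorm r₀ 0 (Ioo 0 1) b₀ (fun _ => 1) < ∞)
    (h₁ : wnorm r₁ 0 (Ioi 1) b₁ (fun _ => 1) < ∞)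
    (h₁' : wnorm r₁ 0 (Ioo 0 1) b₁ (fun s => wnorm q₁ 0 (Ioo 0 s) a₁ fun _ => 1) < ∞)
    (χ₀ χ₁ ρ : ℝ → ℝ) (hχ₀ : χ₀ = chi0 r₀ b₀ a₀) (hχ₁ : χ₁ = chi1 r₁ b₁ q₁ a₁)
    (hρ : ρ = rho θ₀ χ₀ χ₁)
    (X₀ X₁ : E → ℝ≥0∞)
    (hX₀ : X₀ = normR A₀.qnorm A₁.qnorm θ₀ r₀ b₀ q₀ a₀)
    (hX₁ : X₁ = normL A₀.qnorm A₁.qnorm 1 r₁ b₁ q₁ a₁) :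
    (∀ θ η : ℝ, 0 < θ → θ < 1 → η = (1 - θ) * θ₀ + θ →
      SpaceEq (stdNorm X₀ X₁ θ r a)
        (stdNorm A₀.qnorm A₁.qnorm η r (aSharp θ χ₀ χ₁ ρ a))) ∧
    (wnorm r 0 (Ioi 1) a (fun _ => 1) < ∞ →
      SpaceEq (stdNorm X₀ X₁ 0 r a)
        (normRL A₀.qnorm A₁.qnorm θ₀ r (a ∘ ρ) r₀ b₀ q₀ a₀)) ∧
    (wnorm r 0 (Ioo 0 1) a (fun _ => 1) < ∞ →
      SpaceEq (stdNorm X₀ X₁ 1 r a)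
        (interNorm (stdNorm A₀.qnorm A₁.qnorm 1 r (aSharp 1 χ₀ χ₁ ρ a))
          (normLR A₀.qnorm A₁.qnorm 1 r (a ∘ ρ) r₁ b₁ q₁ a₁))) := by
  have hr' := hr.ne'
  let P : Params :=
    { θ₀ := θ₀, r₀ := r₀, q₀ := q₀, r₁ := r₁, q₁ := q₁, a₀ := a₀, b₀ := b₀, a₁ := a₁, b₁ := b₁
      hθ₀ := hθ₀
      hθ₀' := hθ₀'
      hr₀ := hr₀.ne'
      hq₀ := hq₀.ne'
      ha₀ := ha₀.regVary
      hb₀ := hb₀.regVary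
      fin₀ := by
        rw [← wnorm_one hr₀.ne' measurableSet_Ioo Ioo_subset_Ioi_self]
        exact h₀.ne
      adm :=
        { hr := hr₁.ne'
          hq := hq₁.ne'
          ha := ha₁.regVary
          hb := hb₁.regVary
          fin_top := by
            rw [← wnorm_one hr₁.ne' measurableSet_Ioi (Ioi_subset_Ioi zero_le_one)]
            exact h₁.ne
          fin_zero := by
            rw [← wnorm_zero hr₁.ne' measurableSet_Ioo Ioo_subset_Ioi_self b₁ fun s _ =>
              wnorm_one hq₁.ne' measurableSet_Ioo Ioo_subset_Ioi_self a₁]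
            exact h₁'.ne } }
  have hχ₀' : ∀ t, χ₀ t = P.a₀ t * P.β t := fun t => by
    rw [hχ₀]
    exact chi0_eq hr₀.ne' b₀ a₀ t
  have hχ₁' : ∀ t, 0 < t → χ₁ t = P.χ₁ t := fun t ht => by
    rw [hχ₁]
    exact chi1_eq hr₁.ne' hq₁.ne' b₁ a₁ ht
  have hρ' : ∀ t, 0 < t → ρ t = P.ρ t := fun t ht => by
    rw [hρ, rho, hχ₀', hχ₁' t ht]
    rfl
  have hX₀' : X₀ = fun f => P.X₀ fun u => peetreK A₀.qnorm A₁.qnorm u f := by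
    rw [hX₀]
    exact funext fun f => normR_eq _ _ _ hr₀.ne' hq₀.ne' _ _ f
  have hX₁' : X₁ = fun f => P.X₁ fun u => peetreK A₀.qnorm A₁.qnorm u f := by
    rw [hX₁]
    exact funext fun f => normL_eq _ _ _ hr₁.ne' hq₁.ne' _ _ f
  have hstd : ∀ θ f, stdNorm X₀ X₁ θ r a f = P.interp A₀ A₁ θ r a f := fun θ f => by
    rw [hX₀', hX₁']
    exact wnorm_eq_mnorm hr' _ measurableSet_Ioi le_rfl _ _
  have hmid : ∀ θ η f, η = (1 - θ) * θ₀ + θ →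
      stdNorm A₀.qnorm A₁.qnorm η r (aSharp θ χ₀ χ₁ ρ a) f = P.midNorm A₀ A₁ θ r a f := by
    intro θ η f hη
    refine (wnorm_eq_mnorm hr' _ measurableSet_Ioi le_rfl _ _).trans
      (mnorm_congr measurableSet_Ioi fun t ht => ?_)
    rw [P.weight_eq a θ ht, aSharp, hχ₀', hχ₁' t ht, hρ' t ht, hη]
  refine ⟨fun θ η hθ hθ' hη => ?_, fun _ => ?_, fun _ => ?_⟩
  · obtain ⟨C, hC⟩ := P.interp_le_midNorm A₀ A₁ hr' ha.regVary hθ hθ'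
    obtain ⟨D, hD⟩ := P.midNorm_le_interp A₀ A₁ hr' ha.regVary θ
    refine ⟨Embeds.of_le (C := D) fun f => ?_, Embeds.of_le (C := C) fun f => ?_⟩
    · rw [hstd, hmid θ η f hη]
      exact hD f
    · rw [hstd, hmid θ η f hη]
      exact hC f
  · obtain ⟨C, hC⟩ := P.interp_equiv_zero A₀ A₁ hr' ha.regVary
    have hRL : ∀ f, normRL A₀.qnorm A₁.qnorm θ₀ r (a ∘ ρ) r₀ b₀ q₀ a₀ f = mnorm r (Ioi 0) fun t =>
        ENNReal.ofReal (a (P.ρ t)) * P.I₀ (fun u => peetreK A₀.qnorm A₁.qnorm u f) t := fun f =>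
      (normRL_eq _ _ _ hr' hr₀.ne' hq₀.ne' _ _ _ f).trans
        (mnorm_congr measurableSet_Ioi fun t ht => by
          rw [Function.comp_apply, hρ' t ht]
          rfl)
    refine ⟨Embeds.of_le (C := C) fun f => ?_, Embeds.of_le (C := C) fun f => ?_⟩
    · rw [hstd, hRL]
      exact (hC f).2
    · rw [hstd, hRL]
      exact (hC f).1
  · obtain ⟨C, hC⟩ := P.interp_equiv_one A₀ A₁ hr' ha.regVary
    obtain ⟨D, hD⟩ := P.midNorm_le_interp A₀ A₁ hr' ha.regVary 1
    have hLR : ∀ f, normLR A₀.qnorm A₁.qnorm 1 r (a ∘ ρ) r₁ b₁ q₁ a₁ f = mnorm r (Ioi 0) fun t =>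
        ENNReal.ofReal (a (P.ρ t)) * P.I₁ (fun u => peetreK A₀.qnorm A₁.qnorm u f) t := fun f =>
      (normLR_eq _ _ _ hr' hr₁.ne' hq₁.ne' _ _ _ f).trans
        (mnorm_congr measurableSet_Ioi fun t ht => by
          rw [Function.comp_apply, hρ' t ht]
          rfl)
    have h1 : (1 : ℝ) = (1 - 1) * θ₀ + 1 := by ring
    -- The norm of the intersection is a maximum, while the estimate bounds by a sum; hence the
    -- factor 2.
    refine ⟨Embeds.of_le (C := C + D) fun f => ?_, Embeds.of_le (C := C * 2) fun f => ?_⟩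
    · rw [hstd, interNorm, hLR, hmid 1 1 f h1, ENNReal.coe_add, add_mul]
      exact max_le ((hD f).trans le_add_self) ((hC f).2.trans le_self_add)
    · rw [hstd, interNorm, hLR, hmid 1 1 f h1, ENNReal.coe_mul, mul_assoc, ENNReal.coe_two, two_mul]
      exact (hC f).1.trans
        (mul_le_mul' le_rfl (add_le_add (le_max_left _ _) (le_max_right _ _)))
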